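/- \textbf{Setting.} Let $T$ (threads), $O$ (hash-table objects), $K$ (keys, linearly ordered), $V$ (values) be arbitrary, and let every table $o\in O$ have $m$ buckets, bucket $\mathrm{hash}(o,k)$ being responsible for key $k$. HT-OSTM is the following concurrent algorithm; an \emph{execution} is any finite interleaving of atomic steps of the threads (each step makes at most one access to a mutable shared field), starting from empty tables, with arbitrary method invocations: a thread without a live transaction may invoke $STM\_begin$, and between two methods of a live transaction it may invoke any of $insert(o,k,v)$, $delete(o,k)$, $lookup(o,k)$, $tryC$, $tryA$. \emph{Shared memory.} Each bucket is a lazy red-blue list: a head with key $-\infty$, a tail with key $+\infty$, and nodes with fields key, value, reentrant lock, \textit{marked}, time-stamps $ts.insert$, $ts.delete$, $ts.lookup$ (initially $0$), a red link $RL$ and a blue link $BL$; initially both links of the head point to the tail. A counter starts at $1$. \emph{begin.} Empties the local log and atomically gets and increments the counter; the number obtained is the transaction's time-stamp $TS$. \emph{lslSearch$(o,k)$.} Repeat: starting from the head follow $BL$ until the next node $c_b$ has key $\ge k$ ($p_b$ is its predecessor); starting from $p_b$ follow $RL$ likewise to obtain $p_r,c_r$; lock $p_b,p_r,c_r,c_b$;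 check that $p_b$ and $c_b$ are unmarked, $p_b.BL=c_b$ and $p_r.RL=c_r$; if this fails, unlock all four and retry. Otherwise, if $c_b$ (or else $c_r$) has key $k$, check for that node that $TS\ge ts.insert$ and $TS\ge ts.delete$ and, when called by $tryC$, $TS\ge ts.lookup$; if this fails, unlock all four and report abort. Otherwise return with the four locks held. \emph{insert.} Purely local: sets the log entry of $\langle o,k\rangle$ to INSERT with value $v$. \emph{lookup, delete.} If $\langle o,k\rangle$ has a log entry, the method is local and returns the value of the entry, or nil if the entry is DELETE; a delete turns the entry into DELETE with value nil, and a lookup keeps the operation and value of the entry. Otherwise it runs lslSearch. On abort it returns abort, and the transaction ends. If $c_b$ has key $k$, it sets $c_b.ts.lookup:=TS$ and returns $c_b$'s value; else if $c_r$ has key $k$, it sets $c_r.ts.lookup:=TS$ and returns nil; else it inserts a marked node with key $k$ between $p_r$ and $c_r$ in the red list only, sets its $ts.lookup:=TS$, and returns nil. It then unlocks $p_b,p_r,c_r,c_b$ and creates the log entry (LOOKUP with the observed value, or DELETE with value nil). \emph{tryC.} Takes the INSERT and DELETE entries of the log in increasing order of keys. First loop: run lslSearch for each entry and record $p_b,p_r,c_r,c_b$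 in it; if one of them reports abort, the transaction aborts and releases the locks held for earlier entries. Second loop, for each entry $e$, with $e'$ the previous entry of the same bucket: if $p_b$ is marked or $p_b.BL\ne c_b$, unlock $p_b$, replace it by $e'.p_b.BL$ if $e'$ is INSERT and by $e'.p_b$ otherwise, and lock it; if $p_r.RL\ne c_r$, unlock $p_r$, replace it by $e'.p_r.RL$, and lock it. Then for INSERT of $v$: if $c_b$ has key $k$, set its value to $v$ and $ts.insert:=TS$; else if $c_r$ has key $k$, set its value to $v$, unmark it, set $c_r.BL:=c_b$, $p_b.BL:=c_r$, $c_r.ts.insert:=TS$; else create a locked unmarked node $n$ with key $k$ and value $v$ and set $n.RL:=c_r$, $n.BL:=c_b$, $p_r.RL:=n$, $p_b.BL:=n$, $n.ts.insert:=TS$. For DELETE: if $c_b$ has key $k$, mark it, set $p_b.BL:=c_b.BL$, $c_b.ts.delete:=TS$. Finally release all locks entry by entry ($p_b,p_r$, the created node, $c_r,c_b$) and return ok. \emph{tryA} aborts. \emph{Linearization points.} begin: the counter increment; insert and a log-only lookup or delete: the access to the log; lookup or delete on the shared memory: its first unlock after lslSearch has succeeded; a committing $tryC$: the first unlock of the final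 release (its end, if there is nothing to release); an aborting method: the step at which it aborts. The \emph{sequential history} $H$ of an execution consists of all methods that have passed their linearization point, with arguments and returned values, in the order of these points, preceded by an initial transaction $T_0$ that deletes every key occurring in the execution and commits. Transactions are identified by their time-stamps. \emph{Legality.} For a key $\langle o,k\rangle$ and a position $i$ of $H$, a committed transaction $T_p$ is a \emph{last updater} at $i$ if it has an insert or delete on the key and commits before $i$, and no transaction with an insert or delete on the key commits between $T_p$'s commit and $i$. $H$ is \emph{legal} if every non-aborting lookup or delete of a transaction $T_t$, $t\ne 0$, on any $\langle o,k\rangle$, at position $i$ with returned value $r\in V\cup\{\mathrm{nil}\}$, satisfies: (LR1) if the previous method of $T_t$ on the key is $insert(o,k,v)$, then $r=v$; if it is a lookup that returned $r'$, then $r=r'$; if it is a delete, then $r=\mathrm{nil}$; (LR2) if it is the first method of $T_t$ on the key and $r=v\ne\mathrm{nil}$, then a last updater at $i$ has a method $insert(o,k,v)$; (LR3) if it is the first method of $T_t$ on the key and $r=\mathrm{nil}$, then a last updater at $i$ has a method $delete(o,k)$. \textbf{Theorem.} For every execution of HT-OSTM, the sequential history $H$ generated at method level is legal. Moreover, every non-aborting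 lookup or delete of a transaction $T_t$, $t\ne0$, that is the first method of $T_t$ on its key $\langle o,k\rangle$ returns the value of the closest preceding committed update: there is a last updater at its position whose last insert or delete on $\langle o,k\rangle$ is either $insert(o,k,v)$, and the value returned is $v$, or $delete(o,k)$, and the value returned is nil. -/

import Mathlib

namespace HTOSTM

/-! ### Methods and method-level histories

Transactions are numbered by `ℕ`; number `0` is the initial transaction `T₀`. `O` is the type of
hash-table objects, `K` of keys, `V` of values; `Option V` adds the value `nil`. -/

/-- What a `lookup` or `delete` returns: a value or `nil`, or the abort value. -/
inductive Result (V : Type*) where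
  | ret (r : Option V)
  | abort

/-- A method together with its arguments and its return value. `tryC true` is a successful commit,
`tryC false` an aborting one. `insert` always returns `ok`, `tryA` always aborts. -/
inductive Meth (O K V : Type*) where
  | stmBegin
  | ins (o : O) (k : K) (v : V)
  | del (o : O) (k : K) (r : Result V)
  | look (o : O) (k : K) (r : Result V)
  | tryC (ok : Bool)
  | tryA

/-- A method of the transaction `tx`. -/
structure MExec (O K V : Type*) where
  tx : ℕ
  meth : Meth O K V

section Histories

variable {O K V : Type*}

/-- The hash-table key on which a method operates, if any. -/
def Meth.key? : Meth O K V → Option (O × K)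
  | .ins o k _ => some (o, k)
  | .del o k _ => some (o, k)
  | .look o k _ => some (o, k)
  | _ => none

/-- `m` is an update method (`insert` or `delete`) on `⟨o, k⟩`. -/
def Meth.IsUpdate (m : Meth O K V) (o : O) (k : K) : Prop :=
  (∃ v, m = .ins o k v) ∨ ∃ r, m = .del o k r

/-- `m` is a return-value method (`lookup` or `delete`) on `⟨o, k⟩` that returned `r`
(a value or `nil`, not an abort). -/
def Meth.IsRv (m : Meth O K V) (o : O) (k : K) (r : Option V) : Prop :=
  m = .look o k (.ret r) ∨ m = .del o k (.ret r)

/-- A sequential history: its methods are atomic, hence it is a list of methods, and the method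
real-time order is the order of positions. -/
abbrev SeqHistory (O K V : Type*) := List (MExec O K V)

namespace SeqHistory

variable (H : SeqHistory O K V)

/-- Position `i` of `H` is a method of transaction `t` on `⟨o, k⟩`. -/
def OnKey (i t : ℕ) (o : O) (k : K) : Prop :=
  ∃ m, H[i]? = some (MExec.mk t m) ∧ m.key? = some (o, k)

/-- Position `i` of `H` is an update method of transaction `t` on `⟨o, k⟩`. -/
def UpdateAt (i t : ℕ) (o : O) (k : K) : Prop :=
  ∃ m, H[i]? = some (MExec.mk t m) ∧ m.IsUpdate o k

/-- Position `c` of `H` is the successful `tryC` of transaction `t`. -/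
def CommitAt (c t : ℕ) : Prop := H[c]? = some (MExec.mk t (.tryC true))

/-- No method of `t` on `⟨o, k⟩` stands before position `i`. -/
def NoneBefore (i t : ℕ) (o : O) (k : K) : Prop := ∀ j < i, ¬ H.OnKey j t o k

/-- `j` is the position of the previous method (before position `i`) of `t` on `⟨o, k⟩`. -/
def IsPrev (j i t : ℕ) (o : O) (k : K) : Prop :=
  j < i ∧ H.OnKey j t o k ∧ ∀ l, j < l → l < i → ¬ H.OnKey l t o k

/-- Transaction `p` commits at position `c`, before position `i`, and no transaction that has an
update method on `⟨o, k⟩` commits between the positions `c` and `i`. -/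
def LastCommit (c p i : ℕ) (o : O) (k : K) : Prop :=
  H.CommitAt c p ∧ c < i ∧
    ¬ ∃ x y d, H.UpdateAt y x o k ∧ H.CommitAt d x ∧ c < d ∧ d < i

/-- First rule: a return-value method that is not the first method of its transaction on the key
agrees with the previous method of the transaction on the key. -/
def LR1 (i t : ℕ) (o : O) (k : K) (r : Option V) : Prop :=
  ∀ j m, H.IsPrev j i t o k → H[j]? = some (MExec.mk t m) →
    (∀ v, m = .ins o k v → r = some v) ∧
    (∀ r', m = .look o k (.ret r') → r = r') ∧
    (∀ r', m = .del o k (.ret r') → r = none)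

/-- Second rule: if the first method of the transaction on the key returns `v ≠ nil`, then the
last transaction that updates the key and commits before it has a method `insert(o, k, v)`. -/
def LR2 (i t : ℕ) (o : O) (k : K) (r : Option V) : Prop :=
  ∀ v, r = some v → H.NoneBefore i t o k →
    ∃ p q c : ℕ, H[q]? = some (MExec.mk p (.ins o k v)) ∧ H.LastCommit c p i o k

/-- Third rule: if the first method of the transaction on the key returns `nil`, then the
last transaction that updates the key and commits before it has a method `delete(o, k)`. -/
def LR3 (i t : ℕ) (o : O) (k : K) (r : Option V) : Prop :=
  r = none → H.NoneBefore i t o k →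
    ∃ (p q c : ℕ) (r' : Result V), H[q]? = some (MExec.mk p (.del o k r')) ∧ H.LastCommit c p i o k

/-- Legality. `T₀` merely stands for the initial, empty hash-tables, so its own `delete`s are
not constrained. -/
def Legal : Prop :=
  ∀ i t m o k r, H[i]? = some (MExec.mk t m) → t ≠ 0 → m.IsRv o k r →
    H.LR1 i t o k r ∧ H.LR2 i t o k r ∧ H.LR3 i t o k r

/-- `q` is the position of the last update method of `p` on `⟨o, k⟩`. -/
def IsLastUpdate (q p : ℕ) (o : O) (k : K) : Prop :=
  H.UpdateAt q p o k ∧ ∀ q', q < q' → ¬ H.UpdateAt q' p o k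

/-- Every `lookup` or `delete` that is the first method of its transaction on its key returns what
the closest preceding committed update method on the key leaves there: the value of an `insert`,
`nil` for a `delete`. -/
def ReturnsClosest : Prop :=
  ∀ i t m o k r, H[i]? = some (MExec.mk t m) → t ≠ 0 → m.IsRv o k r → H.NoneBefore i t o k →
    ∃ p q c u, H.LastCommit c p i o k ∧ H.IsLastUpdate q p o k ∧ H[q]? = some (MExec.mk p u) ∧
      ((∃ v, u = .ins o k v ∧ r = some v) ∨ ((∃ r', u = .del o k r') ∧ r = none))

end SeqHistory

/-- Does the method end its transaction? -/
def Meth.isFinal : Meth O K V → Bool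
  | .del _ _ .abort => true
  | .look _ _ .abort => true
  | .tryC _ => true
  | .tryA => true
  | _ => false

end Histories

/-! ### Shared memory: lazy red-blue lists -/

/-- Addresses of nodes: the two sentinels of each bucket of each hash-table, and the cells that are
allocated during the execution. -/
inductive Addr (O : Type*) (m : ℕ) where
  | head (o : O) (b : Fin m)
  | tail (o : O) (b : Fin m)
  | cell (n : ℕ)
  deriving DecidableEq

/-- A node of a lazy red-blue list. `T` is the type of threads. The lock is reentrant: it stores its
owner and how often the owner holds it. `none` is the null pointer in `rl` and `bl`. -/
structure Node (T O K V : Type*) (m : ℕ) where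
  key : WithBot (WithTop K)
  val : Option V := none
  lock : Option (T × ℕ) := none
  marked : Bool := false
  tsIns : ℕ := 0
  tsDel : ℕ := 0
  tsLook : ℕ := 0
  rl : Option (Addr O m) := none
  bl : Option (Addr O m) := none

/-- The shared memory: nodes, the next unallocated cell, and the counter `sh_cntr`. -/
structure Shared (T O K V : Type*) (m : ℕ) where
  heap : Addr O m → Node T O K V m
  fresh : ℕ
  cntr : ℕ

/-- The methods as invoked, with their arguments. -/
inductive Op (O K V : Type*) where
  | stmBegin
  | ins (o : O) (k : K) (v : V)
  | del (o : O) (k : K)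
  | look (o : O) (k : K)
  | tryC
  | tryA

/-- Method names in the local log. -/
inductive Opn where
  | insert
  | delete
  | lookup

/-- `op_status` of a method in the local log. -/
inductive Status where
  | ok
  | fail

/-- An entry of the local log. `node` is the node created for the entry by `tryC`, if any. -/
structure LogEntry (O K V : Type*) (m : ℕ) where
  obj : O
  key : K
  opn : Opn
  val : Option V
  st : Status
  bp : Addr O m := .cell 0
  rp : Addr O m := .cell 0
  rc : Addr O m := .cell 0
  bc : Addr O m := .cell 0
  node : Option (Addr O m) := none

/-! ### Program counters

Each value of the program counter stands for one atomic step, which makes at most one access to a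
mutable field of the shared memory (together with local computation and reads of the immutable keys). -/

/-- Program points of `lslSearch`, with the lock acquisition and the validation it calls. The argument
of the `unlock` points tells whether the search aborts (`true`) or retries (`false`). -/
inductive SearchPC where
  | start
  | readBl | testBlKey
  | readRl | testRlKey
  | lockBp | lockRp | lockRc | lockBc
  | valBpMarked | valBcMarked | valBpBl | valRpRl
  | aptCurr | tsIns | tsDel | tsLook
  | unlockBp (ab : Bool) | unlockRp (ab : Bool) | unlockRc (ab : Bool) | unlockBc (ab : Bool)

/-- Program points of `commonLu&Del` after a successful search. -/
inductive RvPC where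
  | dispatch
  | blueTs | blueVal
  | redTs
  | newNode | newMarked | newRl | linkRl | newTs
  | unlockBp | unlockRp | unlockRc | unlockBc
  | log

/-- Program points of the second loop of `tryC`: `intraTransValidation` for the current log entry, then
its effect on the lists. -/
inductive UpdPC where
  | load
  | testBpMarked | testBpBl | unlockBp | newBp | lockBp
  | testRpRl | unlockRp | newRp | lockRp
  | dispatch
  | ovVal | ovTs
  | reVal | reMarked | reBl | reLink | reTs
  | newNode | newLock | newRl | newBl | linkRl | linkBl | newTs | newField
  | delMarked | delRead | delLink | delTs
  | finish

/-- Program points of `release_ordered_locks`. -/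
inductive RelPC where
  | loop
  | bp | rp | node | rc | bc

/-- Who calls `lslSearch`: a `delete` (`rv true`), a `lookup` (`rv false`), or `tryC`. -/
inductive Caller where
  | rv (isDel : Bool)
  | tryC

/-- Program counters. `idle`: no live transaction. `ready`: a live transaction, between two methods. -/
inductive PC (O K V : Type*) where
  | idle
  | ready
  | stmBegin
  | ins (o : O) (k : K) (v : V)
  | rvStart (isDel : Bool) (o : O) (k : K)
  | search (c : Caller) (o : O) (k : K) (s : SearchPC)
  | rvEff (isDel : Bool) (o : O) (k : K) (s : RvPC)
  | rvAbort (isDel : Bool) (o : O) (k : K)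
  | tcStart
  | tcLoop
  | tcFound
  | tcAbort
  | updLoop
  | upd (s : UpdPC)
  | rel (ok : Bool) (s : RelPC)
  | tryA
  | ret (m : Meth O K V)

/-- The local state of a thread. `bp`, `rp` are `preds[0]`, `preds[1]`; `rc`, `bc` are `currs[0]`,
`currs[1]`. `todo` and `done` are the remaining and the treated entries of the ordered log in the loops
of `tryC`; `lpDone` tells whether `tryC` has passed its linearization point. -/
structure Local (O K V : Type*) (m : ℕ) where
  pc : PC O K V := .idle
  tx : ℕ := 0
  log : List (LogEntry O K V m) := []
  bp : Addr O m := .cell 0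
  rp : Addr O m := .cell 0
  rc : Addr O m := .cell 0
  bc : Addr O m := .cell 0
  cur : Addr O m := .cell 0
  node : Addr O m := .cell 0
  tmp : Option (Addr O m) := none
  val : Option V := none
  st : Status := .ok
  todo : List (LogEntry O K V m) := []
  done : List (LogEntry O K V m) := []
  lpDone : Bool := false

/-- Method-level events of a concurrent execution: invocations, linearization points, responses. -/
inductive Event (T O K V : Type*) where
  | inv (t : T) (op : Op O K V)
  | lp (t : T) (e : MExec O K V)
  | rsp (t : T) (e : MExec O K V)

section Algorithm

variable {T O K V : Type*} [DecidableEq T] [DecidableEq O] [LinearOrder K] {m : ℕ}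

/-- A key of the hash-table as the key of a node; `⊥` and `⊤` are the keys of head and tail. -/
def nodeKey (k : K) : WithBot (WithTop K) := ((k : WithTop K) : WithBot (WithTop K))

/-- Change the node at address `a`. -/
def Shared.modify (g : Shared T O K V m) (a : Addr O m)
    (f : Node T O K V m → Node T O K V m) : Shared T O K V m :=
  { g with heap := Function.update g.heap a (f (g.heap a)) }

/-- `new node()`: allocate an unlocked, unmarked node with null links. -/
def Shared.alloc (g : Shared T O K V m) (k : K) (v : Option V) : Shared T O K V m :=
  { g with
    heap := Function.update g.heap (.cell g.fresh) { key := nodeKey k, val := v }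
    fresh := g.fresh + 1 }

/-- `lock()` by thread `t`; `none` means that `t` has to wait. -/
def Shared.lock (g : Shared T O K V m) (t : T) (a : Addr O m) : Option (Shared T O K V m) :=
  match (g.heap a).lock with
  | none => some (g.modify a fun n => { n with lock := some (t, 1) })
  | some (u, c) =>
    if u = t then some (g.modify a fun n => { n with lock := some (t, c + 1) }) else none

/-- `unlock()` by thread `t`. -/
def Shared.unlock (g : Shared T O K V m) (t : T) (a : Addr O m) : Shared T O K V m :=
  match (g.heap a).lock with
  | none => g
  | some (u, c) =>
    if u = t then
      g.modify a fun n => { n with lock := if c ≤ 1 then none else some (t, c - 1) }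
    else g

/-- The initial shared memory: every bucket has only its sentinels. The counter has been incremented
once, by the initial transaction `T₀`. -/
def Shared.initial : Shared T O K V m where
  heap
    | .head o b => { key := ⊥, rl := some (.tail o b), bl := some (.tail o b) }
    | .tail _ _ => { key := ⊤ }
    | .cell _ => { key := ⊤ }
  fresh := 0
  cntr := 1

/-- `findInLL`. -/
def findInLL (log : List (LogEntry O K V m)) (o : O) (k : K) : Option (LogEntry O K V m) :=
  log.find? fun e => decide (e.obj = o ∧ e.key = k)

/-- Store the entry `e` in the log, in place of the entry for the same key if there is one. -/
def putLL (log : List (LogEntry O K V m)) (e : LogEntry O K V m) : List (LogEntry O K V m) :=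
  match findInLL log e.obj e.key with
  | none => log ++ [e]
  | some _ => log.map fun e' => if e'.obj = e.obj ∧ e'.key = e.key then e else e'

/-- Does `tryC` treat the entry? Only updates are treated. -/
def Opn.isUpdate : Opn → Bool
  | .lookup => false
  | _ => true

/-- `ordered_ll_list`: the updates of the log, in increasing order of keys. -/
def orderedLL (log : List (LogEntry O K V m)) : List (LogEntry O K V m) :=
  (log.filter fun e => e.opn.isUpdate).insertionSort fun a b => a.key ≤ b.key

/-- The method recorded for a return-value method. -/
def rvMeth (isDel : Bool) (o : O) (k : K) (r : Result V) : Meth O K V :=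
  if isDel then .del o k r else .look o k r

/-- A `lookup` or `delete` whose key has the log entry `e`: returned value and new log entry. -/
def rvLocal (isDel : Bool) (e : LogEntry O K V m) : Option V × LogEntry O K V m :=
  match isDel, e.opn with
  | false, .delete => (none, { e with st := .fail })
  | false, _ => (e.val, e)
  | true, .insert => (e.val, { e with val := none, opn := .delete, st := .ok })
  | true, .delete => (none, { e with val := none, st := .fail })
  | true, .lookup => (e.val, { e with val := none, opn := .delete })

/-- The previous treated entry of the same bucket as `e`. -/
def prevSameBucket (hash : O → K → Fin m) (done : List (LogEntry O K V m))
    (e : LogEntry O K V m) : Option (LogEntry O K V m) :=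
  done.reverse.find? fun e' => decide (e'.obj = e.obj ∧ hash e'.obj e'.key = hash e.obj e.key)

/-- One atomic step: new shared memory, new local state, event of the step. `none`: no step possible. -/
abbrev Outcome (T O K V : Type*) (m : ℕ) :=
  Option (Shared T O K V m × Local O K V m × Option (Event T O K V))

/-- `lslSearch` for `⟨o, k⟩`. -/
def stepSearch (hash : O → K → Fin m) (t : T) (g : Shared T O K V m) (l : Local O K V m)
    (c : Caller) (o : O) (k : K) : SearchPC → Outcome T O K V m :=
  let at_ (s : SearchPC) : PC O K V := .search c o k s
  let found : PC O K V :=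
    match c with
    | .rv d => .rvEff d o k .dispatch
    | .tryC => .tcFound
  let aborted : PC O K V :=
    match c with
    | .rv d => .rvAbort d o k
    | .tryC => .tcAbort
  fun
  | .start => some (g, { l with bp := .head o (hash o k), pc := at_ .readBl }, none)
  | .readBl =>
    match (g.heap l.bp).bl with
    | some a => some (g, { l with bc := a, pc := at_ .testBlKey }, none)
    | none => none
  | .testBlKey =>
    if (g.heap l.bc).key < nodeKey k then
      some (g, { l with bp := l.bc, pc := at_ .readBl }, none)
    else some (g, { l with rp := l.bp, pc := at_ .readRl }, none)
  | .readRl =>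
    match (g.heap l.rp).rl with
    | some a => some (g, { l with rc := a, pc := at_ .testRlKey }, none)
    | none => none
  | .testRlKey =>
    if (g.heap l.rc).key < nodeKey k then
      some (g, { l with rp := l.rc, pc := at_ .readRl }, none)
    else some (g, { l with pc := at_ .lockBp }, none)
  | .lockBp => (g.lock t l.bp).map fun g' => (g', { l with pc := at_ .lockRp }, none)
  | .lockRp => (g.lock t l.rp).map fun g' => (g', { l with pc := at_ .lockRc }, none)
  | .lockRc => (g.lock t l.rc).map fun g' => (g', { l with pc := at_ .lockBc }, none)
  | .lockBc => (g.lock t l.bc).map fun g' => (g', { l with pc := at_ .valBpMarked }, none)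
  | .valBpMarked =>
    some (g, { l with pc := at_ (if (g.heap l.bp).marked then .unlockBp false else .valBcMarked) },
      none)
  | .valBcMarked =>
    some (g, { l with pc := at_ (if (g.heap l.bc).marked then .unlockBp false else .valBpBl) },
      none)
  | .valBpBl =>
    some (g, { l with pc := at_ (if (g.heap l.bp).bl ≠ some l.bc then .unlockBp false
      else .valRpRl) }, none)
  | .valRpRl =>
    some (g, { l with pc := at_ (if (g.heap l.rp).rl ≠ some l.rc then .unlockBp false
      else .aptCurr) }, none)
  | .aptCurr =>
    if (g.heap l.bc).key = nodeKey k then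
      some (g, { l with cur := l.bc, pc := at_ .tsIns }, none)
    else if (g.heap l.rc).key = nodeKey k then
      some (g, { l with cur := l.rc, pc := at_ .tsIns }, none)
    else some (g, { l with pc := found }, none)
  | .tsIns =>
    some (g, { l with pc := at_ (if l.tx < (g.heap l.cur).tsIns then .unlockBp true
      else .tsDel) }, none)
  | .tsDel =>
    if l.tx < (g.heap l.cur).tsDel then some (g, { l with pc := at_ (.unlockBp true) }, none)
    else
      match c with
      | .rv _ => some (g, { l with pc := found }, none)
      | .tryC => some (g, { l with pc := at_ .tsLook }, none)
  | .tsLook =>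
    some (g, { l with pc := if l.tx < (g.heap l.cur).tsLook then at_ (.unlockBp true)
      else found }, none)
  | .unlockBp ab => some (g.unlock t l.bp, { l with pc := at_ (.unlockRp ab) }, none)
  | .unlockRp ab => some (g.unlock t l.rp, { l with pc := at_ (.unlockRc ab) }, none)
  | .unlockRc ab => some (g.unlock t l.rc, { l with pc := at_ (.unlockBc ab) }, none)
  | .unlockBc ab =>
    some (g.unlock t l.bc, { l with pc := if ab then aborted else at_ .start }, none)

/-- `commonLu&Del` after a successful search. The linearization point is the first unlocking. -/
def stepRv (t : T) (g : Shared T O K V m) (l : Local O K V m)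
    (d : Bool) (o : O) (k : K) : RvPC → Outcome T O K V m :=
  let at_ (s : RvPC) : PC O K V := .rvEff d o k s
  fun
  | .dispatch =>
    if (g.heap l.bc).key = nodeKey k then some (g, { l with pc := at_ .blueTs }, none)
    else if (g.heap l.rc).key = nodeKey k then some (g, { l with pc := at_ .redTs }, none)
    else some (g, { l with pc := at_ .newNode }, none)
  | .blueTs =>
    some (g.modify l.bc fun n => { n with tsLook := l.tx }, { l with pc := at_ .blueVal }, none)
  | .blueVal =>
    some (g, { l with val := (g.heap l.bc).val, st := .ok, pc := at_ .unlockBp }, none)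
  | .redTs =>
    some (g.modify l.rc fun n => { n with tsLook := l.tx },
      { l with val := none, st := .fail, pc := at_ .unlockBp }, none)
  | .newNode =>
    some (g.alloc k none, { l with node := .cell g.fresh, pc := at_ .newMarked }, none)
  | .newMarked =>
    some (g.modify l.node fun n => { n with marked := true }, { l with pc := at_ .newRl }, none)
  | .newRl =>
    some (g.modify l.node fun n => { n with rl := some l.rc }, { l with pc := at_ .linkRl }, none)
  | .linkRl =>
    some (g.modify l.rp fun n => { n with rl := some l.node }, { l with pc := at_ .newTs }, none)
  | .newTs =>
    some (g.modify l.node fun n => { n with tsLook := l.tx },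
      { l with val := none, st := .fail, pc := at_ .unlockBp }, none)
  | .unlockBp =>
    some (g.unlock t l.bp, { l with pc := at_ .unlockRp },
      some (.lp t ⟨l.tx, rvMeth d o k (.ret l.val)⟩))
  | .unlockRp => some (g.unlock t l.rp, { l with pc := at_ .unlockRc }, none)
  | .unlockRc => some (g.unlock t l.rc, { l with pc := at_ .unlockBc }, none)
  | .unlockBc => some (g.unlock t l.bc, { l with pc := at_ .log }, none)
  | .log =>
    let e : LogEntry O K V m :=
      { obj := o, key := k, opn := if d then .delete else .lookup,
        val := if d then none else l.val, st := l.st,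
        bp := l.bp, rp := l.rp, rc := l.rc, bc := l.bc }
    some (g, { l with log := putLL l.log e, pc := .ret (rvMeth d o k (.ret l.val)) }, none)

/-- Second loop of `tryC`; the current log entry `e` is the first entry of `todo`, and `rest` is the
remainder of `todo`. -/
def stepUpd (hash : O → K → Fin m) (t : T) (g : Shared T O K V m) (l : Local O K V m)
    (e : LogEntry O K V m) (rest : List (LogEntry O K V m)) : UpdPC → Outcome T O K V m :=
  let go (g' : Shared T O K V m) (s : UpdPC) : Outcome T O K V m :=
    some (g', { l with pc := .upd s }, none)
  fun
  | .load =>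
    some (g, { l with bp := e.bp, rp := e.rp, rc := e.rc, bc := e.bc, pc := .upd .testBpMarked },
      none)
  | .testBpMarked => go g (if (g.heap l.bp).marked then .unlockBp else .testBpBl)
  | .testBpBl => go g (if (g.heap l.bp).bl ≠ some l.bc then .unlockBp else .testRpRl)
  | .unlockBp => go (g.unlock t l.bp) .newBp
  | .newBp =>
    match prevSameBucket hash l.done e with
    | none => none
    | some e' =>
      match e'.opn with
      | .insert =>
        match (g.heap e'.bp).bl with
        | none => none
        | some a => some (g, { l with bp := a, pc := .upd .lockBp }, none)
      | _ => some (g, { l with bp := e'.bp, pc := .upd .lockBp }, none)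
  | .lockBp => (g.lock t l.bp).bind fun g' => go g' .testRpRl
  | .testRpRl => go g (if (g.heap l.rp).rl ≠ some l.rc then .unlockRp else .dispatch)
  | .unlockRp => go (g.unlock t l.rp) .newRp
  | .newRp =>
    match prevSameBucket hash l.done e with
    | none => none
    | some e' =>
      match (g.heap e'.rp).rl with
      | none => none
      | some a => some (g, { l with rp := a, pc := .upd .lockRp }, none)
  | .lockRp => (g.lock t l.rp).bind fun g' => go g' .dispatch
  | .dispatch =>
    match e.opn with
    | .insert =>
      if (g.heap l.bc).key = nodeKey e.key then go g .ovVal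
      else if (g.heap l.rc).key = nodeKey e.key then go g .reVal
      else go g .newNode
    | .delete => if (g.heap l.bc).key = nodeKey e.key then go g .delMarked else go g .finish
    | .lookup => go g .finish
  -- the key is in the blue list: overwrite the value
  | .ovVal => go (g.modify l.bc fun n => { n with val := e.val }) .ovTs
  | .ovTs => go (g.modify l.bc fun n => { n with tsIns := l.tx }) .finish
  -- the key is only in the red list: `lslIns(RL_BL)`
  | .reVal => go (g.modify l.rc fun n => { n with val := e.val }) .reMarked
  | .reMarked => go (g.modify l.rc fun n => { n with marked := false }) .reBl
  | .reBl => go (g.modify l.rc fun n => { n with bl := some l.bc }) .reLink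
  | .reLink => go (g.modify l.bp fun n => { n with bl := some l.rc }) .reTs
  | .reTs => go (g.modify l.rc fun n => { n with tsIns := l.tx }) .finish
  -- the key is in neither list: `lslIns(BL)`
  | .newNode =>
    some (g.alloc e.key e.val, { l with node := .cell g.fresh, pc := .upd .newLock }, none)
  | .newLock => (g.lock t l.node).bind fun g' => go g' .newRl
  | .newRl => go (g.modify l.node fun n => { n with rl := some l.rc }) .newBl
  | .newBl => go (g.modify l.node fun n => { n with bl := some l.bc }) .linkRl
  | .linkRl => go (g.modify l.rp fun n => { n with rl := some l.node }) .linkBl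
  | .linkBl => go (g.modify l.bp fun n => { n with bl := some l.node }) .newTs
  | .newTs => go (g.modify l.node fun n => { n with tsIns := l.tx }) .newField
  | .newField =>
    some (g, { l with todo := { e with node := (g.heap l.bp).bl } :: rest, pc := .upd .finish },
      none)
  -- `lslDel`
  | .delMarked => go (g.modify l.bc fun n => { n with marked := true }) .delRead
  | .delRead => some (g, { l with tmp := (g.heap l.bc).bl, pc := .upd .delLink }, none)
  | .delLink => go (g.modify l.bp fun n => { n with bl := l.tmp }) .delTs
  | .delTs => go (g.modify l.bc fun n => { n with tsDel := l.tx }) .finish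
  | .finish =>
    some (g, { l with done := l.done ++ [{ e with bp := l.bp, rp := l.rp }], todo := rest,
                      pc := .updLoop }, none)

/-- `release_ordered_locks` on the entries in `todo`. For a committing `tryC` the first unlocking is the
linearization point; if there is no update, hence no unlocking, it is the end of the empty loop. -/
def stepRel (t : T) (g : Shared T O K V m) (l : Local O K V m) (ok : Bool) :
    RelPC → Outcome T O K V m :=
  let point : Option (Event T O K V) :=
    if l.lpDone then none else some (.lp t ⟨l.tx, .tryC ok⟩)
  let at_ (s : RelPC) : PC O K V := .rel ok s
  fun
  | .loop =>
    match l.todo with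
    | [] => some (g, { l with lpDone := true, pc := .ret (.tryC ok) }, point)
    | _ :: _ => some (g, { l with pc := at_ .bp }, none)
  | .bp =>
    match l.todo with
    | [] => none
    | e :: _ => some (g.unlock t e.bp, { l with lpDone := true, pc := at_ .rp }, point)
  | .rp =>
    match l.todo with
    | [] => none
    | e :: _ => some (g.unlock t e.rp, { l with pc := at_ .node }, none)
  | .node =>
    match l.todo with
    | [] => none
    | e :: _ =>
      match e.node with
      | none => some (g, { l with pc := at_ .rc }, none)
      | some a => some (g.unlock t a, { l with pc := at_ .rc }, none)
  | .rc =>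
    match l.todo with
    | [] => none
    | e :: _ => some (g.unlock t e.rc, { l with pc := at_ .bc }, none)
  | .bc =>
    match l.todo with
    | [] => none
    | e :: rest => some (g.unlock t e.bc, { l with todo := rest, pc := at_ .loop }, none)

/-- One atomic step of thread `t` inside a method. A thread that is `idle` or `ready` has no such step. -/
def stepThread (hash : O → K → Fin m) (t : T) (g : Shared T O K V m) (l : Local O K V m) :
    Outcome T O K V m :=
  match l.pc with
  | .idle => none
  | .ready => none
  | .stmBegin =>
    some ({ g with cntr := g.cntr + 1 },
      { l with tx := g.cntr, log := [], pc := .ret .stmBegin }, some (.lp t ⟨g.cntr, .stmBegin⟩))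
  | .ins o k v =>
    let e : LogEntry O K V m :=
      (findInLL l.log o k).getD { obj := o, key := k, opn := .insert, val := some v, st := .ok }
    some (g, { l with log := putLL l.log { e with val := some v, opn := .insert, st := .ok },
                      pc := .ret (.ins o k v) }, some (.lp t ⟨l.tx, .ins o k v⟩))
  | .rvStart d o k =>
    match findInLL l.log o k with
    | none => some (g, { l with pc := .search (.rv d) o k .start }, none)
    | some e =>
      let (r, e') := rvLocal d e
      some (g, { l with log := putLL l.log e', pc := .ret (rvMeth d o k (.ret r)) },
        some (.lp t ⟨l.tx, rvMeth d o k (.ret r)⟩))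
  | .search c o k s => stepSearch hash t g l c o k s
  | .rvEff d o k s => stepRv t g l d o k s
  | .rvAbort d o k =>
    some (g, { l with pc := .ret (rvMeth d o k .abort) }, some (.lp t ⟨l.tx, rvMeth d o k .abort⟩))
  | .tcStart => some (g, { l with todo := orderedLL l.log, done := [], pc := .tcLoop }, none)
  -- first loop: locate, lock and validate every update
  | .tcLoop =>
    match l.todo with
    | [] => some (g, { l with todo := l.done, done := [], pc := .updLoop }, none)
    | e :: _ => some (g, { l with pc := .search .tryC e.obj e.key .start }, none)
  | .tcFound =>
    match l.todo with
    | [] => none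
    | e :: rest =>
      some (g, { l with
        todo := rest
        done := l.done ++ [{ e with bp := l.bp, rp := l.rp, rc := l.rc, bc := l.bc, node := none }]
        pc := .tcLoop }, none)
  -- the transaction aborts; the locks of the entries that have been treated are released
  | .tcAbort =>
    some (g, { l with todo := l.done, done := [], lpDone := true, pc := .rel false .loop },
      some (.lp t ⟨l.tx, .tryC false⟩))
  -- second loop: perform the updates
  | .updLoop =>
    match l.todo with
    | [] => some (g, { l with todo := l.done, done := [], lpDone := false, pc := .rel true .loop }, none)
    | _ :: _ => some (g, { l with pc := .upd .load }, none)
  | .upd s =>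
    match l.todo with
    | [] => none
    | e :: rest => stepUpd hash t g l e rest s
  | .rel ok s => stepRel t g l ok s
  | .tryA => some (g, { l with pc := .ret .tryA }, some (.lp t ⟨l.tx, .tryA⟩))
  | .ret r =>
    some (g, { l with pc := if r.isFinal then .idle else .ready }, some (.rsp t ⟨l.tx, r⟩))

/-- First program point of an invoked method. A thread without a live transaction may only begin one;
a thread with a live transaction, between two methods, may invoke any other method. -/
def invoke (p : PC O K V) (op : Op O K V) : Option (PC O K V) :=
  match p, op with
  | .idle, .stmBegin => some .stmBegin
  | .ready, .ins o k v => some (.ins o k v)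
  | .ready, .del o k => some (.rvStart true o k)
  | .ready, .look o k => some (.rvStart false o k)
  | .ready, .tryC => some .tcStart
  | .ready, .tryA => some .tryA
  | _, _ => none

/-- A global state: the shared memory and the local states of the threads. -/
structure State (T O K V : Type*) (m : ℕ) where
  shared : Shared T O K V m
  locals : T → Local O K V m

/-- The initial state: empty hash-tables, no live transaction. -/
def State.initial : State T O K V m where
  shared := Shared.initial
  locals _ := {}

/-- `Exec hash E σ`: some execution of the algorithm (any interleaving of the steps of the threads, with
any method invocations) leads from the initial state to `σ` and produces the events `E`. Bucket number
`hash o k` of the table `o` is responsible for the key `k`. -/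
inductive Exec (hash : O → K → Fin m) : List (Event T O K V) → State T O K V m → Prop
  | init : Exec hash [] State.initial
  | invoke {E : List (Event T O K V)} {σ : State T O K V m} (h : Exec hash E σ)
      (t : T) (op : Op O K V) (p : PC O K V) (hp : invoke (σ.locals t).pc op = some p) :
      Exec hash (E ++ [.inv t op])
        ⟨σ.shared, Function.update σ.locals t { σ.locals t with pc := p }⟩
  | step {E : List (Event T O K V)} {σ : State T O K V m} (h : Exec hash E σ)
      (t : T) (g : Shared T O K V m) (l : Local O K V m) (ev : Option (Event T O K V))
      (hs : stepThread hash t σ.shared (σ.locals t) = some (g, l, ev)) :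
      Exec hash (E ++ ev.toList) ⟨g, Function.update σ.locals t l⟩

end Algorithm

/-! ### The sequential history of an execution -/

section SequentialHistory

variable {T O K V : Type*}

/-- The method at a linearization point. -/
def Event.lp? : Event T O K V → Option (MExec O K V)
  | .lp _ e => some e
  | _ => none

/-- The methods of an execution in the order of their linearization points. -/
def lpHistory (E : List (Event T O K V)) : SeqHistory O K V := E.filterMap Event.lp?

/-- The keys on which a history operates. -/
def usedKeys (H : SeqHistory O K V) : List (O × K) := H.filterMap fun e => e.meth.key?

/-- The initial transaction `T₀`: it deletes all keys that are used and commits. -/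
def initialTx (ks : List (O × K)) : SeqHistory O K V :=
  ks.map (fun x => ⟨0, .del x.1 x.2 (.ret none)⟩) ++ [⟨0, .tryC true⟩]

/-- The sequential history generated by an execution: `T₀`, then the methods of the execution in the
order of their linearization points. -/
def seqHistory (E : List (Event T O K V)) : SeqHistory O K V :=
  initialTx (usedKeys (lpHistory E)) ++ lpHistory E

end SequentialHistory

end HTOSTM

set_option linter.unusedSectionVars false
set_option linter.unusedVariables false

/-! Legality is a consequence of the locking. The time-stamp tests and the order of the red list
play no part in the argument; of the red list it is only used that its links stay inside one bucket.

The central invariant is `ContentI`: for every key that no thread is in the course of rewriting, the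
blue list stores the value of the closest committed update, and lacks the key if that update is a
delete. A key is `Dirty` for a thread from the moment its `tryC` enters the second loop with an
entry for the key until its linearization point. An aborting `tryC` never reaches the second loop,
so only committing transactions make keys dirty.

Readers: at its linearization point a shared-memory lookup or delete still holds the lock of the
last blue node below its key. There is only one such node (`Mem.Pred.unique`), and a thread for
which the key is dirty also holds its lock (`LI.dirty`). Hence the key is clean, and what was read
is the closest committed value (`ExecI.closest`).

Writers: when a committing `tryC` is about to release its first lock, the effect of every entry is
visible in the blue lists (`DoneOK`), and the log entry of a key records the last update of the
transaction on it (`ViewI`). So the commit restores the invariant for the keys that become clean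
(`ContentI.commit`). `ViewI` also yields the first rule, for the methods that are answered from the
log.

What a thread knows must survive the steps of the others. This is a rely-guarantee argument: a step
changes the blue structure and the values only at nodes locked by the acting thread (`Guar`), and
assertions mention only locked nodes, private nodes and permanent facts (`LI.rely`). A search trusts
the mark of a locked node because mark and blue list disagree only at a node locked by the thread
that is linking or unlinking it (`MemInv.mark_own`).

It remains that the entries of one transaction interfere with each other. They are treated in
increasing order of keys, so an earlier entry can displace the blue predecessor recorded for a later
one, but not its successor; the correct predecessor is then a node locked on behalf of an earlier
entry, and `intraTransValidation` finds it (`Phase2`, `Behind.eq_of_prev`). -/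

namespace HTOSTM

/-! ### Memory with ghost status, and the blue lists as sets of reachable addresses. -/

section Memory

variable {T O K V : Type*} {m : ℕ}

/-- Ghost status of an address: not yet allocated, known only to the thread that allocated it, or
part of the lists of a bucket. -/
inductive Stat (T O : Type*) (m : ℕ) where
  | free
  | priv (t : T)
  | pub (B : O × Fin m)

/-- The shared memory with the ghost status of every address. -/
structure Mem (T O K V : Type*) (m : ℕ) where
  sh : Shared T O K V m
  st : Addr O m → Stat T O m

/-- The addresses reachable from the head of the bucket `B` along the links `f`. -/
def BlueFn (f : Addr O m → Option (Addr O m)) (B : O × Fin m) (a : Addr O m) : Prop :=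
  Relation.ReflTransGen (fun x y => f x = some y) (.head B.1 B.2) a

namespace Mem

def key (S : Mem T O K V m) (a : Addr O m) := (S.sh.heap a).key
def val (S : Mem T O K V m) (a : Addr O m) := (S.sh.heap a).val
def marked (S : Mem T O K V m) (a : Addr O m) := (S.sh.heap a).marked
def bl (S : Mem T O K V m) (a : Addr O m) := (S.sh.heap a).bl
def rl (S : Mem T O K V m) (a : Addr O m) := (S.sh.heap a).rl

def Blue (S : Mem T O K V m) (B : O × Fin m) (a : Addr O m) : Prop := BlueFn S.bl B a

end Mem

section Lists

variable [LinearOrder K]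

/-- How often thread `t` holds the lock of the node. -/
def Node.cnt [DecidableEq T] (n : Node T O K V m) (t : T) : ℕ :=
  match n.lock with
  | some (u, c) => if u = t then c else 0
  | none => 0

variable [DecidableEq T]

def Mem.cnt (S : Mem T O K V m) (t : T) (a : Addr O m) : ℕ := (S.sh.heap a).cnt t

theorem Node.cnt_unique (n : Node T O K V m) {t u : T} (ht : 0 < n.cnt t) (hu : 0 < n.cnt u) :
    t = u := by
  unfold Node.cnt at ht hu
  rcases h : n.lock with _ | ⟨w, c⟩
  · simp [h] at ht
  · simp only [h] at ht hu
    split_ifs at ht hu with h1 h2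
    · exact h1.symm.trans h2
    all_goals omega

theorem Mem.cnt_unique (S : Mem T O K V m) {t u : T} {a : Addr O m} (ht : 0 < S.cnt t a)
    (hu : 0 < S.cnt u a) : t = u := Node.cnt_unique _ ht hu

/-- Well-formedness of the shared memory. -/
structure Mem.WF (S : Mem T O K V m) : Prop where
  headPub : ∀ o b, S.st (.head o b) = .pub (o, b)
  headKey : ∀ o b, S.key (.head o b) = ⊥
  freeCell : ∀ n, S.sh.fresh ≤ n → S.st (.cell n) = .free
  blPub : ∀ a B b, S.st a = .pub B → S.bl a = some b → S.st b = .pub B ∧ S.key a < S.key b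
  rlPub : ∀ a B b, S.st a = .pub B → S.rl a = some b → S.st b = .pub B
  cntSt : ∀ t a, 0 < S.cnt t a → (∃ B, S.st a = .pub B) ∨ S.st a = .priv t

namespace Mem

variable {S : Mem T O K V m}

theorem WF.blue_pub (h : S.WF) {B : O × Fin m} {a : Addr O m} (ha : S.Blue B a) :
    S.st a = .pub B := by
  induction ha with
  | refl => exact h.headPub _ _
  | tail _ hxy ih => exact (h.blPub _ _ _ ih hxy).1

theorem WF.bucket_unique (h : S.WF) {B B' : O × Fin m} {a : Addr O m} (ha : S.Blue B a)
    (ha' : S.st a = .pub B') : B' = B := by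
  have := h.blue_pub ha
  rw [ha'] at this
  simpa using this

theorem WF.reach_key_le (h : S.WF) {B : O × Fin m} {a b : Addr O m} (ha : S.st a = .pub B)
    (hab : Relation.ReflTransGen (fun x y => S.bl x = some y) a b) :
    S.st b = .pub B ∧ S.key a ≤ S.key b := by
  induction hab with
  | refl => exact ⟨ha, le_rfl⟩
  | tail _ hxy ih =>
    have := h.blPub _ _ _ ih.1 hxy
    exact ⟨this.1, ih.2.trans this.2.le⟩

/-- Each node has at most one blue link, so two paths from the same head extend one another. -/
theorem Blue.total {B : O × Fin m} {a b : Addr O m} (ha : S.Blue B a) (hb : S.Blue B b) :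
    Relation.ReflTransGen (fun x y => S.bl x = some y) a b ∨
      Relation.ReflTransGen (fun x y => S.bl x = some y) b a :=
  Relation.ReflTransGen.total_of_right_unique
    (fun x y z hy hz => Option.some.inj (hy.symm.trans hz)) ha hb

/-- In a blue list at most one node is the last one satisfying a downward closed condition. -/
theorem WF.last_unique (h : S.WF) {P : WithBot (WithTop K) → Prop}
    (hP : ∀ x y, P x → y ≤ x → P y) {B : O × Fin m} {a b : Addr O m} (ha : S.Blue B a)
    (hb : S.Blue B b) (hka : P (S.key a)) (hkb : P (S.key b))
    (hsa : ∀ c, S.bl a = some c → ¬ P (S.key c)) (hsb : ∀ c, S.bl b = some c → ¬ P (S.key c)) :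
    a = b := by
  -- If `y` lay strictly after `x`, the successor of `x` would have a key at most that of `y` and
  -- hence satisfy `P`.
  have key : ∀ x y, S.Blue B x → P (S.key y) → (∀ c, S.bl x = some c → ¬ P (S.key c)) →
      Relation.ReflTransGen (fun x y => S.bl x = some y) x y → x = y := by
    intro x y hx hky hsx hxy
    rcases hxy.cases_head with h1 | ⟨c, hc, hcy⟩
    · exact h1
    · have h2 := h.blPub _ _ _ (h.blue_pub hx) hc
      exact absurd (hP _ _ hky (h.reach_key_le h2.1 hcy).2) (hsx c hc)
  rcases Blue.total ha hb with hab | hba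
  · exact key a b ha hkb hsa hab
  · exact (key b a hb hka hsb hba).symm

/-- Keys increase strictly along blue links, so both nodes are the last one with key at most their
common key. -/
theorem WF.blue_key_inj (h : S.WF) {B : O × Fin m} {a b : Addr O m} (ha : S.Blue B a)
    (hb : S.Blue B b) (hk : S.key a = S.key b) : a = b :=
  h.last_unique (P := fun x => x ≤ S.key a) (fun _ _ hx hy => hy.trans hx) ha hb le_rfl hk.ge
    (fun _ hc => not_le.2 (h.blPub _ _ _ (h.blue_pub ha) hc).2)
    (fun _ hc => not_le.2 (hk ▸ (h.blPub _ _ _ (h.blue_pub hb) hc).2))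

/-- `p` and `c` are neighbours in the blue list of `B`, and the key `κ` belongs between them or
to `c`. -/
structure Win (S : Mem T O K V m) (B : O × Fin m) (κ : WithBot (WithTop K)) (p c : Addr O m) :
    Prop where
  blue : S.Blue B p
  next : S.bl p = some c
  lt : S.key p < κ
  le : κ ≤ S.key c

theorem Win.blue_next {B : O × Fin m} {κ : WithBot (WithTop K)} {p c : Addr O m}
    (h : S.Win B κ p c) : S.Blue B c := h.blue.tail h.next

/-- `p` is the last node of the blue list of `B` whose key is below `κ`. -/
structure Pred (S : Mem T O K V m) (B : O × Fin m) (κ : WithBot (WithTop K)) (p : Addr O m) :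
    Prop where
  blue : S.Blue B p
  lt : S.key p < κ
  le : ∀ c, S.bl p = some c → κ ≤ S.key c

theorem Win.pred {B : O × Fin m} {κ : WithBot (WithTop K)} {p c : Addr O m}
    (h : S.Win B κ p c) : S.Pred B κ p :=
  ⟨h.blue, h.lt, fun _ hd => (Option.some.inj (h.next.symm.trans hd)) ▸ h.le⟩

/-- This is what makes locks exclusive per key: readers and writers of `κ` meet at the lock of this
one node. -/
theorem Pred.unique (hS : S.WF) {B : O × Fin m} {κ : WithBot (WithTop K)} {p q : Addr O m}
    (hp : S.Pred B κ p) (hq : S.Pred B κ q) : p = q :=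
  hS.last_unique (P := fun x => x < κ) (fun _ _ hx hy => hy.trans_lt hx) hp.blue hq.blue hp.lt hq.lt
    (fun c hc => not_lt.2 (hp.le c hc)) (fun c hc => not_lt.2 (hq.le c hc))

/-- A blue node whose key is `κ` follows the last node below `κ`. -/
theorem Pred.next_of_key (hS : S.WF) {B : O × Fin m} {κ : WithBot (WithTop K)} {p a : Addr O m}
    (hp : S.Pred B κ p) (ha : S.Blue B a) (hk : S.key a = κ) : S.bl p = some a := by
  rcases Blue.total hp.blue ha with h | h
  · rcases h.cases_head with h1 | ⟨c, hc, hca⟩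
    · exact absurd hp.lt (by rw [h1, hk]; exact lt_irrefl _)
    · have h2 := hS.blPub _ _ _ (hS.blue_pub hp.blue) hc
      -- A second link would put `a` strictly beyond `c`, whose key is already at least `κ`.
      rcases hca.cases_head with h1 | ⟨d, hd, hda⟩
      · rw [hc, h1]
      · have h3 := hS.blPub _ _ _ h2.1 hd
        have h4 := (hS.reach_key_le h3.1 hda).2
        exact absurd (h3.2.trans_le h4) (not_lt.2 (hk ▸ hp.le c hc))
  · exact absurd hp.lt (not_lt.2 (hk ▸ (hS.reach_key_le (hS.blue_pub ha) h).2))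

theorem Win.eq_next_of_key (hS : S.WF) {B : O × Fin m} {κ : WithBot (WithTop K)}
    {p c a : Addr O m} (hp : S.Win B κ p c) (ha : S.Blue B a) (hk : S.key a = κ) : a = c :=
  Option.some.inj ((hp.pred.next_of_key hS ha hk).symm.trans hp.next)

end Mem

end Lists

/-- As `n` already points to `c`, old paths through `p → c` become paths through `p → n → c`. Both
ways of inserting, re-linking a red node and linking a new one, set the link of `n` before that of
`p` and are instances. `hB` confines the change to the list of one bucket. -/
theorem blueFn_insert {f : Addr O m → Option (Addr O m)} [DecidableEq O] {B : O × Fin m}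
    {p n c : Addr O m} (hp : BlueFn f B p) (hpc : f p = some c) (hnc : f n = some c)
    (hpn : n ≠ p) (hB : ∀ B', BlueFn f B' p → B' = B) (B' : O × Fin m) (a : Addr O m) :
    BlueFn (Function.update f p (some n)) B' a ↔ BlueFn f B' a ∨ (B' = B ∧ a = n) := by
  have hmem : ∀ B' x, BlueFn f B' x → BlueFn (Function.update f p (some n)) B' x := by
    intro B' x hx
    induction hx with
    | refl => exact .refl
    | @tail x y _ hxy ih =>
      by_cases hxp : x = p
      · subst hxp
        have h1 : BlueFn (Function.update f x (some n)) B' n := ih.tail (by simp)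
        obtain rfl : c = y := Option.some.inj (hpc.symm.trans hxy)
        exact h1.tail (by simp [Function.update_of_ne hpn, hnc])
      · exact ih.tail (by simp [Function.update_of_ne hxp, hxy])
  constructor
  · intro h
    induction h with
    | refl => exact .inl .refl
    | @tail x y _ hxy ih =>
      by_cases hxp : x = p
      · subst hxp
        simp only [Function.update_self, Option.some.injEq] at hxy
        rcases ih with h | ⟨_, h⟩
        · exact .inr ⟨hB _ h, hxy.symm⟩
        · exact absurd h.symm hpn
      · rw [Function.update_of_ne hxp] at hxy
        rcases ih with h | ⟨rfl, rfl⟩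
        · exact .inl (h.tail hxy)
        · obtain rfl : c = y := Option.some.inj (hnc.symm.trans hxy)
          exact .inl (hp.tail hpc)
  · rintro (h | ⟨rfl, rfl⟩)
    · exact hmem _ _ h
    · exact (hmem _ _ hp).tail (by simp)

/-- `p` is the only reachable node that points to `c`, so bypassing `c` there removes `c` and
nothing else. -/
theorem blueFn_delete {f : Addr O m → Option (Addr O m)} [DecidableEq O] {p c : Addr O m}
    (hpc : f p = some c)
    (hpred : ∀ B' x, BlueFn f B' x → f x = some c → x = p)
    (hhead : ∀ o b, c ≠ .head o b) (hne : p ≠ c) (hcc : f c ≠ some c)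
    (B' : O × Fin m) (a : Addr O m) :
    BlueFn (Function.update f p (f c)) B' a ↔ BlueFn f B' a ∧ a ≠ c := by
  constructor
  · intro h
    induction h with
    | refl => exact ⟨.refl, (hhead _ _).symm⟩
    | @tail x y _ hxy ih =>
      by_cases hxp : x = p
      · subst hxp
        rw [Function.update_self] at hxy
        exact ⟨(ih.1.tail hpc).tail hxy, fun h => hcc (h ▸ hxy)⟩
      · rw [Function.update_of_ne hxp] at hxy
        exact ⟨ih.1.tail hxy, fun h => hxp (hpred _ _ ih.1 (h ▸ hxy))⟩
  · rintro ⟨h, hac⟩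
    -- The induction along the old path needs a substitute when it passes through `c`: at that
    -- moment `p`, which now points past `c`, is reachable.
    have key : (a ≠ c → BlueFn (Function.update f p (f c)) B' a) ∧
        (a = c → BlueFn (Function.update f p (f c)) B' p) := by
      clear hac
      induction h with
      | refl => exact ⟨fun _ => .refl, fun h => absurd h.symm (hhead _ _)⟩
      | @tail x y hx hxy ih =>
        refine ⟨fun hy => ?_, fun hy => ?_⟩
        · by_cases hxc : x = c
          · exact (ih.2 hxc).tail (by simp [← hxc, hxy])
          · have hxp : x ≠ p := fun h => hy (Option.some.inj (hxy.symm.trans (h ▸ hpc)))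
            exact (ih.1 hxc).tail (by simp [Function.update_of_ne hxp, hxy])
        · have hxp : x = p := hpred _ _ hx (hy ▸ hxy)
          subst hxp
          exact ih.1 hne
    exact key.1 hac

theorem blueFn_update {f : Addr O m → Option (Addr O m)} [DecidableEq O] {x : Addr O m}
    {v : Option (Addr O m)} (hx : ∀ B', ¬ BlueFn f B' x) (B' : O × Fin m) (a : Addr O m) :
    BlueFn (Function.update f x v) B' a ↔ BlueFn f B' a := by
  constructor
  · intro h
    induction h with
    | refl => exact .refl
    | @tail y z _ hyz ih =>
      have hne : y ≠ x := fun h => hx _ (h ▸ ih)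
      rw [Function.update_of_ne hne] at hyz
      exact ih.tail hyz
  · intro h
    induction h with
    | refl => exact .refl
    | @tail y z hy hyz ih =>
      have hne : y ≠ x := fun h => hx _ (h ▸ hy)
      exact ih.tail (by simp [Function.update_of_ne hne, hyz])

end Memory

/-! ### Rely and guarantee conditions, lock counting, and the elementary memory steps. -/

section Actions

variable {T O K V : Type*} [DecidableEq T] [DecidableEq O] [LinearOrder K] {m : ℕ}

/-- What is known about the published nodes survives: the blue structure on `X`, the values on `Y`. -/
structure Agree (X Y : Addr O m → Prop) (S S' : Mem T O K V m) : Prop where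
  pub : ∀ a B, S.st a = .pub B → S'.st a = .pub B
  key : ∀ a B, S.st a = .pub B → S'.key a = S.key a
  bl : ∀ a B, X a → S.st a = .pub B → S'.bl a = S.bl a
  blue : ∀ a B, X a → S.Blue B a → S'.Blue B a
  val : ∀ a B, Y a → S.st a = .pub B → S'.val a = S.val a

/-- The effect of steps of other threads, as seen by thread `t`. -/
structure Rely (t : T) (S S' : Mem T O K V m) : Prop where
  agree : Agree (fun a => 0 < S.cnt t a) (fun a => 0 < S.cnt t a) S S'
  cnt : ∀ a, S'.cnt t a = S.cnt t a
  marked : ∀ a B, 0 < S.cnt t a → S.st a = .pub B → S'.marked a = S.marked a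
  priv : ∀ a, S.st a = .priv t → S'.st a = .priv t ∧ S'.sh.heap a = S.sh.heap a

/-- The effect of a step of thread `u`, as guaranteed to the other threads. -/
structure Guar (u : T) (S S' : Mem T O K V m) : Prop where
  pub : ∀ a B, S.st a = .pub B → S'.st a = .pub B
  key : ∀ a B, S.st a = .pub B → S'.key a = S.key a
  bl : ∀ a B, S.st a = .pub B → S.cnt u a = 0 → S'.bl a = S.bl a
  marked : ∀ a B, S.st a = .pub B → S.cnt u a = 0 → S'.marked a = S.marked a
  val : ∀ a B, S.st a = .pub B → S.cnt u a = 0 → S'.val a = S.val a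
  blue : ∀ a B, S.st a = .pub B → S.cnt u a = 0 → (S'.Blue B a ↔ S.Blue B a)
  cnt : ∀ t, t ≠ u → ∀ a, S'.cnt t a = S.cnt t a
  priv : ∀ t, t ≠ u → ∀ a, S.st a = .priv t → S'.st a = .priv t ∧ S'.sh.heap a = S.sh.heap a

/-- A lock has at most one owner: a node locked by `t` is not locked by `u`, and `u` guarantees to
leave such nodes alone. -/
theorem Guar.rely {u t : T} {S S' : Mem T O K V m} (h : Guar u S S') (hS : S.WF) (ht : t ≠ u) :
    Rely t S S' := by
  have h0 : ∀ a, 0 < S.cnt t a → S.cnt u a = 0 := fun a ha => by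
    by_contra hu
    exact ht (S.cnt_unique ha (Nat.pos_of_ne_zero hu))
  exact
    { agree :=
        { pub := h.pub
          key := h.key
          bl := fun a B ha hp => h.bl a B hp (h0 a ha)
          blue := fun a B ha hb => (h.blue a B (hS.blue_pub hb) (h0 a ha)).2 hb
          val := fun a B ha hp => h.val a B hp (h0 a ha) }
      cnt := h.cnt t ht
      marked := fun a B ha hp => h.marked a B hp (h0 a ha)
      priv := h.priv t ht }

/-- A step of thread `u` that does not touch the blue structure of published nodes. -/
structure Quiet (u : T) (S S' : Mem T O K V m) : Prop where
  pub : ∀ a B, S'.st a = .pub B ↔ S.st a = .pub B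
  key : ∀ a B, S.st a = .pub B → S'.key a = S.key a
  bl : ∀ a B, S.st a = .pub B → S'.bl a = S.bl a
  marked : ∀ a B, S.st a = .pub B → S'.marked a = S.marked a
  val : ∀ a B, S.st a = .pub B → S'.val a = S.val a
  cnt : ∀ t, t ≠ u → ∀ a, S'.cnt t a = S.cnt t a
  priv : ∀ t, t ≠ u → ∀ a, S.st a = .priv t → S'.st a = .priv t ∧ S'.sh.heap a = S.sh.heap a

theorem blueFn_congr {f f' : Addr O m → Option (Addr O m)} {B : O × Fin m}
    (h : ∀ a, BlueFn f B a → f' a = f a) (a : Addr O m) : BlueFn f' B a ↔ BlueFn f B a := by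
  constructor
  · intro ha
    induction ha with
    | refl => exact .refl
    | tail _ hxy ih => exact ih.tail (h _ ih ▸ hxy)
  · intro ha
    induction ha with
    | refl => exact .refl
    | tail hx hxy ih => exact ih.tail ((h _ hx).trans hxy)

namespace Quiet

variable {u : T} {S S' : Mem T O K V m}

theorem blue (h : Quiet u S S') (hS : S.WF) (B : O × Fin m) (a : Addr O m) :
    S'.Blue B a ↔ S.Blue B a :=
  blueFn_congr (fun x hx => h.bl x B (hS.blue_pub hx)) a

theorem guar (h : Quiet u S S') (hS : S.WF) : Guar u S S' where
  pub a B := (h.pub a B).2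
  key := h.key
  bl a B hp _ := h.bl a B hp
  marked a B hp _ := h.marked a B hp
  val a B hp _ := h.val a B hp
  blue a B _ _ := h.blue hS B a
  cnt := h.cnt
  priv := h.priv

theorem agree (h : Quiet u S S') (hS : S.WF) (X Y : Addr O m → Prop) : Agree X Y S S' where
  pub a B := (h.pub a B).2
  key := h.key
  bl a B _ := h.bl a B
  blue a B _ := (h.blue hS B a).2
  val a B _ := h.val a B

theorem rfl' : Quiet u S S where
  pub _ _ := Iff.rfl
  key _ _ _ := rfl
  bl _ _ _ := rfl
  marked _ _ _ := rfl
  val _ _ _ := rfl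
  cnt _ _ _ := rfl
  priv _ _ _ h := ⟨h, rfl⟩

end Quiet

/-- The addresses in `L` are held by `t`, with multiplicity. -/
def Held (t : T) (S : Mem T O K V m) (L : List (Addr O m)) : Prop :=
  ∀ a, L.count a ≤ S.cnt t a

namespace Held

variable {t : T} {S S' : Mem T O K V m} {L L' : List (Addr O m)}

theorem own (h : Held t S L) {a : Addr O m} (ha : a ∈ L) : 0 < S.cnt t a :=
  (List.count_pos_iff.2 ha).trans_le (h a)

theorem mono (h : Held t S L) (hL : ∀ a, L'.count a ≤ L.count a) : Held t S L' :=
  fun a => (hL a).trans (h a)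

theorem congr (h : Held t S L) (hc : ∀ a, S'.cnt t a = S.cnt t a) : Held t S' L :=
  fun a => hc a ▸ h a

theorem nil : Held t S [] := fun _ => by simp

theorem cons {x : Addr O m} (h : Held t S L)
    (hc : ∀ a, S'.cnt t a = S.cnt t a + if a = x then 1 else 0) : Held t S' (x :: L) := by
  intro a
  have := h a
  rw [hc a, List.count_cons]
  by_cases hax : a = x
  · simp only [hax, beq_self_eq_true, if_true] at this ⊢
    omega
  · simpa [hax, beq_eq_false_iff_ne.2 (Ne.symm hax)] using this

theorem uncons {x : Addr O m} (h : Held t S (x :: L))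
    (hc : ∀ a, S'.cnt t a = S.cnt t a - if a = x then 1 else 0) : Held t S' L := by
  intro a
  have := h a
  rw [hc a]
  rw [List.count_cons] at this
  by_cases hax : a = x
  · simp only [hax, beq_self_eq_true, if_true] at this ⊢
    omega
  · simpa [hax, beq_eq_false_iff_ne.2 (Ne.symm hax)] using this

end Held

section Lock

variable {u : T} {S : Mem T O K V m} {a : Addr O m} {g' : Shared T O K V m}

theorem shared_lock_spec {g : Shared T O K V m} (h : g.lock u a = some g') :
    ∃ v, g' = g.modify a (fun n => { n with lock := v }) ∧
      (∀ t, ({ g.heap a with lock := v } : Node T O K V m).cnt t =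
        (g.heap a).cnt t + if t = u then 1 else 0) := by
  unfold Shared.lock at h
  split at h
  · rename_i hl
    refine ⟨_, (Option.some.inj h).symm, fun t => ?_⟩
    by_cases ht : t = u <;> simp [Node.cnt, hl, ht, eq_comm]
    simpa [eq_comm] using ht
  · rename_i w c hl
    split_ifs at h with hw
    refine ⟨_, (Option.some.inj h).symm, fun t => ?_⟩
    by_cases ht : t = u <;> simp [Node.cnt, hl, ht, hw]
    rw [if_neg (fun h => ht h.symm), if_neg (fun h => ht h.symm)]

theorem shared_unlock_spec (g : Shared T O K V m) (u : T) (a : Addr O m) :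
    ∃ v, g.unlock u a = g.modify a (fun n => { n with lock := v }) ∧
      (∀ t, ({ g.heap a with lock := v } : Node T O K V m).cnt t =
        (g.heap a).cnt t - if t = u then 1 else 0) := by
  unfold Shared.unlock
  -- An `unlock` that has nothing to release returns `g`; writing this as a modification by the same
  -- lock gives all branches one form.
  have hself : ∀ v, v = (g.heap a).lock → g = g.modify a (fun n => { n with lock := v }) := by
    rintro v rfl
    simp [Shared.modify]
  split
  · rename_i hl
    exact ⟨none, hself _ hl.symm, fun t => by simp [Node.cnt, hl]⟩
  · rename_i w c hl
    by_cases hw : w = u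
    · rw [if_pos hw]
      refine ⟨_, rfl, fun t => ?_⟩
      -- The types also allow a stored count of `0`; truncated subtraction gives the right count in
      -- that case too.
      by_cases hc : c ≤ 1
      · rw [if_pos hc]
        by_cases ht : u = t
        · simp [Node.cnt, hl, ht, hw]; omega
        · simp [Node.cnt, hl, ht, hw]
      · rw [if_neg hc]
        by_cases ht : u = t
        · simp [Node.cnt, hl, ht, hw]
        · simp [Node.cnt, hl, ht, hw]
    · rw [if_neg hw]
      refine ⟨some (w, c), hself _ hl.symm, fun t => ?_⟩
      by_cases ht : t = u <;> simp [Node.cnt, hl, ht, hw]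

end Lock

namespace Mem

def modify (S : Mem T O K V m) (a : Addr O m) (f : Node T O K V m → Node T O K V m) :
    Mem T O K V m := ⟨S.sh.modify a f, S.st⟩

variable {S : Mem T O K V m} {a : Addr O m} {f : Node T O K V m → Node T O K V m}

theorem modify_heap (x : Addr O m) :
    (S.modify a f).sh.heap x = if x = a then f (S.sh.heap a) else S.sh.heap x := by
  simp [modify, Shared.modify, Function.update_apply]

theorem modify_heap_of_ne {x : Addr O m} (h : x ≠ a) :
    (S.modify a f).sh.heap x = S.sh.heap x := by simp [modify_heap, h]

theorem modify_heap_self : (S.modify a f).sh.heap a = f (S.sh.heap a) := by simp [modify_heap]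

theorem modify_proj {α : Type*} (π : Node T O K V m → α) (h : π (f (S.sh.heap a)) = π (S.sh.heap a))
    (x : Addr O m) : π ((S.modify a f).sh.heap x) = π (S.sh.heap x) := by
  rw [modify_heap]
  split_ifs with hx
  · rw [hx, h]
  · rfl


/-- Changing a node without changing key and blue link keeps well-formedness. -/
theorem WF.modify (hS : S.WF) (hkey : (f (S.sh.heap a)).key = (S.sh.heap a).key)
    (hbl : ∀ B b, S.st a = .pub B → (f (S.sh.heap a)).bl = some b →
      S.st b = .pub B ∧ S.key a < S.key b)
    (hrl : ∀ B b, S.st a = .pub B → (f (S.sh.heap a)).rl = some b → S.st b = .pub B)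
    (hcnt : ∀ t, 0 < (f (S.sh.heap a)).cnt t → 0 < S.cnt t a ∨ (∃ B, S.st a = .pub B) ∨
      S.st a = .priv t) :
    (S.modify a f).WF where
  headPub := hS.headPub
  headKey o b := (modify_proj Node.key hkey _).trans (hS.headKey o b)
  freeCell := hS.freeCell
  blPub x B b hx hb := by
    have hk := modify_proj (S := S) Node.key hkey
    unfold Mem.key
    rw [hk, hk]
    unfold Mem.bl at hb
    rw [modify_heap] at hb
    split_ifs at hb with h
    · subst h; exact hbl B b hx hb
    · exact hS.blPub x B b hx hb
  rlPub x B b hx hb := by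
    unfold Mem.rl at hb
    rw [modify_heap] at hb
    split_ifs at hb with h
    · subst h; exact hrl B b hx hb
    · exact hS.rlPub x B b hx hb
  cntSt t x hx := by
    unfold Mem.cnt at hx
    rw [modify_heap] at hx
    split_ifs at hx with h
    · subst h
      rcases hcnt t hx with h1 | h1
      · exact hS.cntSt t x h1
      · exact h1
    · exact hS.cntSt t x hx

theorem quiet_modify {u : T} (hkey : (f (S.sh.heap a)).key = (S.sh.heap a).key)
    (hcore : ∀ B, S.st a = .pub B → (f (S.sh.heap a)).bl = (S.sh.heap a).bl ∧
      (f (S.sh.heap a)).marked = (S.sh.heap a).marked ∧ (f (S.sh.heap a)).val = (S.sh.heap a).val)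
    (hcnt : ∀ t, t ≠ u → (f (S.sh.heap a)).cnt t = (S.sh.heap a).cnt t)
    (hpriv : ∀ t, t ≠ u → S.st a = .priv t → f (S.sh.heap a) = S.sh.heap a) :
    Quiet u S (S.modify a f) where
  pub _ _ := Iff.rfl
  key x B _ := modify_proj Node.key hkey x
  bl x B hx := by
    by_cases h : x = a
    · subst h; simpa [Mem.bl, modify_heap_self] using (hcore B hx).1
    · simp [Mem.bl, modify_heap_of_ne h]
  marked x B hx := by
    by_cases h : x = a
    · subst h; simpa [Mem.marked, modify_heap_self] using (hcore B hx).2.1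
    · simp [Mem.marked, modify_heap_of_ne h]
  val x B hx := by
    by_cases h : x = a
    · subst h; simpa [Mem.val, modify_heap_self] using (hcore B hx).2.2
    · simp [Mem.val, modify_heap_of_ne h]
  cnt t ht x := modify_proj (fun n => n.cnt t) (hcnt t ht) x
  priv t ht x hx := by
    refine ⟨hx, ?_⟩
    by_cases h : x = a
    · subst h; rw [modify_heap_self, hpriv t ht hx]
    · rw [modify_heap_of_ne h]

end Mem

section Steps

variable {u : T} {S : Mem T O K V m} {a : Addr O m} {g' : Shared T O K V m}

/-- `ha` preserves the rule that a thread locks only published nodes and private nodes of its own.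
The last clause serves the locking of a new node in `tryC`, whose other fields have to be known
afterwards. -/
theorem lock_step (hS : S.WF) (ha : (∃ B, S.st a = .pub B) ∨ S.st a = .priv u)
    (h : S.sh.lock u a = some g') :
    ∃ S' : Mem T O K V m, S'.sh = g' ∧ S'.st = S.st ∧ S'.WF ∧ Quiet u S S' ∧
      (∀ x, S'.cnt u x = S.cnt u x + if x = a then 1 else 0) ∧
      ∀ x, ∃ v, S'.sh.heap x = { S.sh.heap x with lock := v } := by
  obtain ⟨v, rfl, hv⟩ := shared_lock_spec h
  refine ⟨S.modify a (fun n => { n with lock := v }), rfl, rfl, ?_, ?_, fun x => ?_, fun x => ?_⟩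
  · refine hS.modify rfl (fun B b => hS.blPub a B b) (fun B b => hS.rlPub a B b) fun t ht => ?_
    rw [hv t] at ht
    by_cases htu : t = u
    · subst htu; exact .inr ha
    · left; simpa [htu, Mem.cnt] using ht
  · refine Mem.quiet_modify rfl (fun _ _ => ⟨rfl, rfl, rfl⟩) (fun t ht => by simp [hv t, ht])
      fun t ht hp => ?_
    rcases ha with ⟨B, hB⟩ | hB
    · rw [hp] at hB; simp at hB
    · rw [hp] at hB; simp at hB; exact absurd hB ht
  · unfold Mem.cnt
    rw [Mem.modify_heap]
    split_ifs with hx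
    · rw [hv u, hx]; simp
    · rfl
  · rw [Mem.modify_heap]
    split_ifs with hx
    · exact ⟨v, by rw [hx]⟩
    · exact ⟨_, rfl⟩

/-- Holding the lock shows that the node is not private to another thread, to which its whole
contents were guaranteed. -/
theorem unlock_step (hS : S.WF) (hown : 0 < S.cnt u a) :
    ∃ S' : Mem T O K V m, S'.sh = S.sh.unlock u a ∧ S'.st = S.st ∧ S'.WF ∧ Quiet u S S' ∧
      ∀ x, S'.cnt u x = S.cnt u x - if x = a then 1 else 0 := by
  obtain ⟨v, h, hv⟩ := shared_unlock_spec S.sh u a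
  refine ⟨S.modify a (fun n => { n with lock := v }), h.symm, rfl, ?_, ?_, fun x => ?_⟩
  · refine hS.modify rfl (fun B b => hS.blPub a B b) (fun B b => hS.rlPub a B b) fun t ht => ?_
    rw [hv t] at ht
    exact .inl (by unfold Mem.cnt; omega)
  · refine Mem.quiet_modify rfl (fun _ _ => ⟨rfl, rfl, rfl⟩) (fun t ht => by simp [hv t, ht])
      fun t ht hp => ?_
    rcases hS.cntSt u a hown with ⟨B, hB⟩ | hB
    · rw [hp] at hB; simp at hB
    · rw [hp] at hB; simp at hB; exact absurd hB ht
  · unfold Mem.cnt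
    rw [Mem.modify_heap]
    split_ifs with hx
    · rw [hv u, hx]; simp
    · simp

/-- Changing a field that is irrelevant to the blue lists in a node. -/
theorem aux_step (hS : S.WF) {f : Node T O K V m → Node T O K V m}
    (ha : (∃ B, S.st a = .pub B) ∨ S.st a = .priv u)
    (hf : ∀ n, (f n).key = n.key ∧ (f n).bl = n.bl ∧ (f n).marked = n.marked ∧
      (f n).val = n.val ∧ (f n).lock = n.lock ∧ (f n).rl = n.rl) :
    ∃ S' : Mem T O K V m, S'.sh = S.sh.modify a f ∧ S'.st = S.st ∧ S'.WF ∧ Quiet u S S' ∧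
      ∀ x, S'.cnt u x = S.cnt u x := by
  have hcnt : ∀ t, (f (S.sh.heap a)).cnt t = (S.sh.heap a).cnt t := fun t => by
    simp only [Node.cnt, (hf _).2.2.2.2.1]
  refine ⟨S.modify a f, rfl, rfl, ?_, ?_, fun x => Mem.modify_proj (fun n => n.cnt u) (hcnt u) x⟩
  · refine hS.modify (hf _).1 (fun B b hB hb => hS.blPub a B b hB ?_)
      (fun B b hB hb => hS.rlPub a B b hB ?_) fun t ht => .inl ?_
    · rw [(hf _).2.1] at hb; exact hb
    · rw [(hf _).2.2.2.2.2] at hb; exact hb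
    · rw [hcnt] at ht; exact ht
  · refine Mem.quiet_modify (hf _).1 (fun _ _ => ⟨(hf _).2.1, (hf _).2.2.1, (hf _).2.2.2.1⟩)
      (fun t _ => hcnt t) fun t ht hp => ?_
    rcases ha with ⟨B, hB⟩ | hB
    · rw [hp] at hB; simp at hB
    · rw [hp] at hB; simp at hB; exact absurd hB ht

/-- Changing a node that only the acting thread knows. -/
theorem priv_step (hS : S.WF) {f : Node T O K V m → Node T O K V m}
    (ha : S.st a = .priv u)
    (hf : ∀ n, (f n).key = n.key ∧ (f n).lock = n.lock) :
    ∃ S' : Mem T O K V m, S'.sh = S.sh.modify a f ∧ S'.st = S.st ∧ S'.WF ∧ Quiet u S S' ∧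
      (∀ x, S'.cnt u x = S.cnt u x) ∧ S'.sh.heap a = f (S.sh.heap a) := by
  have hcnt : ∀ t, (f (S.sh.heap a)).cnt t = (S.sh.heap a).cnt t := fun t => by
    simp only [Node.cnt, (hf _).2]
  refine ⟨S.modify a f, rfl, rfl, ?_, ?_, fun x => Mem.modify_proj (fun n => n.cnt u) (hcnt u) x,
    Mem.modify_heap_self⟩
  · refine hS.modify (hf _).1 (fun B b hB hb => ?_)
      (fun B b hB hb => ?_) fun t ht => .inl ?_
    · rw [ha] at hB; simp at hB
    · rw [ha] at hB; simp at hB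
    · rw [hcnt] at ht; exact ht
  · refine Mem.quiet_modify (hf _).1 (fun B hB => ?_)
      (fun t _ => hcnt t) fun t ht hp => ?_
    · rw [ha] at hB; simp at hB
    · rw [ha] at hp; simp at hp; exact absurd hp.symm ht

theorem alloc_step (hS : S.WF) (u : T) (k : K) (v : Option V) :
    ∃ S' : Mem T O K V m, S'.sh = S.sh.alloc k v ∧ S'.WF ∧ Quiet u S S' ∧
      (∀ x, S'.cnt u x = S.cnt u x) ∧ S'.st (.cell S.sh.fresh) = .priv u ∧
      S'.sh.heap (.cell S.sh.fresh) = { key := nodeKey k, val := v } := by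
  have hfree : S.st (.cell S.sh.fresh) = .free := hS.freeCell _ le_rfl
  have hne : ∀ x, S.st x ≠ .free → x ≠ .cell S.sh.fresh := fun x hx h => hx (h ▸ hfree)
  let S' : Mem T O K V m :=
    ⟨S.sh.alloc k v, Function.update S.st (.cell S.sh.fresh) (.priv u)⟩
  have hst : ∀ x, S'.st x = if x = .cell S.sh.fresh then .priv u else S.st x := fun x => by
    simp [S', Function.update_apply]
  have hheap : ∀ x, S'.sh.heap x =
      if x = .cell S.sh.fresh then { key := nodeKey k, val := v } else S.sh.heap x := fun x => by
    simp [S', Shared.alloc, Function.update_apply]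
  have hheap' : ∀ x, S.st x ≠ .free → S'.sh.heap x = S.sh.heap x := fun x hx => by
    rw [hheap, if_neg (hne x hx)]
  have hst' : ∀ x, S.st x ≠ .free → S'.st x = S.st x := fun x hx => by
    rw [hst, if_neg (hne x hx)]
  have hpub : ∀ a B, S'.st a = .pub B ↔ S.st a = .pub B := fun a B => by
    rw [hst]
    split_ifs with h
    · rw [h, hfree]; simp
    · rfl
  have hnf : ∀ {a B}, S.st a = .pub B → S.st a ≠ .free := fun h => by rw [h]; simp
  have hcnt : ∀ t x, S'.cnt t x = S.cnt t x := fun t x => by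
    unfold Mem.cnt
    rw [hheap]
    split_ifs with hx
    · subst hx
      -- The new node is unlocked, and so was the free cell, because only published or private nodes
      -- are ever locked. Hence allocation changes no lock count.
      have : ¬ 0 < S.cnt t (.cell S.sh.fresh) := fun h => by
        rcases hS.cntSt t _ h with ⟨B, hB⟩ | hB <;> rw [hfree] at hB <;> simp at hB
      unfold Mem.cnt at this
      simp only [Node.cnt]
      simp only [Node.cnt] at this
      omega
    · rfl
  refine ⟨S', rfl, ?_, ?_, hcnt u, by simp [hst], by simp [hheap]⟩
  · exact
      { headPub := fun o b => (hpub _ _).2 (hS.headPub o b)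
        headKey := fun o b => by
          unfold Mem.key
          rw [hheap' _ (by rw [hS.headPub]; simp)]
          exact hS.headKey o b
        freeCell := fun n hn => by
          have hn' : S.sh.fresh + 1 ≤ n := hn
          rw [hst, if_neg (by simp; omega)]
          exact hS.freeCell n (by omega)
        blPub := fun x B b hx hb => by
          rw [hpub] at hx ⊢
          unfold Mem.bl at hb
          rw [hheap' _ (hnf hx)] at hb
          have := hS.blPub x B b hx hb
          unfold Mem.key
          rw [hheap' _ (hnf hx), hheap' _ (hnf this.1)]
          exact this
        rlPub := fun x B b hx hb => by
          rw [hpub] at hx ⊢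
          unfold Mem.rl at hb
          rw [hheap' _ (hnf hx)] at hb
          exact hS.rlPub x B b hx hb
        cntSt := fun t x hx => by
          rw [hcnt] at hx
          have := hS.cntSt t x hx
          rwa [hst' x (by rcases this with ⟨B, hB⟩ | hB <;> rw [hB] <;> simp)] }
  · exact
      { pub := hpub
        key := fun a B h => congrArg Node.key (hheap' a (hnf h))
        bl := fun a B h => congrArg Node.bl (hheap' a (hnf h))
        marked := fun a B h => congrArg Node.marked (hheap' a (hnf h))
        val := fun a B h => congrArg Node.val (hheap' a (hnf h))
        cnt := fun t _ => hcnt t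
        priv := fun t _ a h => by
          have : S.st a ≠ .free := by rw [h]; simp
          exact ⟨(hst' a this).trans h, hheap' a this⟩ }

end Steps

end Actions

/-! ### The invariant of one thread at every program point, and its stability. -/

section Invariant

variable {T O K V : Type*} [DecidableEq T] [DecidableEq O] [LinearOrder K] {m : ℕ}

def LogEntry.bucket (hash : O → K → Fin m) (e : LogEntry O K V m) : O × Fin m :=
  (e.obj, hash e.obj e.key)

/-- The addresses whose locks are released for the entry. -/
def LogEntry.slots (e : LogEntry O K V m) : List (Addr O m) :=
  [e.bp, e.rp, e.rc, e.bc] ++ e.node.toList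

/-- The result of a traversal of the bucket `B` in search of `κ`. -/
structure Places (S : Mem T O K V m) (B : O × Fin m) (κ : WithBot (WithTop K))
    (bp rp rc bc : Addr O m) : Prop where
  bpPub : S.st bp = .pub B
  rpPub : S.st rp = .pub B
  rcPub : S.st rc = .pub B
  bcPub : S.st bc = .pub B
  lt : S.key bp < κ
  le : κ ≤ S.key bc

/-- The result of a successful search. -/
structure Found (S : Mem T O K V m) (B : O × Fin m) (κ : WithBot (WithTop K))
    (bp rp rc bc : Addr O m) : Prop where
  win : S.Win B κ bp bc
  rpPub : S.st rp = .pub B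
  rcPub : S.st rc = .pub B

/-- An entry that has been located by the first loop of `tryC`. -/
def FirstOK (hash : O → K → Fin m) (S : Mem T O K V m) (e : LogEntry O K V m) : Prop :=
  Found S (e.bucket hash) (nodeKey e.key) e.bp e.rp e.rc e.bc

/-- An entry whose effect is visible in the blue list. -/
structure DoneOK (hash : O → K → Fin m) (S : Mem T O K V m) (e : LogEntry O K V m) : Prop where
  rpPub : S.st e.rp = .pub (e.bucket hash)
  blue : S.Blue (e.bucket hash) e.bp
  lt : S.key e.bp < nodeKey e.key
  -- That `n` is among the slots means that its lock is still held, so no other thread can change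
  -- the value just stored.
  ins : e.opn = .insert →
    ∃ n ∈ e.slots, S.bl e.bp = some n ∧ S.key n = nodeKey e.key ∧ S.val n = e.val
  del : e.opn ≠ .insert → ∀ c, S.bl e.bp = some c → nodeKey e.key < S.key c

/-- `p` is a node that has been reached by an earlier entry of the same bucket. -/
def Behind (hash : O → K → Fin m) (S : Mem T O K V m) (done : List (LogEntry O K V m))
    (e : LogEntry O K V m) (p : Addr O m) : Prop :=
  ∃ e' ∈ done, e'.bucket hash = e.bucket hash ∧ p ∈ e'.slots ∧ S.key p ≤ nodeKey e'.key

/-- An entry that is still to be treated by the second loop of `tryC`. -/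
structure TodoOK (hash : O → K → Fin m) (S : Mem T O K V m) (done : List (LogEntry O K V m))
    (e : LogEntry O K V m) : Prop where
  places : Places S (e.bucket hash) (nodeKey e.key) e.bp e.rp e.rc e.bc
  -- Earlier entries have smaller keys in this bucket, so they act strictly to the left of `e.bc`:
  -- only the predecessor can have changed since the first loop.
  win : ∃ p, S.Win (e.bucket hash) (nodeKey e.key) p e.bc ∧ (p = e.bp ∨ Behind hash S done e p)

structure Phase2 (hash : O → K → Fin m) (S : Mem T O K V m)
    (done todo : List (LogEntry O K V m)) : Prop where
  doneOK : ∀ e ∈ done, DoneOK hash S e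
  todoOK : ∀ e ∈ todo, TodoOK hash S done e

/-- A program point names the step that comes next, so at `lockBp` nothing is held yet, and at
`unlockBp` everything still is. -/
def searchHeld (l : Local O K V m) : SearchPC → List (Addr O m)
  | .start | .readBl | .testBlKey | .readRl | .testRlKey | .lockBp => []
  | .lockRp => [l.bp]
  | .lockRc => [l.bp, l.rp]
  | .lockBc => [l.bp, l.rp, l.rc]
  | .unlockRp _ => [l.rp, l.rc, l.bc]
  | .unlockRc _ => [l.rc, l.bc]
  | .unlockBc _ => [l.bc]
  | _ => [l.bp, l.rp, l.rc, l.bc]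

def rvHeld (l : Local O K V m) : RvPC → List (Addr O m)
  | .unlockRp => [l.rp, l.rc, l.bc]
  | .unlockRc => [l.rc, l.bc]
  | .unlockBc => [l.bc]
  | .log => []
  | _ => [l.bp, l.rp, l.rc, l.bc]

def updHeld (l : Local O K V m) (e : LogEntry O K V m) : UpdPC → List (Addr O m)
  | .load => e.slots
  | .newBp | .lockBp => [l.rp, l.rc, l.bc] ++ e.node.toList
  | .newRp | .lockRp => [l.bp, l.rc, l.bc] ++ e.node.toList
  | .newRl | .newBl | .linkRl | .linkBl | .newTs | .newField => [l.bp, l.rp, l.rc, l.bc, l.node]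
  | _ => [l.bp, l.rp, l.rc, l.bc] ++ e.node.toList

def relHeld (e : LogEntry O K V m) : RelPC → List (Addr O m)
  | .loop | .bp => e.slots
  | .rp => [e.rp, e.rc, e.bc] ++ e.node.toList
  | .node => [e.rc, e.bc] ++ e.node.toList
  | .rc => [e.rc, e.bc]
  | .bc => [e.bc]

/-- The locks that a thread holds. -/
def held (l : Local O K V m) : List (Addr O m) :=
  match l.pc with
  | .search (.rv _) _ _ s => searchHeld l s
  | .search .tryC _ _ s => searchHeld l s ++ l.done.flatMap LogEntry.slots
  | .rvEff _ _ _ s => rvHeld l s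
  | .tcLoop => l.done.flatMap LogEntry.slots
  | .tcFound => [l.bp, l.rp, l.rc, l.bc] ++ l.done.flatMap LogEntry.slots
  | .tcAbort => l.done.flatMap LogEntry.slots
  | .updLoop => l.done.flatMap LogEntry.slots ++ l.todo.flatMap LogEntry.slots
  | .upd s =>
    match l.todo with
    | [] => []
    | e :: rest =>
      updHeld l e s ++ (l.done.flatMap LogEntry.slots ++ rest.flatMap LogEntry.slots)
  | .rel _ s =>
    match l.todo with
    | [] => []
    | e :: rest => relHeld e s ++ rest.flatMap LogEntry.slots
  | _ => []

/-- The node for which mark and blue list disagree. -/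
def exc (l : Local O K V m) : Option (Addr O m) :=
  match l.pc with
  | .upd .reBl | .upd .reLink => some l.rc
  | .upd .linkBl => some l.node
  | .upd .delRead | .upd .delLink => some l.bc
  | _ => none

/-- The traversal takes place without locks, so up to the tests only permanent facts are recorded:
publication in the bucket and keys. Membership of `l.bp` in the blue list appears once its mark has
been tested under its lock, the window once its link has been tested. -/
def SearchI (S : Mem T O K V m) (B : O × Fin m) (κ : WithBot (WithTop K)) (l : Local O K V m) :
    SearchPC → Prop
  | .start => True
  | .readBl => S.st l.bp = .pub B ∧ S.key l.bp < κ
  | .testBlKey => S.st l.bp = .pub B ∧ S.key l.bp < κ ∧ S.st l.bc = .pub B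
  | .readRl => S.st l.bp = .pub B ∧ S.key l.bp < κ ∧ S.st l.bc = .pub B ∧ κ ≤ S.key l.bc ∧
      S.st l.rp = .pub B
  | .testRlKey | .lockBp | .lockRp | .lockRc | .lockBc | .valBpMarked =>
      Places S B κ l.bp l.rp l.rc l.bc
  | .valBcMarked | .valBpBl => Places S B κ l.bp l.rp l.rc l.bc ∧ S.Blue B l.bp
  | .valRpRl | .aptCurr | .tsIns | .tsDel | .tsLook => Found S B κ l.bp l.rp l.rc l.bc
  | _ => True

def RvI (t : T) (S : Mem T O K V m) (B : O × Fin m) (κ : WithBot (WithTop K))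
    (l : Local O K V m) : RvPC → Prop
  | .dispatch => Found S B κ l.bp l.rp l.rc l.bc
  | .blueTs | .blueVal => Found S B κ l.bp l.rp l.rc l.bc ∧ S.key l.bc = κ
  | .redTs | .newNode => Found S B κ l.bp l.rp l.rc l.bc ∧ S.key l.bc ≠ κ
  | .newTs => Found S B κ l.bp l.rp l.rc l.bc ∧ S.key l.bc ≠ κ ∧ S.st l.node = .pub B
  | .newMarked => Found S B κ l.bp l.rp l.rc l.bc ∧ S.key l.bc ≠ κ ∧ S.st l.node = .priv t ∧
      (S.sh.heap l.node).bl = none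
  | .newRl => Found S B κ l.bp l.rp l.rc l.bc ∧ S.key l.bc ≠ κ ∧ S.st l.node = .priv t ∧
      (S.sh.heap l.node).bl = none ∧ (S.sh.heap l.node).marked = true
  | .linkRl => Found S B κ l.bp l.rp l.rc l.bc ∧ S.key l.bc ≠ κ ∧ S.st l.node = .priv t ∧
      (S.sh.heap l.node).bl = none ∧ (S.sh.heap l.node).marked = true ∧
      (S.sh.heap l.node).rl = some l.rc
  -- This is the linearization point: all four locks are still held, and `l.val` is still what the
  -- blue list says about the key.
  | .unlockBp => Found S B κ l.bp l.rp l.rc l.bc ∧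
      ((S.key l.bc = κ ∧ l.val = S.val l.bc) ∨ (S.key l.bc ≠ κ ∧ l.val = none))
  | _ => True

/-- The entry as it will be stored once the current entry has been treated. -/
def curEntry (l : Local O K V m) (e : LogEntry O K V m) : UpdPC → LogEntry O K V m
  | .newTs | .newField => { e with bp := l.bp, rp := l.rp, node := some l.node }
  | _ => { e with bp := l.bp, rp := l.rp }

/-- The program points at which the effect of the current entry is visible. -/
def UpdPC.isPost : UpdPC → Bool
  | .ovTs | .reTs | .newTs | .newField | .delTs | .finish => true
  | _ => false

/-- The invariant for the current entry, before its effect is visible. -/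
def PreI (hash : O → K → Fin m) (t : T) (S : Mem T O K V m) (l : Local O K V m)
    (e : LogEntry O K V m) : UpdPC → Prop
  | .load => TodoOK hash S l.done e
  | .testBpMarked => Places S (e.bucket hash) (nodeKey e.key) l.bp l.rp l.rc l.bc ∧
      ∃ p, S.Win (e.bucket hash) (nodeKey e.key) p l.bc ∧ (p = l.bp ∨ Behind hash S l.done e p)
  | .testBpBl => Places S (e.bucket hash) (nodeKey e.key) l.bp l.rp l.rc l.bc ∧
      S.Blue (e.bucket hash) l.bp ∧
      ∃ p, S.Win (e.bucket hash) (nodeKey e.key) p l.bc ∧ (p = l.bp ∨ Behind hash S l.done e p)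
  -- Here `l.bp` is obsolete; the true predecessor `p` is protected by the lock that an earlier
  -- entry holds.
  | .unlockBp | .newBp => S.st l.rp = .pub (e.bucket hash) ∧ S.st l.rc = .pub (e.bucket hash) ∧
      ∃ p, S.Win (e.bucket hash) (nodeKey e.key) p l.bc ∧ Behind hash S l.done e p
  -- The window is stable even before this locking, since the node is among the slots of an earlier
  -- entry.
  | .lockBp => Found S (e.bucket hash) (nodeKey e.key) l.bp l.rp l.rc l.bc ∧
      Behind hash S l.done e l.bp
  | .testRpRl | .unlockRp | .newRp | .lockRp | .dispatch =>
      Found S (e.bucket hash) (nodeKey e.key) l.bp l.rp l.rc l.bc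
  | .ovVal => Found S (e.bucket hash) (nodeKey e.key) l.bp l.rp l.rc l.bc ∧ e.opn = .insert ∧
      S.key l.bc = nodeKey e.key
  | .reVal => Found S (e.bucket hash) (nodeKey e.key) l.bp l.rp l.rc l.bc ∧ e.opn = .insert ∧
      S.key l.bc ≠ nodeKey e.key ∧ S.key l.rc = nodeKey e.key
  | .reMarked => Found S (e.bucket hash) (nodeKey e.key) l.bp l.rp l.rc l.bc ∧ e.opn = .insert ∧
      S.key l.bc ≠ nodeKey e.key ∧ S.key l.rc = nodeKey e.key ∧ S.val l.rc = e.val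
  | .reBl => Found S (e.bucket hash) (nodeKey e.key) l.bp l.rp l.rc l.bc ∧ e.opn = .insert ∧
      S.key l.bc ≠ nodeKey e.key ∧ S.key l.rc = nodeKey e.key ∧ S.val l.rc = e.val ∧
      S.marked l.rc = false
  | .reLink => Found S (e.bucket hash) (nodeKey e.key) l.bp l.rp l.rc l.bc ∧ e.opn = .insert ∧
      S.key l.bc ≠ nodeKey e.key ∧ S.key l.rc = nodeKey e.key ∧ S.val l.rc = e.val ∧
      S.marked l.rc = false ∧ S.bl l.rc = some l.bc
  | .newNode => Found S (e.bucket hash) (nodeKey e.key) l.bp l.rp l.rc l.bc ∧ e.opn = .insert ∧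
      S.key l.bc ≠ nodeKey e.key
  | .newLock | .newRl => Found S (e.bucket hash) (nodeKey e.key) l.bp l.rp l.rc l.bc ∧
      e.opn = .insert ∧ S.key l.bc ≠ nodeKey e.key ∧ S.st l.node = .priv t ∧
      (S.sh.heap l.node).key = nodeKey e.key ∧ (S.sh.heap l.node).val = e.val ∧
      (S.sh.heap l.node).marked = false
  | .newBl => Found S (e.bucket hash) (nodeKey e.key) l.bp l.rp l.rc l.bc ∧
      e.opn = .insert ∧ S.key l.bc ≠ nodeKey e.key ∧ S.st l.node = .priv t ∧
      (S.sh.heap l.node).key = nodeKey e.key ∧ (S.sh.heap l.node).val = e.val ∧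
      (S.sh.heap l.node).marked = false ∧ (S.sh.heap l.node).rl = some l.rc
  | .linkRl => Found S (e.bucket hash) (nodeKey e.key) l.bp l.rp l.rc l.bc ∧
      e.opn = .insert ∧ S.key l.bc ≠ nodeKey e.key ∧ S.st l.node = .priv t ∧
      (S.sh.heap l.node).key = nodeKey e.key ∧ (S.sh.heap l.node).val = e.val ∧
      (S.sh.heap l.node).marked = false ∧ (S.sh.heap l.node).rl = some l.rc ∧
      (S.sh.heap l.node).bl = some l.bc
  | .linkBl => Found S (e.bucket hash) (nodeKey e.key) l.bp l.rp l.rc l.bc ∧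
      e.opn = .insert ∧ S.key l.bc ≠ nodeKey e.key ∧ S.st l.node = .pub (e.bucket hash) ∧
      S.key l.node = nodeKey e.key ∧ S.val l.node = e.val ∧ S.marked l.node = false ∧
      S.bl l.node = some l.bc
  | .delMarked => Found S (e.bucket hash) (nodeKey e.key) l.bp l.rp l.rc l.bc ∧
      e.opn ≠ .insert ∧ S.key l.bc = nodeKey e.key
  | .delRead => Found S (e.bucket hash) (nodeKey e.key) l.bp l.rp l.rc l.bc ∧
      e.opn ≠ .insert ∧ S.key l.bc = nodeKey e.key ∧ S.marked l.bc = true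
  | .delLink => Found S (e.bucket hash) (nodeKey e.key) l.bp l.rp l.rc l.bc ∧
      e.opn ≠ .insert ∧ S.key l.bc = nodeKey e.key ∧ S.marked l.bc = true ∧ l.tmp = S.bl l.bc
  | .newTs | .newField => S.bl l.bp = some l.node
  | _ => True

/-- The invariant of the second loop of `tryC` inside the treatment of the entry `e`. -/
structure UpdI (hash : O → K → Fin m) (t : T) (S : Mem T O K V m) (l : Local O K V m)
    (e : LogEntry O K V m) (rest : List (LogEntry O K V m)) (s : UpdPC) : Prop where
  eqs : s ≠ .load → l.rc = e.rc ∧ l.bc = e.bc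
  -- As soon as its effect is visible, the current entry counts as done, in the form in which
  -- `finish` will store it.
  phase : Phase2 hash S (if s.isPost then l.done ++ [curEntry l e s] else l.done) rest
  cur : PreI hash t S l e s

/-- What a thread knows about the memory, apart from its locks. -/
def PcI (hash : O → K → Fin m) (t : T) (S : Mem T O K V m) (l : Local O K V m) : Prop :=
  match l.pc with
  | .search (.rv _) o k s => SearchI S (o, hash o k) (nodeKey k) l s
  | .search .tryC o k s => SearchI S (o, hash o k) (nodeKey k) l s ∧
      (∃ e rest, l.todo = e :: rest ∧ e.obj = o ∧ e.key = k) ∧ ∀ e ∈ l.done, FirstOK hash S e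
  | .rvEff _ o k s => RvI t S (o, hash o k) (nodeKey k) l s
  | .tcLoop => ∀ e ∈ l.done, FirstOK hash S e
  | .tcFound =>
      (∃ e rest, l.todo = e :: rest ∧
        Found S (e.bucket hash) (nodeKey e.key) l.bp l.rp l.rc l.bc) ∧
      ∀ e ∈ l.done, FirstOK hash S e
  | .updLoop => Phase2 hash S l.done l.todo
  | .upd s => ∃ e rest, l.todo = e :: rest ∧ UpdI hash t S l e rest s
  -- Before the linearization point nothing has been released, so all entries are intact. An
  -- aborting release starts with `lpDone` set.
  | .rel ok s => l.lpDone = false → ok = true ∧ (s = .loop ∨ s = .bp) ∧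
      ∀ e ∈ l.todo, DoneOK hash S e
  | _ => True

/-- The invariant of thread `t`. -/
structure LI (hash : O → K → Fin m) (t : T) (S : Mem T O K V m) (l : Local O K V m) : Prop where
  held : Held t S (held l)
  pc : PcI hash t S l

section Mono

variable {hash : O → K → Fin m} {X Y : Addr O m → Prop} {S S' : Mem T O K V m}

theorem Mem.Win.mono {B : O × Fin m} {κ : WithBot (WithTop K)} {p c : Addr O m}
    (h : S.Win B κ p c) (hS : S.WF) (hA : Agree X Y S S') (hp : X p) : S'.Win B κ p c where
  blue := hA.blue _ _ hp h.blue
  next := (hA.bl _ _ hp (hS.blue_pub h.blue)).trans h.next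
  lt := (hA.key _ _ (hS.blue_pub h.blue)).symm ▸ h.lt
  le := (hA.key _ _ (hS.blue_pub h.blue_next)).symm ▸ h.le

theorem Places.mono {B : O × Fin m} {κ : WithBot (WithTop K)} {bp rp rc bc : Addr O m}
    (h : Places S B κ bp rp rc bc) (hA : Agree X Y S S') : Places S' B κ bp rp rc bc where
  bpPub := hA.pub _ _ h.bpPub
  rpPub := hA.pub _ _ h.rpPub
  rcPub := hA.pub _ _ h.rcPub
  bcPub := hA.pub _ _ h.bcPub
  lt := (hA.key _ _ h.bpPub).symm ▸ h.lt
  le := (hA.key _ _ h.bcPub).symm ▸ h.le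

theorem Found.mono {B : O × Fin m} {κ : WithBot (WithTop K)} {bp rp rc bc : Addr O m}
    (h : Found S B κ bp rp rc bc) (hS : S.WF) (hA : Agree X Y S S') (hp : X bp) :
    Found S' B κ bp rp rc bc where
  win := h.win.mono hS hA hp
  rpPub := hA.pub _ _ h.rpPub
  rcPub := hA.pub _ _ h.rcPub

/-- `hY` asks for stable values only at slots that carry the key of the entry itself, which leaves
room for a later entry to overwrite another node. -/
theorem DoneOK.mono {e : LogEntry O K V m} (h : DoneOK hash S e) (hS : S.WF)
    (hA : Agree X Y S S') (hX : X e.bp)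
    (hY : ∀ n ∈ e.slots, S.key n = nodeKey e.key → S.st n = .pub (e.bucket hash) → Y n) :
    DoneOK hash S' e where
  rpPub := hA.pub _ _ h.rpPub
  blue := hA.blue _ _ hX h.blue
  lt := (hA.key _ _ (hS.blue_pub h.blue)).symm ▸ h.lt
  ins hi := by
    obtain ⟨n, hn, hbl, hk, hv⟩ := h.ins hi
    have hp := hS.blue_pub h.blue
    have hnp := (hS.blPub _ _ _ hp hbl).1
    exact ⟨n, hn, (hA.bl _ _ hX hp).trans hbl, (hA.key _ _ hnp).trans hk,
      (hA.val _ _ (hY n hn hk hnp) hnp).trans hv⟩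
  del hd c hc := by
    have hp := hS.blue_pub h.blue
    rw [hA.bl _ _ hX hp] at hc
    rw [hA.key _ _ (hS.blPub _ _ _ hp hc).1]
    exact h.del hd c hc

theorem Behind.mono {done : List (LogEntry O K V m)} {e : LogEntry O K V m} {p : Addr O m}
    (h : Behind hash S done e p) (hA : Agree X Y S S') {B : O × Fin m} (hp : S.st p = .pub B) :
    Behind hash S' done e p := by
  obtain ⟨e', h1, h2, h3, h4⟩ := h
  exact ⟨e', h1, h2, h3, (hA.key _ _ hp).symm ▸ h4⟩

/-- In either alternative the predecessor is a node that the transaction has locked, for this entry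
or for an earlier one. -/
theorem win_or_behind_mono {done : List (LogEntry O K V m)} {e : LogEntry O K V m}
    {bp bc : Addr O m} (hS : S.WF) (hA : Agree X Y S S') (hX : X bp)
    (hXd : ∀ e' ∈ done, ∀ a ∈ e'.slots, X a)
    (h : ∃ p, S.Win (e.bucket hash) (nodeKey e.key) p bc ∧ (p = bp ∨ Behind hash S done e p)) :
    ∃ p, S'.Win (e.bucket hash) (nodeKey e.key) p bc ∧ (p = bp ∨ Behind hash S' done e p) := by
  obtain ⟨p, hw, hp⟩ := h
  have hXp : X p := by
    rcases hp with rfl | ⟨e', h1, _, h3, _⟩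
    · exact hX
    · exact hXd e' h1 p h3
  exact ⟨p, hw.mono hS hA hXp, hp.imp id fun hb => hb.mono hA (hS.blue_pub hw.blue)⟩

theorem TodoOK.mono {done : List (LogEntry O K V m)} {e : LogEntry O K V m}
    (h : TodoOK hash S done e) (hS : S.WF) (hA : Agree X Y S S') (hX : X e.bp)
    (hXd : ∀ e' ∈ done, ∀ a ∈ e'.slots, X a) : TodoOK hash S' done e where
  places := h.places.mono hA
  win := win_or_behind_mono hS hA hX hXd h.win

theorem Phase2.mono {done todo : List (LogEntry O K V m)} (h : Phase2 hash S done todo)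
    (hS : S.WF) (hA : Agree X Y S S') (hXd : ∀ e ∈ done, ∀ a ∈ e.slots, X a)
    (hYd : ∀ e ∈ done, ∀ a ∈ e.slots, S.key a = nodeKey e.key → S.st a = .pub (e.bucket hash) → Y a)
    (hXt : ∀ e ∈ todo, X e.bp) : Phase2 hash S' done todo where
  doneOK e he := (h.doneOK e he).mono hS hA (hXd e he _ (by simp [LogEntry.slots])) (hYd e he)
  todoOK e he := (h.todoOK e he).mono hS hA (hXt e he) hXd

end Mono

section Stable

variable {hash : O → K → Fin m} {X Y : Addr O m → Prop} {S S' : Mem T O K V m} {t : T}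
  {l : Local O K V m}

theorem SearchI.mono {B : O × Fin m} {κ : WithBot (WithTop K)} {s : SearchPC}
    (h : SearchI S B κ l s) (hS : S.WF) (hA : Agree X Y S S')
    (hX : ∀ a ∈ searchHeld l s, X a) : SearchI S' B κ l s := by
  cases s <;> simp only [SearchI, searchHeld, List.mem_cons, forall_eq_or_imp] at h hX ⊢
  case readBl => exact ⟨hA.pub _ _ h.1, (hA.key _ _ h.1).symm ▸ h.2⟩
  case testBlKey => exact ⟨hA.pub _ _ h.1, (hA.key _ _ h.1).symm ▸ h.2.1, hA.pub _ _ h.2.2⟩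
  case readRl =>
    exact ⟨hA.pub _ _ h.1, (hA.key _ _ h.1).symm ▸ h.2.1, hA.pub _ _ h.2.2.1,
      (hA.key _ _ h.2.2.1).symm ▸ h.2.2.2.1, hA.pub _ _ h.2.2.2.2⟩
  case testRlKey | lockBp | lockRp | lockRc | lockBc | valBpMarked => exact h.mono hA
  case valBcMarked | valBpBl => exact ⟨h.1.mono hA, hA.blue _ _ hX.1 h.2⟩
  case valRpRl | aptCurr | tsIns | tsDel | tsLook => exact h.mono hS hA hX.1

theorem Found.bcPub {B : O × Fin m} {κ : WithBot (WithTop K)} {bp rp rc bc : Addr O m}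
    (h : Found S B κ bp rp rc bc) (hS : S.WF) : S.st bc = .pub B := hS.blue_pub h.win.blue_next

theorem Found.bpPub {B : O × Fin m} {κ : WithBot (WithTop K)} {bp rp rc bc : Addr O m}
    (h : Found S B κ bp rp rc bc) (hS : S.WF) : S.st bp = .pub B := hS.blue_pub h.win.blue

theorem RvI.rely {B : O × Fin m} {κ : WithBot (WithTop K)} {s : RvPC}
    (h : RvI t S B κ l s) (hS : S.WF) (hR : Rely t S S')
    (hX : ∀ a ∈ rvHeld l s, 0 < S.cnt t a) : RvI t S' B κ l s := by
  have hA := hR.agree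
  cases s <;> simp only [RvI, rvHeld, List.mem_cons, forall_eq_or_imp] at h hX ⊢
  case dispatch => exact h.mono hS hA hX.1
  case blueTs | blueVal => exact ⟨h.1.mono hS hA hX.1, (hA.key _ _ (h.1.bcPub hS)).trans h.2⟩
  case redTs | newNode =>
    exact ⟨h.1.mono hS hA hX.1, (hA.key _ _ (h.1.bcPub hS)).trans_ne h.2⟩
  case newTs =>
    exact ⟨h.1.mono hS hA hX.1, (hA.key _ _ (h.1.bcPub hS)).trans_ne h.2.1, hA.pub _ _ h.2.2⟩
  case newMarked | newRl | linkRl =>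
    obtain ⟨h1, h2, h3, h4⟩ := h
    obtain ⟨h5, h6⟩ := hR.priv _ h3
    exact ⟨h1.mono hS hA hX.1, (hA.key _ _ (h1.bcPub hS)).trans_ne h2, h5, by rw [h6]; exact h4⟩
  case unlockBp =>
    refine ⟨h.1.mono hS hA hX.1, ?_⟩
    rw [hA.key _ _ (h.1.bcPub hS), hA.val _ _ hX.2.2.2.1 (h.1.bcPub hS)]
    exact h.2

theorem PreI.rely {e : LogEntry O K V m} {s : UpdPC} (h : PreI hash t S l e s) (hS : S.WF)
    (hR : Rely t S S') (hs : s ≠ .load → l.rc = e.rc ∧ l.bc = e.bc)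
    (hph : s.isPost = true → S.Blue (e.bucket hash) l.bp)
    (hX : ∀ a ∈ updHeld l e s, 0 < S.cnt t a)
    (hXd : ∀ e' ∈ l.done, ∀ a ∈ e'.slots, 0 < S.cnt t a) : PreI hash t S' l e s := by
  have hA := hR.agree
  cases s <;> simp only [PreI, updHeld, List.mem_cons, forall_eq_or_imp, List.cons_append]
    at h hX hph ⊢
  case load => exact h.mono hS hA (hX _ (by simp [LogEntry.slots])) hXd
  case testBpMarked => exact ⟨h.1.mono hA, win_or_behind_mono hS hA hX.1 hXd h.2⟩
  case testBpBl =>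
    exact ⟨h.1.mono hA, hA.blue _ _ hX.1 h.2.1, win_or_behind_mono hS hA hX.1 hXd h.2.2⟩
  case unlockBp | newBp =>
    obtain ⟨h1, h2, p, hw, hb⟩ := h
    refine ⟨hA.pub _ _ h1, hA.pub _ _ h2, p, hw.mono hS hA ?_, hb.mono hA (hS.blue_pub hw.blue)⟩
    obtain ⟨e', he', -, hp, -⟩ := hb
    exact hXd e' he' p hp
  case lockBp =>
    obtain ⟨h1, hb⟩ := h
    refine ⟨h1.mono hS hA ?_, hb.mono hA (h1.bpPub hS)⟩
    obtain ⟨e', he', -, hp, -⟩ := hb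
    exact hXd e' he' _ hp
  case testRpRl | unlockRp | newRp | lockRp | dispatch => exact h.mono hS hA hX.1
  case ovVal | delMarked =>
    exact ⟨h.1.mono hS hA hX.1, h.2.1, (hA.key _ _ (h.1.bcPub hS)).trans h.2.2⟩
  case delRead =>
    obtain ⟨h1, h2, h3, h4⟩ := h
    exact ⟨h1.mono hS hA hX.1, h2, (hA.key _ _ (h1.bcPub hS)).trans h3,
      (hR.marked _ _ hX.2.2.2.1 (h1.bcPub hS)).trans h4⟩
  case delLink =>
    obtain ⟨h1, h2, h3, h4, h5⟩ := h
    exact ⟨h1.mono hS hA hX.1, h2, (hA.key _ _ (h1.bcPub hS)).trans h3,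
      (hR.marked _ _ hX.2.2.2.1 (h1.bcPub hS)).trans h4,
      h5.trans (hA.bl _ _ hX.2.2.2.1 (h1.bcPub hS)).symm⟩
  case newNode =>
    exact ⟨h.1.mono hS hA hX.1, h.2.1, (hA.key _ _ (h.1.bcPub hS)).trans_ne h.2.2⟩
  case newLock | newRl | newBl | linkRl =>
    obtain ⟨h1, h2, h3, h4, h5⟩ := h
    obtain ⟨h6, h7⟩ := hR.priv _ h4
    exact ⟨h1.mono hS hA hX.1, h2, (hA.key _ _ (h1.bcPub hS)).trans_ne h3, h6, by
      rw [h7]; exact h5⟩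
  case linkBl =>
    obtain ⟨h1, h2, h3, h4, h5, h6, h7, h8⟩ := h
    have ho := hX.2.2.2.2.1
    exact ⟨h1.mono hS hA hX.1, h2, (hA.key _ _ (h1.bcPub hS)).trans_ne h3, hA.pub _ _ h4,
      (hA.key _ _ h4).trans h5, (hA.val _ _ ho h4).trans h6, (hR.marked _ _ ho h4).trans h7,
      (hA.bl _ _ ho h4).trans h8⟩
  case newTs | newField => exact (hA.bl _ _ hX.1 (hS.blue_pub (hph rfl))).trans h
  case reVal =>
    obtain ⟨h1, h2, h3, h4⟩ := h
    exact ⟨h1.mono hS hA hX.1, h2, (hA.key _ _ (h1.bcPub hS)).trans_ne h3,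
      (hA.key _ _ h1.rcPub).trans h4⟩
  case reMarked =>
    obtain ⟨h1, h2, h3, h4, h5⟩ := h
    exact ⟨h1.mono hS hA hX.1, h2, (hA.key _ _ (h1.bcPub hS)).trans_ne h3,
      (hA.key _ _ h1.rcPub).trans h4, (hA.val _ _ hX.2.2.1 h1.rcPub).trans h5⟩
  case reBl =>
    obtain ⟨h1, h2, h3, h4, h5, h6⟩ := h
    exact ⟨h1.mono hS hA hX.1, h2, (hA.key _ _ (h1.bcPub hS)).trans_ne h3,
      (hA.key _ _ h1.rcPub).trans h4, (hA.val _ _ hX.2.2.1 h1.rcPub).trans h5,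
      (hR.marked _ _ hX.2.2.1 h1.rcPub).trans h6⟩
  case reLink =>
    obtain ⟨h1, h2, h3, h4, h5, h6, h7⟩ := h
    exact ⟨h1.mono hS hA hX.1, h2, (hA.key _ _ (h1.bcPub hS)).trans_ne h3,
      (hA.key _ _ h1.rcPub).trans h4, (hA.val _ _ hX.2.2.1 h1.rcPub).trans h5,
      (hR.marked _ _ hX.2.2.1 h1.rcPub).trans h6, (hA.bl _ _ hX.2.2.1 h1.rcPub).trans h7⟩

theorem curEntry_bucket (l : Local O K V m) (e : LogEntry O K V m) (s : UpdPC) :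
    (curEntry l e s).bucket hash = e.bucket hash := by cases s <;> rfl

theorem curEntry_bp (l : Local O K V m) (e : LogEntry O K V m) (s : UpdPC) :
    (curEntry l e s).bp = l.bp := by cases s <;> rfl

/-- The stored entry takes `rc` and `bc` from `e`, whereas the locks are counted for the registers
of `l`; `he` reconciles the two. -/
theorem curEntry_slots {e : LogEntry O K V m} {s : UpdPC} (hs : s.isPost = true)
    (he : l.rc = e.rc ∧ l.bc = e.bc) : ∀ a ∈ (curEntry l e s).slots, a ∈ updHeld l e s := by
  cases s <;> simp [UpdPC.isPost] at hs <;> simp [curEntry, LogEntry.slots, updHeld, he]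

theorem UpdI.rely {e : LogEntry O K V m} {rest : List (LogEntry O K V m)} {s : UpdPC}
    (h : UpdI hash t S l e rest s) (hS : S.WF) (hR : Rely t S S')
    (hX : ∀ a ∈ updHeld l e s, 0 < S.cnt t a)
    (hXd : ∀ e' ∈ l.done, ∀ a ∈ e'.slots, 0 < S.cnt t a)
    (hXr : ∀ e' ∈ rest, ∀ a ∈ e'.slots, 0 < S.cnt t a) : UpdI hash t S' l e rest s := by
  have hdone : ∀ e' ∈ (if s.isPost then l.done ++ [curEntry l e s] else l.done),
      ∀ a ∈ e'.slots, 0 < S.cnt t a := by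
    intro e' he' a ha
    split_ifs at he' with hp
    · rcases List.mem_append.1 he' with h1 | h1
      · exact hXd e' h1 a ha
      · rw [List.mem_singleton.1 h1] at ha
        exact hX a (curEntry_slots hp (h.eqs (by rintro rfl; simp [UpdPC.isPost] at hp)) a ha)
    · exact hXd e' he' a ha
  refine ⟨h.eqs, h.phase.mono hS hR.agree hdone (fun e he a ha _ _ => hdone e he a ha)
    fun e he => hXr e he _ (by simp [LogEntry.slots]), h.cur.rely hS hR h.eqs ?_ hX hXd⟩
  intro hp
  have := (h.phase.doneOK (curEntry l e s) (by simp [hp])).blue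
  rwa [curEntry_bucket, curEntry_bp] at this

theorem FirstOK.mono {e : LogEntry O K V m} (h : FirstOK hash S e) (hS : S.WF)
    (hA : Agree X Y S S') (hX : X e.bp) : FirstOK hash S' e := Found.mono h hS hA hX

theorem mem_slots_bp (e : LogEntry O K V m) : e.bp ∈ e.slots := by simp [LogEntry.slots]

/-- Every assertion of the invariant concerns a node locked by `t`, a node private to `t`, or a key
or publication, which never change. This is why the steps of other threads can be ignored from here
on. -/
theorem LI.rely (h : LI hash t S l) (hS : S.WF) (hR : Rely t S S') : LI hash t S' l := by
  refine ⟨h.held.congr hR.cnt, ?_⟩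
  obtain ⟨hH, hP⟩ := h
  have hA := hR.agree
  have own : ∀ a ∈ HTOSTM.held l, 0 < S.cnt t a := fun a ha => hH.own ha
  unfold PcI HTOSTM.held at *
  rcases hpc : l.pc with _ | _ | _ | _ | _ | ⟨_ | _, o, k, s⟩ | _ | _ | _ | _ | _ | _ | _ | s | ⟨ok, s⟩ | _ | _ <;>
    simp only [hpc] at hP own ⊢
  · exact hP.mono hS hA own
  · refine ⟨hP.1.mono hS hA fun a ha => own a (List.mem_append_left _ ha), hP.2.1,
      fun e he => (hP.2.2 e he).mono hS hA ?_⟩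
    exact own _ (List.mem_append_right _ (List.mem_flatMap.2 ⟨e, he, mem_slots_bp e⟩))
  · exact hP.rely hS hR own
  · exact fun e he => (hP e he).mono hS hA (own _ (List.mem_flatMap.2 ⟨e, he, mem_slots_bp e⟩))
  · obtain ⟨⟨e, rest, h1, h2⟩, h3⟩ := hP
    exact ⟨⟨e, rest, h1, h2.mono hS hA (own _ (by simp))⟩, fun e he => (h3 e he).mono hS hA
      (own _ (List.mem_append_right _ (List.mem_flatMap.2 ⟨e, he, mem_slots_bp e⟩)))⟩
  · have hd : ∀ e ∈ l.done, ∀ a ∈ e.slots, 0 < S.cnt t a := fun e he a ha =>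
      own _ (List.mem_append_left _ (List.mem_flatMap.2 ⟨e, he, ha⟩))
    exact hP.mono hS hA hd (fun e he a ha _ _ => hd e he a ha) fun e he =>
      own _ (List.mem_append_right _ (List.mem_flatMap.2 ⟨e, he, mem_slots_bp e⟩))
  · obtain ⟨e, rest, h1, h2⟩ := hP
    simp only [h1] at own
    refine ⟨e, rest, h1, h2.rely hS hR (fun a ha => own a (List.mem_append_left _ ha)) ?_ ?_⟩
    · exact fun e' he' a ha => own a (List.mem_append_right _ (List.mem_append_left _
        (List.mem_flatMap.2 ⟨e', he', ha⟩)))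
    · exact fun e' he' a ha => own a (List.mem_append_right _ (List.mem_append_right _
        (List.mem_flatMap.2 ⟨e', he', ha⟩)))
  · intro hl
    obtain ⟨h1, h2, h3⟩ := hP hl
    refine ⟨h1, h2, ?_⟩
    have hs : ∀ e ∈ l.todo, ∀ a ∈ e.slots, 0 < S.cnt t a := by
      intro e he a ha
      apply own
      cases htd : l.todo with
      | nil => simp [htd] at he
      | cons e0 rest =>
        rw [htd] at he
        have : relHeld e0 s = e0.slots := by rcases h2 with rfl | rfl <;> rfl
        simp only [this]
        rcases List.mem_cons.1 he with rfl | he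
        · exact List.mem_append_left _ ha
        · exact List.mem_append_right _ (List.mem_flatMap.2 ⟨e, he, ha⟩)
    exact fun e he => (h3 e he).mono hS hA (hs e he _ (mem_slots_bp e))
      fun n hn _ _ => hs e he n hn

end Stable

end Invariant

/-! ### The global memory invariant and the steps of `lslSearch`. -/

section Steps

variable {T O K V : Type*} [DecidableEq T] [DecidableEq O] [LinearOrder K] {m : ℕ}

/-- The invariant of the shared memory and the local states of the threads. -/
structure MemInv (hash : O → K → Fin m) (S : Mem T O K V m) (L : T → Local O K V m) : Prop where
  wf : S.WF
  li : ∀ t, LI hash t S (L t)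
  mark : ∀ a B, S.st a = .pub B → (∀ t, exc (L t) ≠ some a) → (S.marked a = false ↔ S.Blue B a)

/-- The blue list of `B` stores the value `r` for the key `κ`. -/
def Content (S : Mem T O K V m) (B : O × Fin m) (κ : WithBot (WithTop K)) (r : Option V) : Prop :=
  -- The clause `r ≠ none` makes nil mean that the key is absent from the blue list.
  (∀ a, S.Blue B a → S.key a = κ → S.val a = r ∧ r ≠ none) ∧
    (r ≠ none → ∃ a, S.Blue B a ∧ S.key a = κ)

/-- The thread may have changed the value of `⟨o, k⟩` without having committed yet. -/
def Dirty (l : Local O K V m) (o : O) (k : K) : Prop :=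
  match l.pc with
  | .updLoop | .upd _ => ∃ e ∈ l.done ++ l.todo, e.obj = o ∧ e.key = k
  | .rel _ _ => l.lpDone = false ∧ ∃ e ∈ l.todo, e.obj = o ∧ e.key = k
  | _ => False

/-- The step of `u` to the memory `g'` and the local state `l'` keeps the invariant and the values of
all keys that are not dirty. -/
def StepOK (hash : O → K → Fin m) (u : T) (S : Mem T O K V m) (L : T → Local O K V m)
    (g' : Shared T O K V m) (l' : Local O K V m) : Prop :=
  ∃ S' : Mem T O K V m, S'.sh = g' ∧ MemInv hash S' (Function.update L u l') ∧
    ∀ o k r, ¬ Dirty (L u) o k → Content S (o, hash o k) (nodeKey k) r →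
      Content S' (o, hash o k) (nodeKey k) r

variable {hash : O → K → Fin m} {u t : T} {S S' : Mem T O K V m} {L : T → Local O K V m}
  {g' : Shared T O K V m} {l l' : Local O K V m} {ev : Option (Event T O K V)}

theorem Quiet.content (hQ : Quiet u S S') (hS : S.WF) {B : O × Fin m} {κ : WithBot (WithTop K)}
    {r : Option V} (h : Content S B κ r) : Content S' B κ r := by
  refine ⟨fun a ha hk => ?_, fun hr => ?_⟩
  · rw [hQ.blue hS] at ha
    rw [hQ.key _ _ (hS.blue_pub ha)] at hk
    rw [hQ.val _ _ (hS.blue_pub ha)]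
    exact h.1 a ha hk
  · obtain ⟨a, ha, hk⟩ := h.2 hr
    exact ⟨a, (hQ.blue hS _ _).2 ha, (hQ.key _ _ (hS.blue_pub ha)).trans hk⟩

/-- The acting thread establishes its own invariant, the others rely on its guarantee. -/
theorem MemInv.guar (hM : MemInv hash S L) (hS' : S'.WF) (hG : Guar u S S')
    (hLI : LI hash u S' l')
    (hmark : ∀ a B, S'.st a = .pub B → (∀ t, exc (Function.update L u l' t) ≠ some a) →
      (S'.marked a = false ↔ S'.Blue B a)) :
    MemInv hash S' (Function.update L u l') := by
  refine ⟨hS', fun t => ?_, hmark⟩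
  by_cases ht : t = u
  · subst ht; simpa using hLI
  · rw [Function.update_of_ne ht]
    exact (hM.li t).rely hM.wf (hG.rely hM.wf ht)

theorem MemInv.quiet (hM : MemInv hash S L) (hS' : S'.WF) (hQ : Quiet u S S')
    (hexc : ∀ a, exc (L u) = some a → exc l' = some a) (hLI : LI hash u S' l') :
    MemInv hash S' (Function.update L u l') := by
  refine hM.guar hS' (hQ.guar hM.wf) hLI fun a B ha he => ?_
  rw [hQ.pub] at ha
  rw [hQ.marked _ _ ha, hQ.blue hM.wf]
  refine hM.mark a B ha fun t => ?_
  have := he t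
  by_cases ht : t = u
  · subst ht
    rw [Function.update_self] at this
    exact fun h => this (hexc a h)
  · rwa [Function.update_of_ne ht] at this

theorem StepOK.quiet (hM : MemInv hash S L) (hS' : S'.WF) (hQ : Quiet u S S')
    (hexc : ∀ a, exc (L u) = some a → exc l' = some a) (hLI : LI hash u S' l') :
    StepOK hash u S L S'.sh l' :=
  ⟨S', rfl, hM.quiet hS' hQ hexc hLI, fun _ _ _ _ h => hQ.content hM.wf h⟩

theorem StepOK.silent (hM : MemInv hash S L)
    (hexc : ∀ a, exc (L u) = some a → exc l' = some a) (hLI : LI hash u S l') :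
    StepOK hash u S L S.sh l' := StepOK.quiet hM hM.wf Quiet.rfl' hexc hLI

/-- The exceptional points all lie between two writes of the second loop of `tryC`, during which the
node concerned stays locked. -/
theorem exc_mem_held {a : Addr O m} (h : LI hash t S l) (he : exc l = some a) : a ∈ held l := by
  have hp := h.pc
  unfold exc at he
  unfold PcI at hp
  unfold held
  split at he <;> rename_i hpc <;> simp only [hpc, Option.some.injEq, reduceCtorEq] at he hp ⊢ <;>
    obtain ⟨e, rest, h1, -⟩ := hp <;> simp [h1, updHeld, he]

/-- With the lock of `a` in the hands of `u`, no other thread can be between marking and linking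
`a`, so the mark can be trusted. -/
theorem MemInv.mark_own (hM : MemInv hash S L) {a : Addr O m} {B : O × Fin m}
    (ha : S.st a = .pub B) (hown : 0 < S.cnt u a) (he : exc (L u) ≠ some a) :
    S.marked a = false ↔ S.Blue B a := by
  refine hM.mark a B ha fun t ht => ?_
  by_cases htu : t = u
  · exact he (htu ▸ ht)
  · exact htu (S.cnt_unique ((hM.li t).held.own (exc_mem_held (hM.li t) ht)) hown)

/-- The locks that a search has inherited from its caller. -/
def callerHeld (c : Caller) (l : Local O K V m) : List (Addr O m) :=
  match c with
  | .rv _ => []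
  | .tryC => l.done.flatMap LogEntry.slots

def CallerI (hash : O → K → Fin m) (S : Mem T O K V m) (c : Caller) (o : O) (k : K)
    (l : Local O K V m) : Prop :=
  match c with
  | .rv _ => True
  | .tryC => (∃ e rest, l.todo = e :: rest ∧ e.obj = o ∧ e.key = k) ∧ ∀ e ∈ l.done, FirstOK hash S e

/-- Separates what the search knows from what its caller knows, so that both callers are handled by
the same case analysis. -/
theorem li_search_iff {c : Caller} {o : O} {k : K} {s : SearchPC}
    (hpc : l.pc = .search c o k s) : LI hash t S l ↔
      Held t S (searchHeld l s ++ callerHeld c l) ∧ SearchI S (o, hash o k) (nodeKey k) l s ∧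
        CallerI hash S c o k l := by
  constructor
  · rintro ⟨h1, h2⟩
    unfold held at h1
    unfold PcI at h2
    rw [hpc] at h1 h2
    cases c
    · exact ⟨by simpa [callerHeld] using h1, h2, trivial⟩
    · exact ⟨h1, h2⟩
  · rintro ⟨h1, h2, h3⟩
    constructor
    · unfold held
      rw [hpc]
      cases c
      · simpa [callerHeld] using h1
      · exact h1
    · unfold PcI
      rw [hpc]
      cases c
      · exact h2
      · exact ⟨h2, h3⟩

theorem CallerI.quiet {c : Caller} {o : O} {k : K} (h : CallerI hash S c o k l) (hS : S.WF)
    (hQ : Quiet u S S') : CallerI hash S' c o k l := by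
  cases c
  · trivial
  · exact ⟨h.1, fun e he => (h.2 e he).mono hS (hQ.agree hS (fun _ => True) fun _ => True) trivial⟩

theorem li_found {c : Caller} {o : O} {k : K}
    (hpc : l.pc = match c with | .rv d => .rvEff d o k .dispatch | .tryC => .tcFound)
    (h1 : Held t S ([l.bp, l.rp, l.rc, l.bc] ++ callerHeld c l))
    (h2 : Found S (o, hash o k) (nodeKey k) l.bp l.rp l.rc l.bc) (h3 : CallerI hash S c o k l) :
    LI hash t S l := by
  cases c
  · constructor
    · unfold held
      rw [hpc]
      simpa [callerHeld, rvHeld] using h1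
    · unfold PcI
      rw [hpc]
      exact h2
  · constructor
    · unfold held
      rw [hpc]
      exact h1
    · unfold PcI
      rw [hpc]
      obtain ⟨⟨e, rest, h4, rfl, rfl⟩, h5⟩ := h3
      exact ⟨⟨e, rest, h4, h2⟩, h5⟩

theorem exc_search {c : Caller} {o : O} {k : K} {s : SearchPC} (hpc : l.pc = .search c o k s) :
    exc l = none := by simp [exc, hpc]

section Search

variable {c : Caller} {o : O} {k : K} {s : SearchPC}

/-- Two tests carry the result: an unmarked `l.bp` is blue, and `p_b.BL = c_b` makes it the
predecessor of `l.bc`. The outcomes of all other tests, in particular of those on time-stamps, are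
not exploited. -/
theorem step_search (hM : MemInv hash S L) (hpc : (L u).pc = .search c o k s)
    (hs : stepSearch hash u S.sh (L u) c o k s = some (g', l', ev)) :
    StepOK hash u S L g' l' := by
  have hS := hM.wf
  obtain ⟨hH, hI, hC⟩ := (li_search_iff hpc).1 (hM.li u)
  have hex : ∀ (l' : Local O K V m) a, exc (L u) = some a → exc l' = some a := by
    intro l' a h
    simp [exc_search hpc] at h
  have hmark := fun a B h1 h2 => hM.mark_own (u := u) (a := a) (B := B) h1 h2
    (by simp [exc_search hpc])
  generalize hl : L u = l at *
  have silent : ∀ {l'}, LI hash u S l' → StepOK hash u S L S.sh l' := fun h =>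
    StepOK.silent hM (by rw [hl]; exact hex _) h
  have go : ∀ (s' : SearchPC) {l' : Local O K V m}, l'.pc = .search c o k s' →
      Held u S (searchHeld l' s' ++ callerHeld c l') →
      SearchI S (o, hash o k) (nodeKey k) l' s' → CallerI hash S c o k l' →
      StepOK hash u S L S.sh l' := fun s' l' h1 h2 h3 h4 =>
    silent ((li_search_iff h1).2 ⟨h2, h3, h4⟩)
  have lock : ∀ {a s'}, (S.sh.lock u a).map (fun g' => (g', { l with pc := .search c o k s' },
      (none : Option (Event T O K V)))) = some (g', l', ev) → (S.st a = .pub (o, hash o k)) →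
      (∀ x, (searchHeld l s').count x ≤ (a :: searchHeld l s).count x) →
      (∀ {S'}, Quiet u S S' → SearchI S' (o, hash o k) (nodeKey k) l s') →
      StepOK hash u S L g' l' := by
    intro a s' h1 h2 h3 h4
    obtain ⟨g1, h5, h6⟩ := Option.map_eq_some_iff.1 h1
    simp only [Prod.mk.injEq] at h6
    obtain ⟨rfl, rfl, rfl⟩ := h6
    obtain ⟨S', rfl, -, hS', hQ, hc, -⟩ := lock_step hS (.inl ⟨_, h2⟩) h5
    refine StepOK.quiet hM hS' hQ (by rw [hl]; exact hex _) ((li_search_iff rfl).2 ⟨?_, h4 hQ, ?_⟩)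
    · refine (hH.cons hc).mono fun x => ?_
      have := h3 x
      change (searchHeld l s' ++ callerHeld c l).count x ≤ _
      simp only [List.count_cons, List.count_append] at this ⊢
      omega
    · exact hC.quiet hS hQ
  have unlock : ∀ {a} {l' : Local O K V m}, a ∈ searchHeld l s →
      (∀ {S'}, Held u S' (((searchHeld l s).erase a) ++ callerHeld c l) → CallerI hash S' c o k l →
        LI hash u S' l') →
      StepOK hash u S L (S.sh.unlock u a) l' := by
    intro a l' h1 h2
    obtain ⟨S', h5, -, hS', hQ, hc⟩ := unlock_step hS (hH.own (List.mem_append_left _ h1))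
    rw [← h5]
    refine StepOK.quiet hM hS' hQ (by rw [hl]; exact hex _) (h2 ?_ (hC.quiet hS hQ))
    refine Held.uncons (x := a) (hH.mono fun x => le_of_eq ?_) hc
    rw [← List.cons_append, List.count_append, List.count_append,
      (List.perm_cons_erase h1).count_eq]
  cases s <;> simp only [stepSearch] at hs
  case start =>
    simp only [Option.some.injEq, Prod.mk.injEq] at hs
    obtain ⟨rfl, rfl, rfl⟩ := hs
    refine go .readBl rfl hH ⟨hS.headPub _ _, ?_⟩ hC
    rw [hS.headKey]
    exact WithBot.bot_lt_coe _
  case readBl =>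
    split at hs <;> simp only [Option.some.injEq, Prod.mk.injEq, reduceCtorEq] at hs
    rename_i a ha
    obtain ⟨rfl, rfl, rfl⟩ := hs
    exact go .testBlKey rfl hH ⟨hI.1, hI.2, (hS.blPub _ _ _ hI.1 ha).1⟩ hC
  case testBlKey =>
    split at hs <;> rename_i hk <;> simp only [Option.some.injEq, Prod.mk.injEq] at hs <;>
      obtain ⟨rfl, rfl, rfl⟩ := hs
    · exact go .readBl rfl hH ⟨hI.2.2, hk⟩ hC
    · exact go .readRl rfl hH ⟨hI.1, hI.2.1, hI.2.2, not_lt.1 hk, hI.1⟩ hC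
  case readRl =>
    split at hs <;> simp only [Option.some.injEq, Prod.mk.injEq, reduceCtorEq] at hs
    rename_i a ha
    obtain ⟨rfl, rfl, rfl⟩ := hs
    obtain ⟨h1, h2, h3, h4, h5⟩ := hI
    exact go .testRlKey rfl hH ⟨h1, h5, hS.rlPub _ _ _ h5 ha, h3, h2, h4⟩ hC
  case testRlKey =>
    split at hs <;> simp only [Option.some.injEq, Prod.mk.injEq] at hs <;>
      obtain ⟨rfl, rfl, rfl⟩ := hs
    · exact go .readRl rfl hH ⟨hI.bpPub, hI.lt, hI.bcPub, hI.le, hI.rcPub⟩ hC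
    · exact go .lockBp rfl hH hI hC
  case lockBp =>
    exact lock hs hI.bpPub (fun x => le_rfl) fun hQ => Places.mono hI (hQ.agree hS ⊤ ⊤)
  case lockRp =>
    refine lock hs hI.rpPub (fun x => ?_) fun hQ => Places.mono hI (hQ.agree hS ⊤ ⊤)
    simp only [searchHeld, List.count_cons]; omega
  case lockRc =>
    refine lock hs hI.rcPub (fun x => ?_) fun hQ => Places.mono hI (hQ.agree hS ⊤ ⊤)
    simp only [searchHeld, List.count_cons]; omega
  case lockBc =>
    refine lock hs hI.bcPub (fun x => ?_) fun hQ => Places.mono hI (hQ.agree hS ⊤ ⊤)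
    simp only [searchHeld, List.count_cons]; omega
  case valBpMarked =>
    simp only [Option.some.injEq, Prod.mk.injEq] at hs
    obtain ⟨rfl, rfl, rfl⟩ := hs
    split
    · exact go (.unlockBp false) rfl hH trivial hC
    · rename_i hm
      refine go .valBcMarked rfl hH ⟨hI, ?_⟩ hC
      -- The traversal may have left the blue list through a deleted node; the mark, read under the
      -- lock, shows that `l.bp` is in the list now.
      exact (hmark _ _ hI.bpPub (hH.own (by simp [searchHeld]))).1 (by simpa [Mem.marked] using hm)
  case valBcMarked =>
    simp only [Option.some.injEq, Prod.mk.injEq] at hs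
    obtain ⟨rfl, rfl, rfl⟩ := hs
    split
    · exact go (.unlockBp false) rfl hH trivial hC
    · exact go .valBpBl rfl hH hI hC
  case valBpBl =>
    simp only [Option.some.injEq, Prod.mk.injEq] at hs
    obtain ⟨rfl, rfl, rfl⟩ := hs
    split
    · exact go (.unlockBp false) rfl hH trivial hC
    · rename_i hb
      exact go .valRpRl rfl hH ⟨⟨hI.2, not_not.1 hb, hI.1.lt, hI.1.le⟩,
        hI.1.rpPub, hI.1.rcPub⟩ hC
  case valRpRl =>
    simp only [Option.some.injEq, Prod.mk.injEq] at hs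
    obtain ⟨rfl, rfl, rfl⟩ := hs
    split
    · exact go (.unlockBp false) rfl hH trivial hC
    · exact go .aptCurr rfl hH hI hC
  case aptCurr =>
    split at hs
    · simp only [Option.some.injEq, Prod.mk.injEq] at hs
      obtain ⟨rfl, rfl, rfl⟩ := hs
      exact go .tsIns rfl hH hI hC
    · split at hs <;> simp only [Option.some.injEq, Prod.mk.injEq] at hs <;>
        obtain ⟨rfl, rfl, rfl⟩ := hs
      · exact go .tsIns rfl hH hI hC
      · exact silent (li_found (c := c) rfl hH hI hC)
  case tsIns =>
    simp only [Option.some.injEq, Prod.mk.injEq] at hs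
    obtain ⟨rfl, rfl, rfl⟩ := hs
    split
    · exact go (.unlockBp true) rfl hH trivial hC
    · exact go .tsDel rfl hH hI hC
  case tsDel =>
    split at hs
    · simp only [Option.some.injEq, Prod.mk.injEq] at hs
      obtain ⟨rfl, rfl, rfl⟩ := hs
      exact go (.unlockBp true) rfl hH trivial hC
    · cases c <;> simp only [Option.some.injEq, Prod.mk.injEq] at hs <;>
        obtain ⟨rfl, rfl, rfl⟩ := hs
      · exact silent (li_found (c := .rv _) rfl hH hI hC)
      · exact go .tsLook rfl hH hI hC
  case tsLook =>
    simp only [Option.some.injEq, Prod.mk.injEq] at hs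
    obtain ⟨rfl, rfl, rfl⟩ := hs
    split
    · exact go (.unlockBp true) rfl hH trivial hC
    · exact silent (li_found (c := c) rfl hH hI hC)
  case unlockBp ab =>
    simp only [Option.some.injEq, Prod.mk.injEq] at hs
    obtain ⟨rfl, rfl, rfl⟩ := hs
    refine unlock (by simp [searchHeld]) fun h1 h2 => (li_search_iff (s := .unlockRp ab) rfl).2
      ⟨?_, trivial, h2⟩
    simp only [searchHeld, List.erase_cons_head] at h1
    exact h1
  case unlockRp ab =>
    simp only [Option.some.injEq, Prod.mk.injEq] at hs
    obtain ⟨rfl, rfl, rfl⟩ := hs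
    refine unlock (by simp [searchHeld]) fun h1 h2 => (li_search_iff (s := .unlockRc ab) rfl).2
      ⟨?_, trivial, h2⟩
    simp only [searchHeld, List.erase_cons_head] at h1
    exact h1
  case unlockRc ab =>
    simp only [Option.some.injEq, Prod.mk.injEq] at hs
    obtain ⟨rfl, rfl, rfl⟩ := hs
    refine unlock (by simp [searchHeld]) fun h1 h2 => (li_search_iff (s := .unlockBc ab) rfl).2
      ⟨?_, trivial, h2⟩
    simp only [searchHeld, List.erase_cons_head] at h1
    exact h1
  case unlockBc ab =>
    simp only [Option.some.injEq, Prod.mk.injEq] at hs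
    obtain ⟨rfl, rfl, rfl⟩ := hs
    refine unlock (by simp [searchHeld]) fun h1 h2 => ?_
    simp only [searchHeld, List.erase_cons_head, List.nil_append] at h1
    split
    · cases c
      · exact ⟨Held.nil, trivial⟩
      · exact ⟨h1, trivial⟩
    · exact (li_search_iff (s := .start) rfl).2 ⟨h1, trivial, h2⟩

end Search

end Steps

/-! ### The shared-memory part of `lookup` and `delete`. -/

section Rv

variable {T O K V : Type*} [DecidableEq T] [DecidableEq O] [LinearOrder K] {m : ℕ}
variable {hash : O → K → Fin m} {u t : T} {S S' : Mem T O K V m} {L : T → Local O K V m}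
  {g' : Shared T O K V m} {l l' : Local O K V m} {ev : Option (Event T O K V)}

/-- Linking a private node into the red list of the bucket `B`. -/
structure Publish (u : T) (S S' : Mem T O K V m) (n : Addr O m) (B : O × Fin m) : Prop where
  wf : S'.WF
  st : ∀ a, S'.st a = if a = n then .pub B else S.st a
  key : S'.key = S.key
  val : S'.val = S.val
  marked : S'.marked = S.marked
  bl : S'.bl = S.bl
  cnt : S'.cnt = S.cnt
  guar : Guar u S S'
  agree : ∀ X Y, Agree X Y S S'

/-- The red link makes the node reachable for others, so this is where its ghost status changes;
from now on its own links must meet the conditions on published nodes. No blue link is written, so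
the blue lists stay as they are. -/
theorem publish_step (hS : S.WF) {B : O × Fin m} {p n : Addr O m} (hp : S.st p = .pub B)
    (hn : S.st n = .priv u) (hrl : ∀ b, S.rl n = some b → S.st b = .pub B)
    (hbl : ∀ b, S.bl n = some b → S.st b = .pub B ∧ S.key n < S.key b) :
    ∃ S' : Mem T O K V m, S'.sh = S.sh.modify p (fun x => { x with rl := some n }) ∧
      Publish u S S' n B := by
  let S' : Mem T O K V m :=
    ⟨S.sh.modify p (fun x => { x with rl := some n }), Function.update S.st n (.pub B)⟩
  have hst : ∀ a, S'.st a = if a = n then .pub B else S.st a := fun x => by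
    simp [S', Function.update_apply]
  have hkey : S'.key = S.key := funext (Mem.modify_proj (S := S) (a := p) Node.key rfl)
  have hval : S'.val = S.val := funext (Mem.modify_proj (S := S) (a := p) Node.val rfl)
  have hmarked : S'.marked = S.marked := funext (Mem.modify_proj (S := S) (a := p) Node.marked rfl)
  have hbl' : S'.bl = S.bl := funext (Mem.modify_proj (S := S) (a := p) Node.bl rfl)
  have hcnt : S'.cnt = S.cnt := funext fun t => funext (Mem.modify_proj (S := S) (a := p) (fun x => x.cnt t) rfl)
  have hblue : ∀ B a, S'.Blue B a ↔ S.Blue B a := fun B a => by simp only [Mem.Blue, hbl']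
  have hpub : ∀ a B', S.st a = .pub B' → S'.st a = .pub B' := fun a B' h => by
    rw [hst, if_neg (by rintro rfl; rw [hn] at h; simp at h), h]
  have hinv : ∀ a B', S'.st a = .pub B' → S.st a = .pub B' ∨ (a = n ∧ B' = B) := fun a B' h => by
    rw [hst] at h
    split_ifs at h with ha
    · exact .inr ⟨ha, by simpa using h.symm⟩
    · exact .inl h
  have hheap : ∀ x, x ≠ p → S'.sh.heap x = S.sh.heap x := fun x hx =>
    Mem.modify_heap_of_ne (S := S) hx
  refine ⟨S', rfl, ?_, hst, hkey, hval, hmarked, hbl', hcnt, ?_, ?_⟩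
  · exact
      { headPub := fun o b => hpub _ _ (hS.headPub o b)
        headKey := fun o b => by rw [hkey]; exact hS.headKey o b
        freeCell := fun i hi => by
          have : S.st (.cell i) = .free := hS.freeCell i hi
          rw [hst, if_neg (by rintro rfl; rw [this] at hn; simp at hn), this]
        blPub := fun a B' b ha hb => by
          rw [hbl'] at hb
          rw [hkey]
          rcases hinv a B' ha with h | ⟨rfl, rfl⟩
          · exact ⟨hpub _ _ (hS.blPub a B' b h hb).1, (hS.blPub a B' b h hb).2⟩
          · exact ⟨hpub _ _ (hbl b hb).1, (hbl b hb).2⟩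
        rlPub := fun a B' b ha hb => by
          rcases hinv a B' ha with h | ⟨rfl, rfl⟩
          · by_cases hap : a = p
            · subst hap
              rw [hp] at h
              have : S'.rl a = some n := by
                simp [Mem.rl, S', Shared.modify]
              rw [this] at hb
              rw [hst, if_pos (Option.some.inj hb).symm, h]
            · unfold Mem.rl at hb
              rw [hheap a hap] at hb
              exact hpub _ _ (hS.rlPub a B' b h hb)
          · have hap : a ≠ p := by rintro rfl; rw [hp] at hn; simp at hn
            unfold Mem.rl at hb
            rw [hheap a hap] at hb
            exact hpub _ _ (hrl b hb)
        cntSt := fun t a ha => by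
          rw [hcnt] at ha
          by_cases han : a = n
          · exact .inl ⟨B, by rw [hst, if_pos han]⟩
          · rw [hst, if_neg han]; exact hS.cntSt t a ha }
  · exact
      { pub := hpub
        key := fun a B _ => by rw [hkey]
        bl := fun a B _ _ => by rw [hbl']
        marked := fun a B _ _ => by rw [hmarked]
        val := fun a B _ _ => by rw [hval]
        blue := fun a B _ _ => hblue _ _
        cnt := fun t _ a => by rw [hcnt]
        priv := fun t ht a ha => by
          have h1 : a ≠ n := by rintro rfl; rw [hn] at ha; simp at ha; exact ht ha.symm
          have h2 : a ≠ p := by rintro rfl; rw [hp] at ha; simp at ha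
          rw [hst, if_neg h1, hheap a h2]
          exact ⟨ha, rfl⟩ }
  · exact fun X Y =>
      { pub := hpub
        key := fun a B _ => by rw [hkey]
        bl := fun a B _ _ => by rw [hbl']
        blue := fun a B _ => (hblue _ _).2
        val := fun a B _ _ => by rw [hval] }

theorem Publish.blue {n : Addr O m} {B : O × Fin m} (h : Publish u S S' n B) (B' : O × Fin m)
    (a : Addr O m) : S'.Blue B' a ↔ S.Blue B' a := by simp only [Mem.Blue, h.bl]

theorem Publish.content {n : Addr O m} {B B' : O × Fin m} {κ : WithBot (WithTop K)} {r : Option V}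
    (h : Publish u S S' n B) (hc : Content S B' κ r) : Content S' B' κ r := by
  simpa only [Content, h.blue, h.key, h.val] using hc

theorem li_rv_iff {d : Bool} {o : O} {k : K} {s : RvPC} (hpc : l.pc = .rvEff d o k s) :
    LI hash t S l ↔ Held t S (rvHeld l s) ∧ RvI t S (o, hash o k) (nodeKey k) l s := by
  constructor
  · rintro ⟨h1, h2⟩
    unfold held at h1
    unfold PcI at h2
    rw [hpc] at h1 h2
    exact ⟨h1, h2⟩
  · rintro ⟨h1, h2⟩
    refine ⟨?_, ?_⟩
    · unfold held; rw [hpc]; exact h1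
    · unfold PcI; rw [hpc]; exact h2

theorem Found.quiet {B : O × Fin m} {κ : WithBot (WithTop K)} {bp rp rc bc : Addr O m}
    (h : Found S B κ bp rp rc bc) (hS : S.WF) (hQ : Quiet u S S') : Found S' B κ bp rp rc bc :=
  h.mono hS (hQ.agree hS (fun _ => True) fun _ => True) trivial

/-- Every step but the red linking is quiet. That one publishes a node, but no step changes the blue
lists. -/
theorem step_rv {d : Bool} {o : O} {k : K} {s : RvPC} (hM : MemInv hash S L)
    (hpc : (L u).pc = .rvEff d o k s) (hs : stepRv u S.sh (L u) d o k s = some (g', l', ev)) :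
    StepOK hash u S L g' l' := by
  have hS := hM.wf
  obtain ⟨hH, hI⟩ := (li_rv_iff hpc).1 (hM.li u)
  have hex0 : exc (L u) = none := by simp [exc, hpc]
  have hex : ∀ (l' : Local O K V m) a, exc (L u) = some a → exc l' = some a := by
    intro l' a h
    simp [hex0] at h
  generalize hl : L u = l at *
  have quiet : ∀ (s' : RvPC) {S' : Mem T O K V m} {l' : Local O K V m}, S'.WF → Quiet u S S' →
      l'.pc = .rvEff d o k s' → Held u S' (rvHeld l' s') →
      RvI u S' (o, hash o k) (nodeKey k) l' s' → StepOK hash u S L S'.sh l' :=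
    fun s' S' l' h1 h2 h3 h4 h5 =>
      StepOK.quiet hM h1 h2 (by rw [hl]; exact hex _) ((li_rv_iff h3).2 ⟨h4, h5⟩)
  have go : ∀ (s' : RvPC) {l' : Local O K V m}, l'.pc = .rvEff d o k s' → Held u S (rvHeld l' s') →
      RvI u S (o, hash o k) (nodeKey k) l' s' → StepOK hash u S L S.sh l' :=
    fun s' l' => quiet s' hS Quiet.rfl'
  cases s <;> simp only [stepRv] at hs
  case dispatch =>
    split at hs <;> rename_i hk
    · simp only [Option.some.injEq, Prod.mk.injEq] at hs
      obtain ⟨rfl, rfl, rfl⟩ := hs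
      exact go .blueTs rfl hH ⟨hI, hk⟩
    · split at hs <;> simp only [Option.some.injEq, Prod.mk.injEq] at hs <;>
        obtain ⟨rfl, rfl, rfl⟩ := hs
      · exact go .redTs rfl hH ⟨hI, hk⟩
      · exact go .newNode rfl hH ⟨hI, hk⟩
  case blueTs =>
    simp only [Option.some.injEq, Prod.mk.injEq] at hs
    obtain ⟨rfl, rfl, rfl⟩ := hs
    obtain ⟨S', h1, h2, h3, h4, h5⟩ := aux_step (u := u) hS (.inl ⟨_, hI.1.bcPub hS⟩)
      (f := fun n => { n with tsLook := l.tx }) fun n => ⟨rfl, rfl, rfl, rfl, rfl, rfl⟩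
    rw [← h1]
    exact quiet .blueVal h3 h4 rfl (hH.congr h5)
      ⟨hI.1.quiet hS h4, (h4.key _ _ (hI.1.bcPub hS)).trans hI.2⟩
  case blueVal =>
    simp only [Option.some.injEq, Prod.mk.injEq] at hs
    obtain ⟨rfl, rfl, rfl⟩ := hs
    exact go .unlockBp rfl hH ⟨hI.1, .inl ⟨hI.2, rfl⟩⟩
  case redTs =>
    simp only [Option.some.injEq, Prod.mk.injEq] at hs
    obtain ⟨rfl, rfl, rfl⟩ := hs
    obtain ⟨S', h1, h2, h3, h4, h5⟩ := aux_step (u := u) hS (.inl ⟨_, hI.1.rcPub⟩)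
      (f := fun n => { n with tsLook := l.tx }) fun n => ⟨rfl, rfl, rfl, rfl, rfl, rfl⟩
    rw [← h1]
    exact quiet .unlockBp h3 h4 rfl (hH.congr h5)
      ⟨hI.1.quiet hS h4, .inr ⟨(h4.key _ _ (hI.1.bcPub hS)).trans_ne hI.2, rfl⟩⟩
  case newNode =>
    simp only [Option.some.injEq, Prod.mk.injEq] at hs
    obtain ⟨rfl, rfl, rfl⟩ := hs
    obtain ⟨S', h1, h3, h4, h5, h6, h7⟩ := alloc_step hS u k (none : Option V)
    rw [← h1]
    exact quiet .newMarked h3 h4 rfl (hH.congr h5)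
      ⟨hI.1.quiet hS h4, (h4.key _ _ (hI.1.bcPub hS)).trans_ne hI.2, h6, by
        simp only [h7]⟩
  case newMarked =>
    simp only [Option.some.injEq, Prod.mk.injEq] at hs
    obtain ⟨rfl, rfl, rfl⟩ := hs
    obtain ⟨h11, h12, h13, h14⟩ := hI
    obtain ⟨S', h1, h2, h3, h4, h5, h6⟩ := priv_step hS h13
      (f := fun n => { n with marked := true }) fun n => ⟨rfl, rfl⟩
    rw [← h1]
    exact quiet .newRl h3 h4 rfl (hH.congr h5)
      ⟨h11.quiet hS h4, (h4.key _ _ (h11.bcPub hS)).trans_ne h12, h2 ▸ h13, by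
        simp only [h6, h14, and_self]⟩
  case newRl =>
    simp only [Option.some.injEq, Prod.mk.injEq] at hs
    obtain ⟨rfl, rfl, rfl⟩ := hs
    obtain ⟨h11, h12, h13, h14, h15⟩ := hI
    obtain ⟨S', h1, h2, h3, h4, h5, h6⟩ := priv_step hS h13
      (f := fun n => { n with rl := some l.rc }) fun n => ⟨rfl, rfl⟩
    rw [← h1]
    exact quiet .linkRl h3 h4 rfl (hH.congr h5)
      ⟨h11.quiet hS h4, (h4.key _ _ (h11.bcPub hS)).trans_ne h12, h2 ▸ h13, by
        simp only [h6, h14, h15, and_self]⟩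
  case linkRl =>
    simp only [Option.some.injEq, Prod.mk.injEq] at hs
    obtain ⟨rfl, rfl, rfl⟩ := hs
    obtain ⟨h11, h12, h13, h14, h15, h16⟩ := hI
    obtain ⟨S', h1, hP⟩ := publish_step hS h11.rpPub h13
      (fun b hb => by
        unfold Mem.rl at hb
        rw [h16] at hb
        exact Option.some.inj hb ▸ h11.rcPub)
      (fun b hb => by
        unfold Mem.bl at hb
        rw [h14] at hb
        simp at hb)
    refine ⟨S', h1, hM.guar hP.wf hP.guar ?_ ?_, fun _ _ _ _ => hP.content⟩
    · refine (li_rv_iff (s := .newTs) rfl).2 ⟨hH.congr (fun a => by rw [hP.cnt]), ?_, ?_⟩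
      · exact h11.mono hS (hP.agree (fun _ => True) fun _ => True) trivial
      · exact ⟨by rw [hP.key]; exact h12, by rw [hP.st, if_pos rfl]⟩
    · intro a B ha he
      rw [hP.marked, hP.blue]
      rw [hP.st] at ha
      split_ifs at ha with han
      -- The new node is marked, and it is not blue because it was private just before, so mark and
      -- blue list agree on it.
      · have : S.marked a = true := by rw [han]; exact h15
        rw [this]
        simp only [Bool.true_eq_false, false_iff]
        intro hb
        have := hS.blue_pub hb
        rw [han, h13] at this
        simp at this
      · refine hM.mark a B ha fun t => ?_
        by_cases ht : t = u
        · rw [ht, hl, hex0]; simp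
        · have := he t
          rwa [Function.update_of_ne ht] at this
  case newTs =>
    simp only [Option.some.injEq, Prod.mk.injEq] at hs
    obtain ⟨rfl, rfl, rfl⟩ := hs
    obtain ⟨S', h1, h2, h3, h4, h5⟩ := aux_step (u := u) hS (.inl ⟨_, hI.2.2⟩)
      (f := fun n => { n with tsLook := l.tx }) fun n => ⟨rfl, rfl, rfl, rfl, rfl, rfl⟩
    rw [← h1]
    exact quiet .unlockBp h3 h4 rfl (hH.congr h5)
      ⟨hI.1.quiet hS h4, .inr ⟨(h4.key _ _ (hI.1.bcPub hS)).trans_ne hI.2.1, rfl⟩⟩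
  case unlockBp =>
    simp only [Option.some.injEq, Prod.mk.injEq] at hs
    obtain ⟨rfl, rfl, rfl⟩ := hs
    obtain ⟨S', h1, h2, h3, h4, h5⟩ := unlock_step hS (hH.own (a := l.bp) (by simp [rvHeld]))
    rw [← h1]
    exact quiet .unlockRp h3 h4 rfl (Held.uncons hH h5) trivial
  case unlockRp =>
    simp only [Option.some.injEq, Prod.mk.injEq] at hs
    obtain ⟨rfl, rfl, rfl⟩ := hs
    obtain ⟨S', h1, h2, h3, h4, h5⟩ := unlock_step hS (hH.own (a := l.rp) (by simp [rvHeld]))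
    rw [← h1]
    exact quiet .unlockRc h3 h4 rfl (Held.uncons hH h5) trivial
  case unlockRc =>
    simp only [Option.some.injEq, Prod.mk.injEq] at hs
    obtain ⟨rfl, rfl, rfl⟩ := hs
    obtain ⟨S', h1, h2, h3, h4, h5⟩ := unlock_step hS (hH.own (a := l.rc) (by simp [rvHeld]))
    rw [← h1]
    exact quiet .unlockBc h3 h4 rfl (Held.uncons hH h5) trivial
  case unlockBc =>
    simp only [Option.some.injEq, Prod.mk.injEq] at hs
    obtain ⟨rfl, rfl, rfl⟩ := hs
    obtain ⟨S', h1, h2, h3, h4, h5⟩ := unlock_step hS (hH.own (a := l.bc) (by simp [rvHeld]))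
    rw [← h1]
    exact quiet .log h3 h4 rfl (Held.uncons hH h5) trivial
  case log =>
    simp only [Option.some.injEq, Prod.mk.injEq] at hs
    obtain ⟨rfl, rfl, rfl⟩ := hs
    refine StepOK.silent hM (by rw [hl]; exact hex _) ⟨Held.nil, trivial⟩

end Rv

/-! ### Effect of one entry of a transaction on the windows of its other entries. -/

section Link

variable {T O K V : Type*} [DecidableEq T] [DecidableEq O] [LinearOrder K] {m : ℕ}
variable {hash : O → K → Fin m} {u t : T} {S S' : Mem T O K V m}
  {done rest : List (LogEntry O K V m)} {e c : LogEntry O K V m}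

theorem nodeKey_lt {k k' : K} : nodeKey k < nodeKey k' ↔ k < k' := by
  simp [nodeKey]

theorem nodeKey_le {k k' : K} : nodeKey k ≤ nodeKey k' ↔ k ≤ k' := by
  simp [nodeKey]

theorem nodeKey_inj {k k' : K} : nodeKey k = nodeKey k' ↔ k = k' := by
  simp [nodeKey]

/-- The order of the entries that `tryC` treats. -/
abbrev EntryOrd (a b : LogEntry O K V m) : Prop := a.obj = b.obj → a.key < b.key

theorem bucket_obj {e e' : LogEntry O K V m} (h : e.bucket hash = e'.bucket hash) :
    e.obj = e'.obj := congrArg Prod.fst h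

theorem TodoOK.extend (h : TodoOK hash S done e) (c : LogEntry O K V m) :
    TodoOK hash S (done ++ [c]) e := by
  obtain ⟨h1, p, h2, h3⟩ := h
  refine ⟨h1, p, h2, h3.imp id ?_⟩
  rintro ⟨e', h4, h5⟩
  exact ⟨e', List.mem_append_left _ h4, h5⟩

theorem Phase2.snoc (h : Phase2 hash S done rest) (hc : DoneOK hash S c) :
    Phase2 hash S (done ++ [c]) rest where
  doneOK e he := by
    rcases List.mem_append.1 he with h1 | h1
    · exact h.doneOK e h1
    · exact List.mem_singleton.1 h1 ▸ hc
  todoOK e he := (h.todoOK e he).extend c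

/-- Overwriting the value of a node whose key is that of the current entry. -/
theorem Phase2.overwrite (h : Phase2 hash S done rest) (hS : S.WF) {n : Addr O m}
    (hn : S.st n = .pub (c.bucket hash)) (hk : S.key n = nodeKey c.key)
    (hA : Agree (fun _ => True) (fun a => a ≠ n) S S')
    (hD : ∀ e ∈ done, EntryOrd e c) : Phase2 hash S' done rest := by
  refine h.mono hS hA (fun _ _ _ _ => trivial) (fun e he a _ h1 h2 => ?_) fun _ _ => trivial
  rintro rfl
  -- A treated entry of the same bucket has a strictly smaller key, hence its value is not the one
  -- being overwritten.
  rw [hk, nodeKey_inj] at h1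
  rw [hn] at h2
  have := hD e he (bucket_obj (by simpa using h2.symm))
  exact absurd h1.symm this.ne

/-- Only windows starting at `c.bp` are affected. A treated entry there must be a DELETE, and the
new successor `n` still lies beyond its key. A pending entry there has a larger key, so its
predecessor becomes `n`, which is among the slots of `c`. -/
theorem Phase2.insert (h : Phase2 hash S done rest) (hS : S.WF) {n bc : Addr O m}
    (hw : S.Win (c.bucket hash) (nodeKey c.key) c.bp bc) (hnc : S.bl n = some bc)
    (hn : S.st n = .pub (c.bucket hash)) (hkn : S.key n = nodeKey c.key)
    (hvn : S.val n = c.val) (hns : n ∈ c.slots) (hrp : S.st c.rp = .pub (c.bucket hash))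
    (hins : c.opn = .insert) (hD : ∀ e ∈ done, EntryOrd e c) (hR : ∀ e ∈ rest, EntryOrd c e)
    (hst : S'.st = S.st) (hkey : S'.key = S.key) (hval : S'.val = S.val)
    (hbl : S'.bl = Function.update S.bl c.bp (some n))
    (hblue : ∀ B a, S'.Blue B a ↔ S.Blue B a ∨ (B = c.bucket hash ∧ a = n)) :
    Phase2 hash S' (done ++ [c]) rest := by
  have hbn : S'.bl c.bp = some n := by simp [hbl]
  have hA : Agree (fun a => a ≠ c.bp) (fun _ => True) S S' :=
    { pub := fun a B ha => by rw [hst]; exact ha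
      key := fun a B _ => by rw [hkey]
      bl := fun a B ha _ => by rw [hbl, Function.update_of_ne ha]
      blue := fun a B _ ha => (hblue B a).2 (.inl ha)
      val := fun a B _ _ => by rw [hval] }
  have hbp := hS.blue_pub hw.blue
  have hnbp : n ≠ c.bp := by rintro rfl; exact absurd hw.lt (by rw [hkn]; exact lt_irrefl _)
  refine ⟨fun e he => ?_, fun e he => ?_⟩
  · rcases List.mem_append.1 he with he | he
    · have hE := h.doneOK e he
      by_cases hbe : e.bp = c.bp
      · have hB : e.bucket hash = c.bucket hash := by
          have := hS.blue_pub hE.blue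
          rw [hbe, hbp] at this
          simpa using this.symm
        have hlt := hD e he (bucket_obj hB)
        refine ⟨by rw [hst]; exact hE.rpPub, (hblue _ _).2 (.inl hE.blue), by rw [hkey]; exact hE.lt,
          fun hi => ?_, fun hd x hx => ?_⟩
        -- For an INSERT the successor of `c.bp` would carry the smaller key of `e`, but it is `bc`,
        -- whose key is at least that of `c`.
        · obtain ⟨x, -, h1, h2, -⟩ := hE.ins hi
          rw [hbe, hw.next] at h1
          obtain rfl := Option.some.inj h1
          exact absurd hw.le (not_le.2 (by rw [h2, nodeKey_lt]; exact hlt))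
        · rw [hbe, hbn] at hx
          obtain rfl := Option.some.inj hx
          rw [hkey, hkn, nodeKey_lt]
          exact hlt
      · exact hE.mono hS hA hbe fun _ _ _ _ => trivial
    · obtain rfl := List.mem_singleton.1 he
      refine ⟨by rw [hst]; exact hrp, (hblue _ _).2 (.inl hw.blue), by rw [hkey]; exact hw.lt,
        fun _ => ⟨n, hns, hbn, by rw [hkey]; exact hkn, by rw [hval]; exact hvn⟩,
        fun hd => absurd hins hd⟩
  · have hE := h.todoOK e he
    obtain ⟨p, hp, hor⟩ := hE.win
    refine ⟨hE.places.mono hA, ?_⟩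
    by_cases hpb : p = c.bp
    · subst hpb
      have hB : e.bucket hash = c.bucket hash := by
        have := hS.blue_pub hp.blue
        rw [hbp] at this
        simpa using this.symm
      have hlt := hR e he (bucket_obj hB.symm)
      have hec : e.bc = bc := Option.some.inj (hp.next.symm.trans hw.next)
      refine ⟨n, ⟨(hblue _ _).2 (.inr ⟨hB, rfl⟩), ?_, ?_, by rw [hkey]; exact hp.le⟩,
        .inr ⟨c, by simp, hB.symm, hns, by rw [hkey, hkn]⟩⟩
      · rw [hbl, Function.update_of_ne hnbp, hnc, hec]
      · rw [hkey, hkn, nodeKey_lt]; exact hlt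
    · refine ⟨p, hp.mono hS hA hpb, hor.imp id fun hb => ?_⟩
      obtain ⟨e', h1, h2, h3, h4⟩ := hb
      exact ⟨e', List.mem_append_left _ h1, h2, h3, by rw [hkey]; exact h4⟩

/-- A pending entry whose predecessor was `bc` falls back to `c.bp`, a slot of `c`. No pending entry
has `c.bp` as predecessor, since its successor would be `bc`, whose key is too small. For treated
entries at `c.bp` the successor only moves further away. -/
theorem Phase2.delete (h : Phase2 hash S done rest) (hS : S.WF) {bc : Addr O m}
    (hw : S.Win (c.bucket hash) (nodeKey c.key) c.bp bc) (hkc : S.key bc = nodeKey c.key)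
    (hrp : S.st c.rp = .pub (c.bucket hash))
    (hdel : c.opn ≠ .insert) (hD : ∀ e ∈ done, EntryOrd e c) (hR : ∀ e ∈ rest, EntryOrd c e)
    (hst : S'.st = S.st) (hkey : S'.key = S.key) (hval : S'.val = S.val)
    (hbl : S'.bl = Function.update S.bl c.bp (S.bl bc))
    (hblue : ∀ B a, S'.Blue B a ↔ S.Blue B a ∧ a ≠ bc) :
    Phase2 hash S' (done ++ [c]) rest := by
  have hbn : S'.bl c.bp = S.bl bc := by simp [hbl]
  have hA : Agree (fun a => a ≠ c.bp ∧ a ≠ bc) (fun _ => True) S S' :=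
    { pub := fun a B ha => by rw [hst]; exact ha
      key := fun a B _ => by rw [hkey]
      bl := fun a B ha _ => by rw [hbl, Function.update_of_ne ha.1]
      blue := fun a B h1 ha => (hblue B a).2 ⟨ha, h1.2⟩
      val := fun a B _ _ => by rw [hval] }
  have hbp := hS.blue_pub hw.blue
  have hbcp := hS.blue_pub hw.blue_next
  have hcb : c.bp ≠ bc := by
    intro hcb
    exact absurd hw.lt (by rw [hcb, hkc]; exact lt_irrefl _)
  have hsucc : ∀ x, S.bl bc = some x → nodeKey c.key < S.key x := fun x hx => by
    rw [← hkc]; exact (hS.blPub _ _ _ hbcp hx).2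
  refine ⟨fun e he => ?_, fun e he => ?_⟩
  · rcases List.mem_append.1 he with he | he
    · have hE := h.doneOK e he
      have hBe := hS.blue_pub hE.blue
      have hebc : e.bp ≠ bc := by
        intro hb
        rw [hb, hbcp] at hBe
        have hB : c.bucket hash = e.bucket hash := by simpa using hBe
        have hlt := hD e he (bucket_obj hB.symm)
        have := hE.lt
        rw [hb, hkc, nodeKey_lt] at this
        exact lt_asymm hlt this
      by_cases hbe : e.bp = c.bp
      · have hB : e.bucket hash = c.bucket hash := by
          rw [hbe, hbp] at hBe
          simpa using hBe.symm
        have hlt := hD e he (bucket_obj hB)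
        refine ⟨by rw [hst]; exact hE.rpPub, (hblue _ _).2 ⟨hE.blue, hebc⟩,
          by rw [hkey]; exact hE.lt, fun hi => ?_, fun hd x hx => ?_⟩
        · obtain ⟨x, -, h1, h2, -⟩ := hE.ins hi
          rw [hbe, hw.next] at h1
          obtain rfl := Option.some.inj h1
          rw [hkc, nodeKey_inj] at h2
          exact absurd h2.symm hlt.ne
        · rw [hbe, hbn] at hx
          rw [hkey]
          exact (nodeKey_lt.2 hlt).trans (hsucc x hx)
      · exact hE.mono hS hA ⟨hbe, hebc⟩ fun _ _ _ _ => trivial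
    · obtain rfl := List.mem_singleton.1 he
      refine ⟨by rw [hst]; exact hrp, (hblue _ _).2 ⟨hw.blue, hcb⟩, by rw [hkey]; exact hw.lt,
        fun hi => absurd hi hdel, fun _ x hx => ?_⟩
      rw [hbn] at hx
      rw [hkey]
      exact hsucc x hx
  · have hE := h.todoOK e he
    obtain ⟨p, hp, hor⟩ := hE.win
    have hpp := hS.blue_pub hp.blue
    refine ⟨hE.places.mono hA, ?_⟩
    by_cases hpc : p = bc
    · have hB : e.bucket hash = c.bucket hash := by
        rw [hpc, hbcp] at hpp
        simpa using hpp.symm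
      have hlt := hR e he (bucket_obj hB.symm)
      refine ⟨c.bp, ⟨(hblue _ _).2 ⟨hB ▸ hw.blue, hcb⟩, ?_, ?_, by rw [hkey]; exact hp.le⟩,
        .inr ⟨c, by simp, hB.symm, mem_slots_bp c, by rw [hkey]; exact hw.lt.le⟩⟩
      · rw [hbn, ← hpc]; exact hp.next
      · rw [hkey]; exact hw.lt.trans (nodeKey_lt.2 hlt)
    · have hpb : p ≠ c.bp := by
        intro hpb
        have hB : e.bucket hash = c.bucket hash := by
          rw [hpb, hbp] at hpp
          simpa using hpp.symm
        have hlt := hR e he (bucket_obj hB.symm)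
        have h1 : e.bc = bc := Option.some.inj (hp.next.symm.trans (hpb ▸ hw.next))
        have h2 := hp.le
        rw [h1, hkc, nodeKey_le] at h2
        exact not_le.2 hlt h2
      refine ⟨p, hp.mono hS hA ⟨hpb, hpc⟩, hor.imp id fun hb => ?_⟩
      obtain ⟨e', h1, h2, h3, h4⟩ := hb
      exact ⟨e', List.mem_append_left _ h1, h2, h3, by rw [hkey]; exact h4⟩

/-- The list is searched from its end, so the latest entry of the bucket is found, and by the order
of treatment it has the largest key. -/
theorem prevSameBucket_spec {e' : LogEntry O K V m} (h : prevSameBucket hash done e = some e')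
    (hord : done.Pairwise EntryOrd) :
    e' ∈ done ∧ e'.bucket hash = e.bucket hash ∧
      ∀ d ∈ done, d.bucket hash = e.bucket hash → d.key ≤ e'.key := by
  unfold prevSameBucket at h
  rw [List.find?_eq_some_iff_append] at h
  obtain ⟨h1, as, bs, h2, h3⟩ := h
  have hb : e'.bucket hash = e.bucket hash := by
    simp only [decide_eq_true_eq] at h1
    exact Prod.ext h1.1 h1.2
  have hd : done = bs.reverse ++ e' :: as.reverse := by
    rw [← List.reverse_reverse done, h2]
    simp
  refine ⟨by simp [hd], hb, fun d hdm hdb => ?_⟩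
  rw [hd] at hdm hord
  rcases List.mem_append.1 hdm with h4 | h4
  · exact ((List.pairwise_append.1 hord).2.2 d h4 e' (by simp)
      (bucket_obj (hdb.trans hb.symm))).le
  · rcases List.mem_cons.1 h4 with rfl | h5
    · exact le_rfl
    · have := h3 d (List.mem_reverse.1 h5)
      simp only [Bool.not_eq_true', decide_eq_false_iff_not] at this
      exact absurd ⟨congrArg Prod.fst hdb, congrArg Prod.snd hdb⟩ this

/-- `intraTransValidation` finds the blue predecessor of the current entry. -/
theorem Behind.eq_of_prev {p bc : Addr O m} {e' : LogEntry O K V m} (hS : S.WF)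
    (hw : S.Win (e.bucket hash) (nodeKey e.key) p bc) (hp : Behind hash S done e p)
    (hdone : ∀ e ∈ done, DoneOK hash S e) (h : prevSameBucket hash done e = some e')
    (hord : done.Pairwise EntryOrd) (hD : ∀ e' ∈ done, EntryOrd e' e) :
    (e'.opn = .insert → S.bl e'.bp = some p) ∧ (e'.opn ≠ .insert → p = e'.bp) := by
  obtain ⟨h1, h2, h3⟩ := prevSameBucket_spec h hord
  obtain ⟨d, hd, hdb, -, hle⟩ := hp
  have hlt : nodeKey e'.key < nodeKey e.key := nodeKey_lt.2 (hD e' h1 (bucket_obj h2))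
  have hpk : S.key p ≤ nodeKey e'.key := hle.trans (nodeKey_le.2 (h3 d hd hdb))
  have hE := hdone e' h1
  have hsp : ∀ x, S.bl p = some x → ¬ S.key x ≤ nodeKey e'.key := fun x hx =>
    not_le.2 (hlt.trans_le (hw.pred.le x hx))
  -- `p` is the last blue node with key at most `e'.key`: its own key is bounded by that of an
  -- earlier entry, and its successor has key at least `e.key`. After an INSERT this node is the
  -- successor of `e'.bp`, after a DELETE it is `e'.bp` itself.
  have huniq : ∀ a, S.Blue (e.bucket hash) a → S.key a ≤ nodeKey e'.key →
      (∀ x, S.bl a = some x → ¬ S.key x ≤ nodeKey e'.key) → p = a := fun a ha hk hs =>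
    hS.last_unique (P := fun x => x ≤ nodeKey e'.key) (fun _ _ hx hy => hy.trans hx) hw.blue ha
      hpk hk hsp hs
  refine ⟨fun hi => ?_, fun hd => ?_⟩
  · obtain ⟨n, -, h4, h5, -⟩ := hE.ins hi
    have hnb : S.Blue (e.bucket hash) n := h2 ▸ (show S.Blue _ n from hE.blue.tail h4)
    rw [h4, huniq n hnb h5.le fun x hx => not_le.2 ?_]
    rw [← h5]
    exact (hS.blPub _ _ _ (hS.blue_pub hnb) hx).2
  · exact huniq e'.bp (h2 ▸ hE.blue) hE.lt.le fun x hx => not_le.2 (hE.del hd x hx)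

end Link

/-! ### The second loop of `tryC`. -/

section Upd

variable {T O K V : Type*} [DecidableEq T] [DecidableEq O] [LinearOrder K] {m : ℕ}
variable {hash : O → K → Fin m} {u t : T} {S S' : Mem T O K V m} {L : T → Local O K V m}
  {g' : Shared T O K V m} {l l' : Local O K V m} {ev : Option (Event T O K V)}
  {e : LogEntry O K V m} {rest : List (LogEntry O K V m)}

/-- A write to a locked published node. The fields of nodes not locked by `u` are trivially
untouched; only membership in the blue lists can change at a distance, so this is left as a premise
of the guarantee. -/
theorem core_step (hS : S.WF) {a : Addr O m} {B : O × Fin m}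
    {f : Node T O K V m → Node T O K V m} (ha : S.st a = .pub B) (hown : 0 < S.cnt u a)
    (hf : ∀ n, (f n).key = n.key ∧ (f n).lock = n.lock ∧ (f n).rl = n.rl)
    (hbl : ∀ b, (f (S.sh.heap a)).bl = some b → S.st b = .pub B ∧ S.key a < S.key b) :
    (S.modify a f).WF ∧ (S.modify a f).key = S.key ∧ (S.modify a f).cnt = S.cnt ∧
      (S.modify a f).bl = Function.update S.bl a (f (S.sh.heap a)).bl ∧
      (S.modify a f).marked = Function.update S.marked a (f (S.sh.heap a)).marked ∧
      (S.modify a f).val = Function.update S.val a (f (S.sh.heap a)).val ∧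
      ((∀ B x, S.st x = .pub B → S.cnt u x = 0 → ((S.modify a f).Blue B x ↔ S.Blue B x)) →
        Guar u S (S.modify a f)) := by
  have hcnt : ∀ t, (f (S.sh.heap a)).cnt t = (S.sh.heap a).cnt t := fun t => by
    simp only [Node.cnt, (hf _).2.1]
  have hkey : (S.modify a f).key = S.key := funext (Mem.modify_proj Node.key (hf _).1)
  have hcnt' : (S.modify a f).cnt = S.cnt :=
    funext fun t => funext (Mem.modify_proj (fun n => n.cnt t) (hcnt t))
  refine ⟨?_, hkey, hcnt', ?_, ?_, ?_, fun hblue => ?_⟩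
  · refine hS.modify (hf _).1 (fun B' b hB hb => ?_) (fun B' b hB hb => hS.rlPub a B' b hB ?_)
      fun t ht => .inl ?_
    · rw [ha] at hB
      rw [← hB]
      exact hbl b hb
    · rw [(hf _).2.2] at hb; exact hb
    · rw [hcnt] at ht; exact ht
  · funext x
    rw [Function.update_apply]
    unfold Mem.bl
    rw [Mem.modify_heap]
    split_ifs <;> rfl
  · funext x
    rw [Function.update_apply]
    unfold Mem.marked
    rw [Mem.modify_heap]
    split_ifs <;> rfl
  · funext x
    rw [Function.update_apply]
    unfold Mem.val
    rw [Mem.modify_heap]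
    split_ifs <;> rfl
  · have hne : ∀ x, S.cnt u x = 0 → x ≠ a := by
      rintro x hx rfl
      omega
    exact
      { pub := fun _ _ h => h
        key := fun x B _ => by rw [hkey]
        bl := fun x B _ hx => by simp only [Mem.bl, Mem.modify_heap_of_ne (hne x hx)]
        marked := fun x B _ hx => by simp only [Mem.marked, Mem.modify_heap_of_ne (hne x hx)]
        val := fun x B _ hx => by simp only [Mem.val, Mem.modify_heap_of_ne (hne x hx)]
        blue := fun x B => hblue B x
        cnt := fun t _ x => by rw [hcnt']
        priv := fun t _ x hx => by
          refine ⟨hx, Mem.modify_heap_of_ne ?_⟩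
          rintro rfl
          rw [ha] at hx
          simp at hx }

theorem Content.congr {B : O × Fin m} {κ : WithBot (WithTop K)} {r : Option V}
    (h : Content S B κ r) (hkey : S'.key = S.key)
    (hb : ∀ a, S.key a = κ → (S'.Blue B a ↔ S.Blue B a))
    (hv : ∀ a, S.Blue B a → S.key a = κ → S'.val a = S.val a) : Content S' B κ r := by
  refine ⟨fun a ha hk => ?_, fun hr => ?_⟩
  · rw [hkey] at hk
    rw [hb a hk] at ha
    rw [hv a ha hk]
    exact h.1 a ha hk
  · obtain ⟨a, ha, hk⟩ := h.2 hr
    exact ⟨a, (hb a hk).2 ha, by rw [hkey]; exact hk⟩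

theorem li_upd_iff {s : UpdPC} (hpc : l.pc = .upd s) (htd : l.todo = e :: rest) :
    LI hash t S l ↔ Held t S (updHeld l e s ++
      (l.done.flatMap LogEntry.slots ++ rest.flatMap LogEntry.slots)) ∧
      UpdI hash t S l e rest s := by
  constructor
  · rintro ⟨h1, h2⟩
    unfold held at h1
    unfold PcI at h2
    rw [hpc] at h1 h2
    simp only [htd] at h1 h2
    obtain ⟨e', rest', h3, h4⟩ := h2
    obtain ⟨rfl, rfl⟩ := List.cons.inj h3
    exact ⟨h1, h4⟩
  · rintro ⟨h1, h2⟩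
    refine ⟨?_, ?_⟩
    · unfold held; rw [hpc]; simp only [htd]; exact h1
    · unfold PcI; rw [hpc]; exact ⟨e, rest, htd, h2⟩

theorem Behind.quiet {done : List (LogEntry O K V m)} {p : Addr O m} {B : O × Fin m}
    (h : Behind hash S done e p) (hS : S.WF) (hQ : Quiet u S S') (hp : S.st p = .pub B) :
    Behind hash S' done e p := h.mono (hQ.agree hS (fun _ => True) fun _ => True) hp

theorem Phase2.quiet {done todo : List (LogEntry O K V m)} (h : Phase2 hash S done todo)
    (hS : S.WF) (hQ : Quiet u S S') : Phase2 hash S' done todo :=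
  h.mono hS (hQ.agree hS (fun _ => True) fun _ => True) (fun _ _ _ _ => trivial)
    (fun _ _ _ _ _ _ => trivial) fun _ _ => trivial

/-- All predecessors in play are blue, so links of nodes outside the blue lists may change freely.
This serves the preparation of a red node before it is linked. -/
theorem Phase2.mono_blue {done todo : List (LogEntry O K V m)} {X : Addr O m → Prop}
    (h : Phase2 hash S done todo) (hS : S.WF) (hA : Agree X (fun _ => True) S S')
    (hX : ∀ a B, S.Blue B a → X a) : Phase2 hash S' done todo where
  doneOK e he := (h.doneOK e he).mono hS hA (hX _ _ (h.doneOK e he).blue) fun _ _ _ _ => trivial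
  todoOK e he := by
    obtain ⟨h1, p, h2, h3⟩ := h.todoOK e he
    exact ⟨h1.mono hA, p, h2.mono hS hA (hX _ _ h2.blue),
      h3.imp id fun hb => hb.mono hA (hS.blue_pub h2.blue)⟩

/-- A node of the red list with the key that is sought but not found in the blue list. -/
theorem Found.not_blue {B : O × Fin m} {κ : WithBot (WithTop K)} {bp rp rc bc n : Addr O m}
    (h : Found S B κ bp rp rc bc) (hS : S.WF) (hk : S.key bc ≠ κ) (hn : S.st n = .pub B)
    (hnk : S.key n = κ) (B' : O × Fin m) : ¬ S.Blue B' n := by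
  intro hb
  obtain rfl := hS.bucket_unique hb hn
  exact hk (h.win.eq_next_of_key hS hb hnk ▸ hnk)

/-- Each update takes effect in the blue list by a single write: `ovVal`, `reLink`, `linkBl` or
`delLink`. The earlier writes concern a node outside the blue list, or just a mark. The write
affects the key of the entry alone, and this key is dirty. -/
theorem step_upd {s : UpdPC} (hM : MemInv hash S L) (hpc : (L u).pc = .upd s)
    (htd : (L u).todo = e :: rest) (hord : ((L u).done ++ e :: rest).Pairwise EntryOrd)
    (hlk : e.opn ≠ .lookup)
    (hs : stepUpd hash u S.sh (L u) e rest s = some (g', l', ev)) :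
    StepOK hash u S L g' l' := by
  have hS := hM.wf
  obtain ⟨hH, hU⟩ := (li_upd_iff hpc htd).1 (hM.li u)
  have hdirty : ∀ o k, ¬ Dirty (L u) o k → ¬ (e.obj = o ∧ e.key = k) := by
    rintro o k h ⟨h1, h2⟩
    apply h
    unfold Dirty
    rw [hpc]
    exact ⟨e, by simp [htd], h1, h2⟩
  have hother : ∀ {o k}, ¬ Dirty (L u) o k → (o, hash o k) = e.bucket hash →
      nodeKey k ≠ nodeKey e.key := by
    intro o k h h1 h2
    exact hdirty o k h ⟨(congrArg Prod.fst h1).symm, (nodeKey_inj.1 h2).symm⟩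
  have hmark := fun a B h1 h2 h3 => hM.mark_own (u := u) (a := a) (B := B) h1 h2 h3
  have hD : ∀ e' ∈ (L u).done, EntryOrd e' e := fun e' he' =>
    (List.pairwise_append.1 hord).2.2 e' he' e (by simp)
  have hR : ∀ e' ∈ rest, EntryOrd e e' := fun e' he' =>
    List.rel_of_pairwise_cons (List.pairwise_append.1 hord).2.1 he'
  have hDo : (L u).done.Pairwise EntryOrd := (List.pairwise_append.1 hord).1
  -- For the steps that end a disagreement between mark and blue list; `hmark''` covers those that
  -- begin one or leave it alone.
  have hmark' : ∀ {S' : Mem T O K V m} (n : Addr O m), exc (L u) = some n → exc l' = none →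
      S'.st = S.st → (∀ B, S.st n = .pub B → (S'.marked n = false ↔ S'.Blue B n)) →
      (∀ a ≠ n, S'.marked a = S.marked a) → (∀ a ≠ n, ∀ B, S'.Blue B a ↔ S.Blue B a) →
      ∀ a B, S'.st a = .pub B → (∀ t, exc (Function.update L u l' t) ≠ some a) →
        (S'.marked a = false ↔ S'.Blue B a) := by
    intro S' n h1 h2 h3 h4 h5 h6 a B ha he
    rw [h3] at ha
    by_cases han : a = n
    · exact han ▸ h4 B (han ▸ ha)
    · rw [h5 a han, h6 a han]
      refine hM.mark a B ha fun t => ?_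
      by_cases ht : t = u
      · rw [ht, h1]
        exact fun h => han (Option.some.inj h).symm
      · have := he t
        rwa [Function.update_of_ne ht] at this
  have hmark'' : ∀ {S' : Mem T O K V m} {l' : Local O K V m},
      (∀ a B, S'.st a = .pub B → exc l' ≠ some a → S.st a = .pub B ∧ S'.marked a = S.marked a ∧
        (∀ B, S'.Blue B a ↔ S.Blue B a) ∧ exc (L u) ≠ some a) →
      ∀ a B, S'.st a = .pub B → (∀ t, exc (Function.update L u l' t) ≠ some a) →
        (S'.marked a = false ↔ S'.Blue B a) := by
    intro S' l' h a B ha he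
    obtain ⟨h1, h2, h3, h4⟩ := h a B ha (by simpa using he u)
    rw [h2, h3]
    refine hM.mark a B h1 fun t => ?_
    by_cases ht : t = u
    · rw [ht]; exact h4
    · have := he t
      rwa [Function.update_of_ne ht] at this
  generalize hl : L u = l at *
  have quiet : ∀ (s' : UpdPC) {e' : LogEntry O K V m} {S' : Mem T O K V m} {l' : Local O K V m},
      S'.WF → Quiet u S S' → l'.pc = .upd s' → l'.todo = e' :: rest →
      (∀ a, exc l = some a → exc l' = some a) →
      Held u S' (updHeld l' e' s' ++
        (l'.done.flatMap LogEntry.slots ++ rest.flatMap LogEntry.slots)) →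
      UpdI hash u S' l' e' rest s' → StepOK hash u S L S'.sh l' :=
    fun s' e' S' l' h1 h2 h3 h4 h5 h6 h7 =>
      StepOK.quiet hM h1 h2 (by rw [hl]; exact h5) ((li_upd_iff h3 h4).2 ⟨h6, h7⟩)
  have hown : ∀ a ∈ updHeld l e s, 0 < S.cnt u a := fun a ha =>
    hH.own (List.mem_append_left _ ha)
  obtain ⟨heq, hph, hI⟩ := hU
  cases s <;> simp only [stepUpd, Option.bind_eq_some_iff, Option.some.injEq, Prod.mk.injEq] at hs
  case load =>
    obtain ⟨rfl, rfl, rfl⟩ := hs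
    refine quiet .testBpMarked hS Quiet.rfl' rfl htd (by simp [exc, hpc]) hH
      ⟨fun _ => ⟨rfl, rfl⟩, hph, hI.places, hI.win⟩
  case testBpMarked =>
    obtain ⟨rfl, rfl, rfl⟩ := hs
    obtain ⟨hP, p, hw, hp⟩ := hI
    have hb := hmark _ _ hP.bpPub (hown l.bp (by simp [updHeld])) (by simp [exc, hpc])
    split <;> rename_i hm
    -- If the recorded predecessor were still the right one it would be blue, hence unmarked; so the
    -- right one stems from an earlier entry.
    · refine quiet .unlockBp hS Quiet.rfl' rfl htd (by simp [exc, hpc]) hH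
        ⟨fun _ => heq (by simp), hph, hP.rpPub, hP.rcPub, p, hw, hp.resolve_left ?_⟩
      rintro rfl
      have := hb.2 hw.blue
      unfold Mem.marked at this
      rw [hm] at this
      simp at this
    · exact quiet .testBpBl hS Quiet.rfl' rfl htd (by simp [exc, hpc]) hH
        ⟨fun _ => heq (by simp), hph, hP, hb.1 (by simpa [Mem.marked] using hm), p, hw, hp⟩
  case testBpBl =>
    obtain ⟨rfl, rfl, rfl⟩ := hs
    obtain ⟨hP, hb, p, hw, hp⟩ := hI
    split <;> rename_i hm
    · refine quiet .unlockBp hS Quiet.rfl' rfl htd (by simp [exc, hpc]) hH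
        ⟨fun _ => heq (by simp), hph, hP.rpPub, hP.rcPub, p, hw, hp.resolve_left ?_⟩
      rintro rfl
      exact hm hw.next
    · exact quiet .testRpRl hS Quiet.rfl' rfl htd (by simp [exc, hpc]) hH
        ⟨fun _ => heq (by simp), hph, ⟨hb, not_not.1 hm, hP.lt, hP.le⟩, hP.rpPub, hP.rcPub⟩
  case unlockBp =>
    obtain ⟨rfl, rfl, rfl⟩ := hs
    obtain ⟨S', h1, h2, h3, h4, h5⟩ := unlock_step hS (hown l.bp (by simp [updHeld]))
    obtain ⟨h6, h7, p, hw, hb⟩ := hI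
    rw [← h1]
    refine quiet .newBp h3 h4 rfl htd (by simp [exc, hpc]) (Held.uncons hH h5)
      ⟨fun _ => heq (by simp), hph.quiet hS h4, h2 ▸ h6, h2 ▸ h7, p, ?_,
        hb.quiet hS h4 (hS.blue_pub hw.blue)⟩
    exact hw.mono hS (h4.agree hS (fun _ => True) fun _ => True) trivial
  case newBp =>
    obtain ⟨h6, h7, p, hw, hb⟩ := hI
    split at hs
    · simp at hs
    rename_i e' he'
    -- Whichever replacement the algorithm chooses, it is the actual predecessor `p`.
    obtain ⟨h8, h9⟩ := hb.eq_of_prev hS hw hph.doneOK he' hDo hD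
    have key : ∀ {l'}, l' = { l with bp := p, pc := .upd .lockBp } → StepOK hash u S L S.sh l' := by
      rintro l' rfl
      exact quiet .lockBp hS Quiet.rfl' rfl htd (by simp [exc, hpc]) hH
        ⟨fun _ => heq (by simp), hph, ⟨hw, h6, h7⟩, hb⟩
    split at hs
    · rename_i hi
      have h10 := h8 hi
      unfold Mem.bl at h10
      rw [h10] at hs
      simp only [Option.some.injEq, Prod.mk.injEq] at hs
      obtain ⟨rfl, rfl, rfl⟩ := hs
      exact key rfl
    · rename_i hi
      simp only [Option.some.injEq, Prod.mk.injEq] at hs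
      obtain ⟨rfl, rfl, rfl⟩ := hs
      exact key (by rw [h9 hi])
  case lockBp =>
    obtain ⟨g1, h0, rfl, rfl, rfl⟩ := hs
    obtain ⟨hF, hb⟩ := hI
    obtain ⟨S', h1, h2, h3, h4, h5, -⟩ := lock_step hS (.inl ⟨_, hF.bpPub hS⟩) h0
    rw [← h1]
    exact quiet .testRpRl h3 h4 rfl htd (by simp [exc, hpc]) (hH.cons h5)
      ⟨fun _ => heq (by simp), hph.quiet hS h4, hF.quiet hS h4⟩
  case testRpRl =>
    obtain ⟨rfl, rfl, rfl⟩ := hs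
    split
    · exact quiet .unlockRp hS Quiet.rfl' rfl htd (by simp [exc, hpc]) hH
        ⟨fun _ => heq (by simp), hph, hI⟩
    · exact quiet .dispatch hS Quiet.rfl' rfl htd (by simp [exc, hpc]) hH
        ⟨fun _ => heq (by simp), hph, hI⟩
  case unlockRp =>
    obtain ⟨rfl, rfl, rfl⟩ := hs
    obtain ⟨S', h1, h2, h3, h4, h5⟩ := unlock_step hS (hown l.rp (by simp [updHeld]))
    rw [← h1]
    refine quiet .newRp h3 h4 rfl htd (by simp [exc, hpc])
      (Held.uncons (hH.mono fun x => ?_) h5) ⟨fun _ => heq (by simp), hph.quiet hS h4, hI.quiet hS h4⟩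
    simp only [updHeld, List.count_cons, List.count_append, List.cons_append]
    omega
  case newRp =>
    split at hs
    · simp at hs
    rename_i e' he'
    split at hs
    · simp at hs
    rename_i a ha
    simp only [Option.some.injEq, Prod.mk.injEq] at hs
    obtain ⟨rfl, rfl, rfl⟩ := hs
    obtain ⟨h8, h9, -⟩ := prevSameBucket_spec he' hDo
    -- Of the new red predecessor it is enough to know the bucket; its position in the red list does
    -- not matter.
    have h10 := hS.rlPub _ _ _ (hph.doneOK e' h8).rpPub ha
    exact quiet .lockRp hS Quiet.rfl' rfl htd (by simp [exc, hpc]) hH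
      ⟨fun _ => heq (by simp), hph, hI.win, h9 ▸ h10, hI.rcPub⟩
  case lockRp =>
    obtain ⟨g1, h0, rfl, rfl, rfl⟩ := hs
    obtain ⟨S', h1, h2, h3, h4, h5, -⟩ := lock_step hS (.inl ⟨_, hI.rpPub⟩) h0
    rw [← h1]
    refine quiet .dispatch h3 h4 rfl htd (by simp [exc, hpc]) ((hH.cons h5).mono fun x => ?_)
      ⟨fun _ => heq (by simp), hph.quiet hS h4, hI.quiet hS h4⟩
    simp only [updHeld, List.count_cons, List.count_append, List.cons_append]
    omega
  case dispatch =>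
    split at hs
    · rename_i ho
      split at hs
      · rename_i hk
        simp only [Option.some.injEq, Prod.mk.injEq] at hs
        obtain ⟨rfl, rfl, rfl⟩ := hs
        exact quiet .ovVal hS Quiet.rfl' rfl htd (by simp [exc, hpc]) hH
          ⟨fun _ => heq (by simp), hph, hI, ho, hk⟩
      · rename_i hk
        split at hs
        · rename_i hk'
          simp only [Option.some.injEq, Prod.mk.injEq] at hs
          obtain ⟨rfl, rfl, rfl⟩ := hs
          exact quiet .reVal hS Quiet.rfl' rfl htd (by simp [exc, hpc]) hH
            ⟨fun _ => heq (by simp), hph, hI, ho, hk, hk'⟩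
        · simp only [Option.some.injEq, Prod.mk.injEq] at hs
          obtain ⟨rfl, rfl, rfl⟩ := hs
          exact quiet .newNode hS Quiet.rfl' rfl htd (by simp [exc, hpc]) hH
            ⟨fun _ => heq (by simp), hph, hI, ho, hk⟩
    · rename_i ho
      split at hs
      · rename_i hk
        simp only [Option.some.injEq, Prod.mk.injEq] at hs
        obtain ⟨rfl, rfl, rfl⟩ := hs
        exact quiet .delMarked hS Quiet.rfl' rfl htd (by simp [exc, hpc]) hH
          ⟨fun _ => heq (by simp), hph, hI, by simp [ho], hk⟩
      · rename_i hk
        simp only [Option.some.injEq, Prod.mk.injEq] at hs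
        obtain ⟨rfl, rfl, rfl⟩ := hs
        -- Deleting an absent key needs no write: the successor of `l.bp` already has a key strictly
        -- beyond it.
        refine quiet .finish hS Quiet.rfl' rfl htd (by simp [exc, hpc]) hH
          ⟨fun _ => heq (by simp), hph.snoc ⟨hI.rpPub, hI.win.blue, hI.win.lt,
            fun hi => absurd (hi.symm.trans ho) (by simp), fun _ x hx => ?_⟩, trivial⟩
        obtain rfl := Option.some.inj (hI.win.next.symm.trans hx)
        exact lt_of_le_of_ne hI.win.le (Ne.symm hk)
    · exact absurd ‹_› hlk
  case ovTs =>
    obtain ⟨rfl, rfl, rfl⟩ := hs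
    have h0 := hown l.bc (by simp [updHeld])
    obtain ⟨S', h1, h2, h3, h4, h5⟩ := aux_step (u := u) hS (hS.cntSt u _ h0)
      (f := fun n => { n with tsIns := l.tx }) fun n => ⟨rfl, rfl, rfl, rfl, rfl, rfl⟩
    rw [← h1]
    exact quiet .finish h3 h4 rfl htd (by simp [exc, hpc]) (hH.congr h5)
      ⟨fun _ => heq (by simp), hph.quiet hS h4, trivial⟩
  case reTs =>
    obtain ⟨rfl, rfl, rfl⟩ := hs
    have h0 := hown l.rc (by simp [updHeld])
    obtain ⟨S', h1, h2, h3, h4, h5⟩ := aux_step (u := u) hS (hS.cntSt u _ h0)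
      (f := fun n => { n with tsIns := l.tx }) fun n => ⟨rfl, rfl, rfl, rfl, rfl, rfl⟩
    rw [← h1]
    exact quiet .finish h3 h4 rfl htd (by simp [exc, hpc]) (hH.congr h5)
      ⟨fun _ => heq (by simp), hph.quiet hS h4, trivial⟩
  case delTs =>
    obtain ⟨rfl, rfl, rfl⟩ := hs
    have h0 := hown l.bc (by simp [updHeld])
    obtain ⟨S', h1, h2, h3, h4, h5⟩ := aux_step (u := u) hS (hS.cntSt u _ h0)
      (f := fun n => { n with tsDel := l.tx }) fun n => ⟨rfl, rfl, rfl, rfl, rfl, rfl⟩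
    rw [← h1]
    exact quiet .finish h3 h4 rfl htd (by simp [exc, hpc]) (hH.congr h5)
      ⟨fun _ => heq (by simp), hph.quiet hS h4, trivial⟩
  case newTs =>
    obtain ⟨rfl, rfl, rfl⟩ := hs
    have h0 := hown l.node (by simp [updHeld])
    obtain ⟨S', h1, h2, h3, h4, h5⟩ := aux_step (u := u) hS (hS.cntSt u _ h0)
      (f := fun n => { n with tsIns := l.tx }) fun n => ⟨rfl, rfl, rfl, rfl, rfl, rfl⟩
    rw [← h1]
    have hbp := hS.blue_pub (hph.doneOK (curEntry l e .newTs) (by simp [UpdPC.isPost])).blue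
    exact quiet .newField h3 h4 rfl htd (by simp [exc, hpc]) (hH.congr h5)
      ⟨fun _ => heq (by simp), hph.quiet hS h4, (h4.bl _ _ hbp).trans hI⟩
  case newField =>
    obtain ⟨rfl, rfl, rfl⟩ := hs
    -- The link of `l.bp` still points to the new node, so the field records the node whose lock has
    -- to be released.
    unfold PreI Mem.bl at hI
    refine quiet .finish (e' := { e with node := (S.sh.heap l.bp).bl }) hS Quiet.rfl' rfl rfl
      (by simp [exc, hpc]) ?_ ⟨fun _ => heq (by simp), ?_, trivial⟩
    · simpa only [updHeld, hI, Option.toList_some, List.cons_append, List.nil_append] using hH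
    · simpa only [UpdPC.isPost, curEntry, hI, if_true] using hph
  case finish =>
    obtain ⟨rfl, rfl, rfl⟩ := hs
    obtain ⟨h1, h2⟩ := heq (by simp)
    refine StepOK.silent hM (by simp [hl, exc, hpc]) ⟨?_, hph⟩
    refine hH.mono fun x => le_of_eq ?_
    simp only [HTOSTM.held, updHeld, List.flatMap_append, List.count_append, List.flatMap_cons,
      List.flatMap_nil, LogEntry.slots, List.append_nil, h1, h2]
    omega
  case newLock =>
    obtain ⟨g1, h0, rfl, rfl, rfl⟩ := hs
    obtain ⟨hF, h11, h12, h13, h14⟩ := hI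
    obtain ⟨S', h1, h2, h3, h4, h5, h6⟩ := lock_step hS (.inr h13) h0
    obtain ⟨v, hv⟩ := h6 l.node
    rw [← h1]
    refine quiet .newRl h3 h4 rfl htd (by simp [exc, hpc]) ((hH.cons h5).mono fun x => ?_)
      ⟨fun _ => heq (by simp), hph.quiet hS h4, hF.quiet hS h4, h11,
        (h4.key _ _ (hF.bcPub hS)).trans_ne h12, h2 ▸ h13, by simpa only [hv] using h14⟩
    simp only [updHeld, List.count_cons, List.count_append, List.cons_append, List.count_nil]
    omega
  case newRl =>
    obtain ⟨rfl, rfl, rfl⟩ := hs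
    obtain ⟨hF, h11, h12, h13, h14⟩ := hI
    obtain ⟨S', h1, h2, h3, h4, h5, h6⟩ := priv_step hS h13
      (f := fun n => { n with rl := some l.rc }) fun n => ⟨rfl, rfl⟩
    rw [← h1]
    exact quiet .newBl h3 h4 rfl htd (by simp [exc, hpc]) (hH.congr h5)
      ⟨fun _ => heq (by simp), hph.quiet hS h4, hF.quiet hS h4, h11,
        (h4.key _ _ (hF.bcPub hS)).trans_ne h12, h2 ▸ h13, by
          simp only [h6, h14, and_self]⟩
  case newBl =>
    obtain ⟨rfl, rfl, rfl⟩ := hs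
    obtain ⟨hF, h11, h12, h13, h14⟩ := hI
    obtain ⟨S', h1, h2, h3, h4, h5, h6⟩ := priv_step hS h13
      (f := fun n => { n with bl := some l.bc }) fun n => ⟨rfl, rfl⟩
    rw [← h1]
    exact quiet .linkRl h3 h4 rfl htd (by simp [exc, hpc]) (hH.congr h5)
      ⟨fun _ => heq (by simp), hph.quiet hS h4, hF.quiet hS h4, h11,
        (h4.key _ _ (hF.bcPub hS)).trans_ne h12, h2 ▸ h13, by
          simp only [h6, h14, and_self]⟩
  case newNode =>
    obtain ⟨rfl, rfl, rfl⟩ := hs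
    obtain ⟨hF, h11, h12⟩ := hI
    obtain ⟨S', h1, h3, h4, h5, h6, h7⟩ := alloc_step hS u e.key e.val
    rw [← h1]
    exact quiet .newLock h3 h4 rfl htd (by simp [exc, hpc]) (hH.congr h5)
      ⟨fun _ => heq (by simp), hph.quiet hS h4, hF.quiet hS h4, h11,
        (h4.key _ _ (hF.bcPub hS)).trans_ne h12, h6, by simp only [h7, and_self]⟩
  case linkRl =>
    obtain ⟨rfl, rfl, rfl⟩ := hs
    obtain ⟨hF, h11, h12, h13, h14, h15, h16, h17, h18⟩ := hI
    obtain ⟨S', h1, hP⟩ := publish_step hS hF.rpPub h13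
      (fun b hb => by
        unfold Mem.rl at hb
        rw [h17] at hb
        exact Option.some.inj hb ▸ hF.rcPub)
      (fun b hb => by
        unfold Mem.bl at hb
        rw [h18] at hb
        obtain rfl := Option.some.inj hb
        refine ⟨hF.bcPub hS, ?_⟩
        unfold Mem.key at h12 ⊢
        rw [h14]
        exact lt_of_le_of_ne hF.win.le (Ne.symm h12))
    refine ⟨S', h1, hM.guar hP.wf hP.guar ?_ (hmark'' fun a B ha he => ?_),
      fun _ _ _ _ => hP.content⟩
    · have hA := hP.agree (fun _ => True) fun _ => True
      refine (li_upd_iff (l := { l with pc := .upd .linkBl }) (s := .linkBl) rfl htd).2 ⟨hH.congr fun a => by rw [hP.cnt],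
        fun _ => heq (by simp), ?_, hF.mono hS hA trivial, h11, ?_, ?_, ?_, ?_, ?_, ?_⟩
      · exact hph.mono hS hA (fun _ _ _ _ => trivial) (fun _ _ _ _ _ _ => trivial)
          fun _ _ => trivial
      · rw [hP.key]; exact h12
      · rw [hP.st, if_pos rfl]
      · rw [hP.key]; exact h14
      · rw [hP.val]; exact h15
      · rw [hP.marked]; exact h16
      · rw [hP.bl]; exact h18
    -- The new node is published unmarked but becomes blue only with `linkBl`; until then it is the
    -- exception.
    · have han : a ≠ l.node := by
        rintro rfl
        simp [exc] at he
      rw [hP.st, if_neg han] at ha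
      exact ⟨ha, by rw [hP.marked], fun B => hP.blue B a, by simp [exc, hpc]⟩
  case ovVal =>
    obtain ⟨rfl, rfl, rfl⟩ := hs
    obtain ⟨hF, h11, h12⟩ := hI
    obtain ⟨hrc, hbc⟩ := heq (by simp)
    have hbcp := hF.bcPub hS
    obtain ⟨hWF, hkey, hcnt, hbl, hmk, hval, hG⟩ := core_step (u := u) hS hbcp
      (hown l.bc (by simp [updHeld])) (f := fun n => { n with val := e.val })
      (fun n => ⟨rfl, rfl, rfl⟩) fun b hb => hS.blPub _ _ _ hbcp hb
    rw [show (S.sh.heap l.bc).bl = S.bl l.bc from rfl, Function.update_eq_self] at hbl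
    rw [show (S.sh.heap l.bc).marked = S.marked l.bc from rfl, Function.update_eq_self] at hmk
    have hblue : ∀ B a, (S.modify l.bc fun n => { n with val := e.val }).Blue B a ↔ S.Blue B a :=
      fun B a => by simp only [Mem.Blue, hbl]
    have hA : Agree (fun _ => True) (fun a => a ≠ l.bc) S
        (S.modify l.bc fun n => { n with val := e.val }) :=
      { pub := fun _ _ h => h
        key := fun a B _ => by rw [hkey]
        bl := fun a B _ _ => by rw [hbl]
        blue := fun a B _ => (hblue B a).2
        val := fun a B ha _ => by rw [hval, Function.update_of_ne ha] }
    refine ⟨S.modify l.bc _, rfl, hM.guar hWF (hG fun B x _ _ => hblue B x) ?_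
      (hmark'' fun a B ha he => ?_), fun o k r hd hc => ?_⟩
    · refine (li_upd_iff (l := { l with pc := .upd .ovTs }) (s := .ovTs) rfl htd).2 ⟨hH.congr fun a => by rw [hcnt],
        fun _ => ⟨hrc, hbc⟩, Phase2.snoc (hph.overwrite (c := e) hS hbcp h12 hA hD) ?_, trivial⟩
      refine ⟨hF.rpPub, (hblue _ _).2 hF.win.blue, by rw [hkey]; exact hF.win.lt,
        fun _ => ⟨l.bc, ?_, by rw [hbl]; exact hF.win.next, by rw [hkey]; exact h12, ?_⟩,
        fun h => absurd h11 h⟩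
      · simp [curEntry, LogEntry.slots, hbc]
      · rw [hval, Function.update_self]; rfl
    · exact ⟨ha, by rw [hmk], fun B => hblue B a, by simp [exc, hpc]⟩
    -- Only the entry's own key loses its value, and this key is dirty.
    · rw [hl] at hd
      refine hc.congr hkey (fun a _ => hblue _ a) fun a ha hk => ?_
      rw [hval, Function.update_of_ne]
      rintro rfl
      exact hother hd (hS.bucket_unique ha hbcp).symm (hk.symm.trans h12)
  case reVal =>
    obtain ⟨rfl, rfl, rfl⟩ := hs
    obtain ⟨hF, h11, h12, h13⟩ := hI
    obtain ⟨hrc, hbc⟩ := heq (by simp)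
    have hp := hF.rcPub
    obtain ⟨hWF, hkey, hcnt, hbl, hmk, hval, hG⟩ := core_step (u := u) hS hp
      (hown l.rc (by simp [updHeld])) (f := fun n => { n with val := e.val })
      (fun n => ⟨rfl, rfl, rfl⟩) fun b hb => hS.blPub _ _ _ hp hb
    rw [show (S.sh.heap l.rc).bl = S.bl l.rc from rfl, Function.update_eq_self] at hbl
    rw [show (S.sh.heap l.rc).marked = S.marked l.rc from rfl, Function.update_eq_self] at hmk
    generalize hS' : S.modify l.rc (fun n => { n with val := e.val }) = S' at *
    have hst : S'.st = S.st := by rw [← hS']; rfl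
    have hblue : ∀ B a, S'.Blue B a ↔ S.Blue B a := fun B a => by simp only [Mem.Blue, hbl]
    have hA : Agree (fun _ => True) (fun a => a ≠ l.rc) S S' :=
      { pub := fun _ _ h => by rw [hst]; exact h
        key := fun a B _ => by rw [hkey]
        bl := fun a B ha _ => by rw [hbl]
        blue := fun a B _ => (hblue B a).2
        val := fun a B ha _ => by rw [hval, Function.update_of_ne ha] }
    refine ⟨S', by rw [← hS']; rfl, hM.guar hWF (hG fun B x _ _ => hblue B x) ?_
      ?_, fun o k r hd hc => ?_⟩
    · refine (li_upd_iff (l := { l with pc := .upd .reMarked }) (s := .reMarked) rfl htd).2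
        ⟨hH.congr fun a => by rw [hcnt], fun _ => ⟨hrc, hbc⟩, hph.overwrite (c := e) hS hp h13 hA hD,
          hF.mono hS hA trivial, h11, ?_, ?_, ?_⟩
      · rw [hkey]; exact h12
      · rw [hkey]; exact h13
      · rw [hval, Function.update_self]
    · exact hmark'' fun a B ha he => ⟨by rw [← hst]; exact ha, by rw [hmk], fun B => hblue B a,
        by simp [exc, hpc]⟩
    -- The red node is not blue, so overwriting its value alters no content, not even for the key of
    -- the entry.
    · refine hc.congr hkey (fun a _ => hblue _ a) fun a ha hk => ?_
      rw [hval, Function.update_of_ne]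
      rintro rfl
      exact hF.not_blue hS h12 hp h13 _ ha
  case reMarked =>
    obtain ⟨rfl, rfl, rfl⟩ := hs
    obtain ⟨hF, h11, h12, h13, h14⟩ := hI
    obtain ⟨hrc, hbc⟩ := heq (by simp)
    have hp := hF.rcPub
    obtain ⟨hWF, hkey, hcnt, hbl, hmk, hval, hG⟩ := core_step (u := u) hS hp
      (hown l.rc (by simp [updHeld])) (f := fun n => { n with marked := false })
      (fun n => ⟨rfl, rfl, rfl⟩) fun b hb => hS.blPub _ _ _ hp hb
    rw [show (S.sh.heap l.rc).bl = S.bl l.rc from rfl, Function.update_eq_self] at hbl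
    rw [show (S.sh.heap l.rc).val = S.val l.rc from rfl, Function.update_eq_self] at hval
    generalize hS' : S.modify l.rc (fun n => { n with marked := false }) = S' at *
    have hst : S'.st = S.st := by rw [← hS']; rfl
    have hblue : ∀ B a, S'.Blue B a ↔ S.Blue B a := fun B a => by simp only [Mem.Blue, hbl]
    have hA : Agree (fun _ => True) (fun _ => True) S S' :=
      { pub := fun _ _ h => by rw [hst]; exact h
        key := fun a B _ => by rw [hkey]
        bl := fun a B ha _ => by rw [hbl]
        blue := fun a B _ => (hblue B a).2
        val := fun a B ha _ => by rw [hval] }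
    refine ⟨S', by rw [← hS']; rfl, hM.guar hWF (hG fun B x _ _ => hblue B x) ?_
      ?_, fun o k r hd hc => ?_⟩
    · refine (li_upd_iff (l := { l with pc := .upd .reBl }) (s := .reBl) rfl htd).2
        ⟨hH.congr fun a => by rw [hcnt], fun _ => ⟨hrc, hbc⟩, hph.mono_blue hS hA fun _ _ _ => trivial,
          hF.mono hS hA trivial, h11, ?_, ?_, ?_, ?_⟩
      · rw [hkey]; exact h12
      · rw [hkey]; exact h13
      · rw [hval]; exact h14
      · rw [hmk, Function.update_self]
    -- From here until `reLink` the node `l.rc` is unmarked without being blue.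
    · refine hmark'' fun a B ha he => ⟨by rw [← hst]; exact ha, ?_, fun B => hblue B a,
        by simp [exc, hpc]⟩
      rw [hmk, Function.update_of_ne]
      rintro rfl
      simp [exc] at he
    · exact hc.congr hkey (fun a _ => hblue _ a) fun a ha hk => by rw [hval]
  case reBl =>
    obtain ⟨rfl, rfl, rfl⟩ := hs
    obtain ⟨hF, h11, h12, h13, h14, h15⟩ := hI
    obtain ⟨hrc, hbc⟩ := heq (by simp)
    have hp := hF.rcPub
    obtain ⟨hWF, hkey, hcnt, hbl, hmk, hval, hG⟩ := core_step (u := u) hS hp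
      (hown l.rc (by simp [updHeld])) (f := fun n => { n with bl := some l.bc })
      (fun n => ⟨rfl, rfl, rfl⟩) fun b hb => by
        obtain rfl := Option.some.inj hb
        exact ⟨hF.bcPub hS, by rw [h13]; exact lt_of_le_of_ne hF.win.le (Ne.symm h12)⟩
    rw [show (S.sh.heap l.rc).marked = S.marked l.rc from rfl, Function.update_eq_self] at hmk
    rw [show (S.sh.heap l.rc).val = S.val l.rc from rfl, Function.update_eq_self] at hval
    generalize hS' : S.modify l.rc (fun n => { n with bl := some l.bc }) = S' at *
    have hst : S'.st = S.st := by rw [← hS']; rfl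
    have hnb := hF.not_blue hS h12 hp h13
    have hblue : ∀ B a, S'.Blue B a ↔ S.Blue B a := fun B a => by
      simp only [Mem.Blue, hbl]
      exact blueFn_update hnb B a
    have hA : Agree (fun a => a ≠ l.rc) (fun _ => True) S S' :=
      { pub := fun _ _ h => by rw [hst]; exact h
        key := fun a B _ => by rw [hkey]
        bl := fun a B ha _ => by rw [hbl, Function.update_of_ne ha]
        blue := fun a B _ => (hblue B a).2
        val := fun a B ha _ => by rw [hval] }
    have hX : ∀ a B, S.Blue B a → a ≠ l.rc := by
      rintro a B ha rfl
      exact hnb B ha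
    refine ⟨S', by rw [← hS']; rfl, hM.guar hWF (hG fun B x _ _ => hblue B x) ?_
      ?_, fun o k r hd hc => ?_⟩
    · refine (li_upd_iff (l := { l with pc := .upd .reLink }) (s := .reLink) rfl htd).2
        ⟨hH.congr fun a => by rw [hcnt], fun _ => ⟨hrc, hbc⟩, hph.mono_blue hS hA hX,
          hF.mono hS hA (hX _ _ hF.win.blue), h11, ?_, ?_, ?_, ?_, ?_⟩
      · rw [hkey]; exact h12
      · rw [hkey]; exact h13
      · rw [hval]; exact h14
      · rw [hmk]; exact h15
      · rw [hbl, Function.update_self]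
    · exact hmark'' fun a B ha he => ⟨by rw [← hst]; exact ha, by rw [hmk], fun B => hblue B a,
        by simpa [exc, hpc] using he⟩
    · exact hc.congr hkey (fun a _ => hblue _ a) fun a ha hk => by rw [hval]
  case reLink =>
    obtain ⟨rfl, rfl, rfl⟩ := hs
    obtain ⟨hF, h11, h12, h13, h14, h15, h16⟩ := hI
    obtain ⟨hrc, hbc⟩ := heq (by simp)
    have hp := hF.bpPub hS
    obtain ⟨hWF, hkey, hcnt, hbl, hmk, hval, hG⟩ := core_step (u := u) hS hp
      (hown l.bp (by simp [updHeld])) (f := fun n => { n with bl := some l.rc })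
      (fun n => ⟨rfl, rfl, rfl⟩) fun b hb => by
        obtain rfl := Option.some.inj hb
        exact ⟨hF.rcPub, by rw [h13]; exact hF.win.lt⟩
    rw [show (S.sh.heap l.bp).marked = S.marked l.bp from rfl, Function.update_eq_self] at hmk
    rw [show (S.sh.heap l.bp).val = S.val l.bp from rfl, Function.update_eq_self] at hval
    generalize hS' : S.modify l.bp (fun n => { n with bl := some l.rc }) = S' at *
    have hst : S'.st = S.st := by rw [← hS']; rfl
    have hnb := hF.not_blue hS h12 hF.rcPub h13
    have hblue : ∀ B a, S'.Blue B a ↔ S.Blue B a ∨ (B = e.bucket hash ∧ a = l.rc) := fun B a => by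
      simp only [Mem.Blue, hbl]
      refine blueFn_insert hF.win.blue hF.win.next h16 ?_ (fun B' hB' => ?_) B a
      · intro h
        exact hnb _ (h ▸ hF.win.blue)
      · exact (hS.bucket_unique hB' hp).symm
    have hne : ∀ a, a ≠ l.rc → ∀ B, S'.Blue B a ↔ S.Blue B a := fun a ha B => by
      rw [hblue]
      simp [ha]
    refine ⟨S', by rw [← hS']; rfl, hM.guar hWF (hG fun B x _ hx => hne x (by rintro rfl; exact absurd (hown l.rc (by simp [updHeld])) (by omega)) B) ?_
      ?_, fun o k r hd hc => ?_⟩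
    · refine (li_upd_iff (l := { l with pc := .upd .reTs }) (s := .reTs) rfl htd).2
        ⟨hH.congr fun a => by rw [hcnt], fun _ => ⟨hrc, hbc⟩, Phase2.insert (c := curEntry l e .reTs) hph hS hF.win h16
          hF.rcPub h13 h14 (by simp [curEntry, LogEntry.slots, hrc]) hF.rpPub h11 hD hR hst hkey hval
          hbl hblue, trivial⟩
    · refine hmark' l.rc (by simp [exc, hpc]) (by simp [exc]) hst (fun B hB => ?_)
        (fun a _ => by rw [hmk]) hne
      rw [hmk, h15, hblue]
      simp only [true_iff]
      rw [hF.rcPub] at hB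
      exact .inr ⟨by simpa using hB.symm, trivial⟩
    · refine hc.congr hkey (fun a hk => ?_) fun a ha hk => by rw [hval]
      rw [hblue, or_iff_left]
      rintro ⟨h1, rfl⟩
      exact hother (hl ▸ hd) h1 (hk.symm.trans h13)
  case linkBl =>
    obtain ⟨rfl, rfl, rfl⟩ := hs
    obtain ⟨hF, h11, h12, h10, h13, h14, h15, h16⟩ := hI
    obtain ⟨hrc, hbc⟩ := heq (by simp)
    have hp := hF.bpPub hS
    obtain ⟨hWF, hkey, hcnt, hbl, hmk, hval, hG⟩ := core_step (u := u) hS hp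
      (hown l.bp (by simp [updHeld])) (f := fun n => { n with bl := some l.node })
      (fun n => ⟨rfl, rfl, rfl⟩) fun b hb => by
        obtain rfl := Option.some.inj hb
        exact ⟨h10, by rw [h13]; exact hF.win.lt⟩
    rw [show (S.sh.heap l.bp).marked = S.marked l.bp from rfl, Function.update_eq_self] at hmk
    rw [show (S.sh.heap l.bp).val = S.val l.bp from rfl, Function.update_eq_self] at hval
    generalize hS' : S.modify l.bp (fun n => { n with bl := some l.node }) = S' at *
    have hst : S'.st = S.st := by rw [← hS']; rfl
    have hnb := hF.not_blue hS h12 h10 h13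
    have hblue : ∀ B a, S'.Blue B a ↔ S.Blue B a ∨ (B = e.bucket hash ∧ a = l.node) := fun B a => by
      simp only [Mem.Blue, hbl]
      refine blueFn_insert hF.win.blue hF.win.next h16 ?_ (fun B' hB' => ?_) B a
      · intro h
        exact hnb _ (h ▸ hF.win.blue)
      · exact (hS.bucket_unique hB' hp).symm
    have hne : ∀ a, a ≠ l.node → ∀ B, S'.Blue B a ↔ S.Blue B a := fun a ha B => by
      rw [hblue]
      simp [ha]
    refine ⟨S', by rw [← hS']; rfl, hM.guar hWF (hG fun B x _ hx => hne x (by rintro rfl; exact absurd (hown l.node (by simp [updHeld])) (by omega)) B) ?_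
      ?_, fun o k r hd hc => ?_⟩
    · refine (li_upd_iff (l := { l with pc := .upd .newTs }) (s := .newTs) rfl htd).2
        ⟨hH.congr fun a => by rw [hcnt], fun _ => ⟨hrc, hbc⟩, Phase2.insert (c := curEntry l e .newTs) hph hS hF.win h16
          h10 h13 h14 (by simp [curEntry, LogEntry.slots]) hF.rpPub h11 hD hR hst hkey hval
          hbl hblue, by
            change S'.bl l.bp = _; rw [hbl, Function.update_self]⟩
    · refine hmark' l.node (by simp [exc, hpc]) (by simp [exc]) hst (fun B hB => ?_)
        (fun a _ => by rw [hmk]) hne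
      rw [hmk, h15, hblue]
      simp only [true_iff]
      rw [h10] at hB
      exact .inr ⟨by simpa using hB.symm, trivial⟩
    · refine hc.congr hkey (fun a hk => ?_) fun a ha hk => by rw [hval]
      rw [hblue, or_iff_left]
      rintro ⟨h1, rfl⟩
      exact hother (hl ▸ hd) h1 (hk.symm.trans h13)
  case delMarked =>
    obtain ⟨rfl, rfl, rfl⟩ := hs
    obtain ⟨hF, h11, h12⟩ := hI
    obtain ⟨hrc, hbc⟩ := heq (by simp)
    have hp := hF.bcPub hS
    obtain ⟨hWF, hkey, hcnt, hbl, hmk, hval, hG⟩ := core_step (u := u) hS hp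
      (hown l.bc (by simp [updHeld])) (f := fun n => { n with marked := true })
      (fun n => ⟨rfl, rfl, rfl⟩) fun b hb => hS.blPub _ _ _ hp hb
    rw [show (S.sh.heap l.bc).bl = S.bl l.bc from rfl, Function.update_eq_self] at hbl
    rw [show (S.sh.heap l.bc).val = S.val l.bc from rfl, Function.update_eq_self] at hval
    generalize hS' : S.modify l.bc (fun n => { n with marked := true }) = S' at *
    have hst : S'.st = S.st := by rw [← hS']; rfl
    have hblue : ∀ B a, S'.Blue B a ↔ S.Blue B a := fun B a => by simp only [Mem.Blue, hbl]
    have hA : Agree (fun _ => True) (fun _ => True) S S' :=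
      { pub := fun _ _ h => by rw [hst]; exact h
        key := fun a B _ => by rw [hkey]
        bl := fun a B ha _ => by rw [hbl]
        blue := fun a B _ => (hblue B a).2
        val := fun a B ha _ => by rw [hval] }
    refine ⟨S', by rw [← hS']; rfl, hM.guar hWF (hG fun B x _ _ => hblue B x) ?_
      ?_, fun o k r hd hc => ?_⟩
    · refine (li_upd_iff (l := { l with pc := .upd .delRead }) (s := .delRead) rfl htd).2
        ⟨hH.congr fun a => by rw [hcnt], fun _ => ⟨hrc, hbc⟩, hph.mono_blue hS hA fun _ _ _ => trivial,
          hF.mono hS hA trivial, h11, ?_, ?_⟩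
      · rw [hkey]; exact h12
      · rw [hmk, Function.update_self]
    -- From here until `delLink` the node `l.bc` is marked while still blue.
    · refine hmark'' fun a B ha he => ⟨by rw [← hst]; exact ha, ?_, fun B => hblue B a,
        by simp [exc, hpc]⟩
      rw [hmk, Function.update_of_ne]
      rintro rfl
      simp [exc] at he
    · exact hc.congr hkey (fun a _ => hblue _ a) fun a ha hk => by rw [hval]
  case delRead =>
    obtain ⟨rfl, rfl, rfl⟩ := hs
    obtain ⟨hF, h11, h12, h13⟩ := hI
    exact quiet .delLink hS Quiet.rfl' rfl htd (by simp [exc, hpc]) hH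
      ⟨fun _ => heq (by simp), hph, hF, h11, h12, h13, rfl⟩
  case delLink =>
    obtain ⟨rfl, rfl, rfl⟩ := hs
    obtain ⟨hF, h11, h12, h13, h14⟩ := hI
    obtain ⟨hrc, hbc⟩ := heq (by simp)
    have hp := hF.bpPub hS
    obtain ⟨hWF, hkey, hcnt, hbl, hmk, hval, hG⟩ := core_step (u := u) hS hp
      (hown l.bp (by simp [updHeld])) (f := fun n => { n with bl := l.tmp })
      (fun n => ⟨rfl, rfl, rfl⟩) fun b hb => by
        have := hS.blPub _ _ b (hF.bcPub hS) (h14 ▸ hb)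
        exact ⟨this.1, hF.win.lt.trans (by rw [← h12]; exact this.2)⟩
    rw [show (S.sh.heap l.bp).marked = S.marked l.bp from rfl, Function.update_eq_self] at hmk
    rw [show (S.sh.heap l.bp).val = S.val l.bp from rfl, Function.update_eq_self] at hval
    generalize hS' : S.modify l.bp (fun n => { n with bl := l.tmp }) = S' at *
    have hst : S'.st = S.st := by rw [← hS']; rfl
    simp only [h14] at hbl
    have hbcp := hF.bcPub hS
    have hcb : l.bp ≠ l.bc := by
      intro h
      have := hF.win.lt
      rw [h, h12] at this
      exact lt_irrefl _ this
    have hblue : ∀ B a, S'.Blue B a ↔ S.Blue B a ∧ a ≠ l.bc := fun B a => by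
      simp only [Mem.Blue, hbl]
      refine blueFn_delete hF.win.next (fun B' x hx hxc => ?_) (fun o b h => ?_) hcb
        (fun h => lt_irrefl _ (hS.blPub _ _ _ hbcp h).2) B a
      · have hxp : S.Blue B' x := hx
        obtain rfl : B' = e.bucket hash := by
          have := (hS.blPub _ _ _ (hS.blue_pub hxp) hxc).1
          rw [hbcp] at this
          simpa using this.symm
        -- A blue node that points to `l.bc` is the last one below its key, and so is `l.bp`.
        refine Mem.Pred.unique hS (κ := nodeKey e.key) ⟨hxp, ?_, fun y hy => ?_⟩ hF.win.pred
        · rw [← h12]; exact (hS.blPub _ _ _ (hS.blue_pub hxp) hxc).2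
        · obtain rfl := Option.some.inj (hxc.symm.trans hy)
          exact h12.ge
      · have := hF.win.lt
        rw [← h12, h, hS.headKey] at this
        exact not_lt_bot this
    have hne : ∀ a, a ≠ l.bc → ∀ B, S'.Blue B a ↔ S.Blue B a := fun a ha B => by
      rw [hblue]
      simp [ha]
    refine ⟨S', by rw [← hS']; rfl, hM.guar hWF (hG fun B x _ hx => hne x (by rintro rfl; exact absurd (hown l.bc (by simp [updHeld])) (by omega)) B) ?_
      ?_, fun o k r hd hc => ?_⟩
    · refine (li_upd_iff (l := { l with pc := .upd .delTs }) (s := .delTs) rfl htd).2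
        ⟨hH.congr fun a => by rw [hcnt], fun _ => ⟨hrc, hbc⟩, Phase2.delete (c := curEntry l e .delTs) hph hS hF.win h12
          hF.rpPub h11 hD hR hst hkey hval hbl hblue, trivial⟩
    · refine hmark' l.bc (by simp [exc, hpc]) (by simp [exc]) hst (fun B hB => ?_)
        (fun a _ => by rw [hmk]) hne
      rw [hmk, h13, hblue]
      simp
    · refine hc.congr hkey (fun a hk => ?_) fun a ha hk => by rw [hval]
      rw [hblue, and_iff_left_iff_imp]
      rintro ha rfl
      exact hother (hl ▸ hd) (hS.bucket_unique ha hbcp).symm (hk.symm.trans h12)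

end Upd

/-! ### Local effects of the steps, and the invariant of the transaction log. -/

section LocalInv

variable {T O K V : Type*} [DecidableEq T] [DecidableEq O] [LinearOrder K] {m : ℕ}
variable {hash : O → K → Fin m} {u t : T} {g g' : Shared T O K V m}
  {l l' : Local O K V m} {ev : Option (Event T O K V)}
  {e : LogEntry O K V m} {rest : List (LogEntry O K V m)}

theorem shared_lock_cntr {a : Addr O m} (h : g.lock u a = some g') : g'.cntr = g.cntr := by
  obtain ⟨v, rfl, -⟩ := shared_lock_spec h
  rfl

theorem shared_unlock_cntr (a : Addr O m) : (g.unlock u a).cntr = g.cntr := by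
  obtain ⟨v, h, -⟩ := shared_unlock_spec g u a
  rw [h]; rfl

/-- All that the history argument needs of a search: it is silent, leaves log and counter alone, and
ends in one of the two exits of its caller. -/
theorem stepSearch_local {c : Caller} {o : O} {k : K} {s : SearchPC}
    (hs : stepSearch hash u g l c o k s = some (g', l', ev)) :
    ev = none ∧ l'.log = l.log ∧ l'.done = l.done ∧ l'.todo = l.todo ∧ l'.tx = l.tx ∧
      g'.cntr = g.cntr ∧
      ((∃ s', l'.pc = .search c o k s') ∨
        (l'.pc = match c with | .rv d => .rvEff d o k .dispatch | .tryC => .tcFound) ∨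
        (l'.pc = match c with | .rv d => .rvAbort d o k | .tryC => .tcAbort)) := by
  cases c <;> cases s <;>
    simp only [stepSearch, Option.map_eq_some_iff, Option.some.injEq, Prod.mk.injEq] at hs <;>
    (repeat' split at hs) <;>
    (try simp only [Option.some.injEq, Prod.mk.injEq, reduceCtorEq] at hs)
  all_goals first
    | (obtain ⟨rfl, rfl, rfl⟩ := hs
       refine ⟨rfl, rfl, rfl, rfl, rfl, ?_, ?_⟩
       · first | rfl | exact shared_unlock_cntr _
       · first
          | exact .inl ⟨_, rfl⟩
          | exact .inr (.inl rfl)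
          | exact .inr (.inr rfl))
    | (obtain ⟨g1, h1, rfl, rfl, rfl⟩ := hs
       exact ⟨rfl, rfl, rfl, rfl, rfl, shared_lock_cntr h1, .inl ⟨_, rfl⟩⟩)

/-- The program points of `commonLu&Del` after its linearization point. -/
def RvPC.isPost : RvPC → Bool
  | .unlockRp | .unlockRc | .unlockBc | .log => true
  | _ => false

/-- The log entry created by `commonLu&Del`. -/
def rvEntry (l : Local O K V m) (d : Bool) (o : O) (k : K) : LogEntry O K V m :=
  { obj := o, key := k, opn := if d then .delete else .lookup,
    val := if d then none else l.val, st := l.st,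
    bp := l.bp, rp := l.rp, rc := l.rc, bc := l.bc }

/-- The linearization point precedes the write to the log by several steps. In between, the
registers from which the entry is built do not change, so the future entry is already determined. -/
theorem stepRv_local {d : Bool} {o : O} {k : K} {s : RvPC}
    (hs : stepRv u g l d o k s = some (g', l', ev)) :
    l'.tx = l.tx ∧ g'.cntr = g.cntr ∧
      ((s = .unlockBp ∧ l' = { l with pc := .rvEff d o k .unlockRp } ∧
          ev = some (.lp u ⟨l.tx, rvMeth d o k (.ret l.val)⟩)) ∨
        (s = .log ∧ ev = none ∧
          l' = { l with log := putLL l.log (rvEntry l d o k), pc := .ret (rvMeth d o k (.ret l.val)) }) ∨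
        (ev = none ∧ l'.log = l.log ∧ ∃ s', l'.pc = .rvEff d o k s' ∧ s'.isPost = s.isPost ∧
          (s.isPost = true → rvEntry l' d o k = rvEntry l d o k))) := by
  by_cases hlog : s = .log
  · subst hlog
    simp only [stepRv, Option.some.injEq, Prod.mk.injEq] at hs
    obtain ⟨rfl, rfl, rfl⟩ := hs
    exact ⟨rfl, rfl, .inr (.inl ⟨rfl, rfl, rfl⟩)⟩
  cases s <;> simp only [stepRv, Option.some.injEq, Prod.mk.injEq] at hs <;>
    (try exact absurd rfl hlog) <;>
    (repeat' split at hs) <;>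
    (try simp only [Option.some.injEq, Prod.mk.injEq] at hs) <;>
    obtain ⟨rfl, rfl, rfl⟩ := hs
  case unlockBp => exact ⟨rfl, shared_unlock_cntr _, .inl ⟨rfl, rfl, rfl⟩⟩
  all_goals
    refine ⟨rfl, ?_, .inr (.inr ⟨rfl, rfl, _, rfl, rfl, ?_⟩)⟩
    · first | rfl | exact shared_unlock_cntr _
    · first | exact fun _ => rfl | exact fun h => absurd h (by simp [RvPC.isPost])

/-- The part of a log entry that is not changed by `tryC`. -/
def LogEntry.sig (e : LogEntry O K V m) : O × K × Opn × Option V := (e.obj, e.key, e.opn, e.val)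

/-- The second loop alters only the addresses stored in the entries; the list of signatures ties the
treated entries to the log until the commit. -/
theorem stepUpd_local {s : UpdPC} (htd : l.todo = e :: rest)
    (hs : stepUpd hash u g l e rest s = some (g', l', ev)) :
    ev = none ∧ l'.log = l.log ∧ l'.tx = l.tx ∧ g'.cntr = g.cntr ∧
      (l'.done ++ l'.todo).map LogEntry.sig = (l.done ++ l.todo).map LogEntry.sig ∧
      ((∃ s', l'.pc = .upd s') ∨ l'.pc = .updLoop) := by
  cases s <;>
    simp only [stepUpd, Option.bind_eq_some_iff, Option.some.injEq, Prod.mk.injEq] at hs <;>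
    (repeat' split at hs) <;>
    (try simp only [Option.some.injEq, Prod.mk.injEq, reduceCtorEq] at hs)
  case finish =>
    obtain ⟨rfl, rfl, rfl⟩ := hs
    refine ⟨rfl, rfl, rfl, rfl, ?_, .inr rfl⟩
    simp [htd, LogEntry.sig]
  case newField =>
    obtain ⟨rfl, rfl, rfl⟩ := hs
    refine ⟨rfl, rfl, rfl, rfl, ?_, .inl ⟨_, rfl⟩⟩
    simp [htd, LogEntry.sig]
  all_goals first
    | (obtain ⟨rfl, rfl, rfl⟩ := hs
       refine ⟨rfl, rfl, rfl, ?_, rfl, .inl ⟨_, rfl⟩⟩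
       first | rfl | exact shared_unlock_cntr _)
    | (obtain ⟨g1, h1, rfl, rfl, rfl⟩ := hs
       exact ⟨rfl, rfl, rfl, shared_lock_cntr h1, rfl, .inl ⟨_, rfl⟩⟩)

/-- Two entries are for different keys. -/
abbrev EntryNe (a b : LogEntry O K V m) : Prop := ¬ (a.obj = b.obj ∧ a.key = b.key)

/-- The entries that `tryC` is treating. -/
def tracked (l : Local O K V m) : Option (List (LogEntry O K V m)) :=
  match l.pc with
  | .tcLoop | .tcFound | .updLoop | .upd _ | .search .tryC _ _ _ => some (l.done ++ l.todo)
  | .rel _ _ => if l.lpDone then none else some l.todo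
  | _ => none

/-- The invariant of the local log. -/
structure LogI (l : Local O K V m) : Prop where
  log : l.log.Pairwise EntryNe
  ent : ∀ es, tracked l = some es → es.map LogEntry.sig = (orderedLL l.log).map LogEntry.sig
  -- A method that goes to the shared memory is the first of its transaction on the key; this is
  -- remembered up to its linearization point.
  new : ∀ d o k, (∃ s, l.pc = .search (.rv d) o k s) ∨ (∃ s, l.pc = .rvEff d o k s) →
    findInLL l.log o k = none

theorem findInLL_eq_none {log : List (LogEntry O K V m)} {o : O} {k : K} :
    findInLL log o k = none ↔ ∀ e ∈ log, ¬ (e.obj = o ∧ e.key = k) := by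
  simp [findInLL]

theorem findInLL_eq_some {log : List (LogEntry O K V m)} {o : O} {k : K}
    (hlog : log.Pairwise EntryNe) : findInLL log o k = some e ↔ e ∈ log ∧ e.obj = o ∧ e.key = k := by
  constructor
  · intro h
    have h1 := List.find?_some h
    exact ⟨List.mem_of_find?_eq_some h, by simpa using h1⟩
  · rintro ⟨h1, rfl, rfl⟩
    cases hf : findInLL log e.obj e.key with
    | none => exact absurd ⟨rfl, rfl⟩ (findInLL_eq_none.1 hf e h1)
    | some e' =>
      have h2 : e'.obj = e.obj ∧ e'.key = e.key := by simpa using List.find?_some hf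
      have h3 := List.mem_of_find?_eq_some hf
      by_contra hne
      have hne' : e' ≠ e := fun h => hne (h ▸ rfl)
      have : Std.Symm (EntryNe (O := O) (K := K) (V := V) (m := m)) :=
        ⟨fun a b h h' => h ⟨h'.1.symm, h'.2.symm⟩⟩
      exact hlog.forall h3 h1 hne' h2

theorem putLL_pairwise {log : List (LogEntry O K V m)} (hlog : log.Pairwise EntryNe)
    (e : LogEntry O K V m) : (putLL log e).Pairwise EntryNe := by
  unfold putLL
  split
  · rename_i h
    rw [findInLL_eq_none] at h
    rw [List.pairwise_append]
    refine ⟨hlog, List.pairwise_singleton _ _, fun a ha b hb => ?_⟩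
    rw [List.mem_singleton.1 hb]
    exact h a ha
  · rw [List.pairwise_map]
    refine hlog.imp fun {a b} hab => ?_
    split_ifs with h1 h2 h2
    · exact absurd ⟨h1.1.trans h2.1.symm, h1.2.trans h2.2.symm⟩ hab
    · exact fun h => h2 ⟨h.1.symm, h.2.symm⟩
    · exact h1
    · exact hab

theorem findInLL_putLL {log : List (LogEntry O K V m)} (hlog : log.Pairwise EntryNe)
    (e : LogEntry O K V m) (o : O) (k : K) : findInLL (putLL log e) o k =
      if e.obj = o ∧ e.key = k then some e else findInLL log o k := by
  have hp := putLL_pairwise hlog e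
  have hmem : e ∈ putLL log e := by
    unfold putLL
    split
    · simp
    · rename_i e' h
      rw [findInLL_eq_some hlog] at h
      exact List.mem_map.2 ⟨e', h.1, by simp [h.2]⟩
  split_ifs with h
  · exact (findInLL_eq_some hp).2 ⟨hmem, h⟩
  · have hiff : ∀ x, x.obj = o ∧ x.key = k → (x ∈ putLL log e ↔ x ∈ log) := by
      rintro x ⟨rfl, rfl⟩
      unfold putLL
      split
      · simp only [List.mem_append, List.mem_singleton, or_iff_left_iff_imp]
        rintro rfl
        exact absurd ⟨rfl, rfl⟩ h
      · rw [List.mem_map]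
        constructor
        · rintro ⟨y, hy, hyx⟩
          split_ifs at hyx with h1
          · subst hyx; exact absurd ⟨rfl, rfl⟩ h
          · exact hyx ▸ hy
        · intro hx
          exact ⟨x, hx, if_neg fun h1 => h ⟨h1.1.symm, h1.2.symm⟩⟩
    cases hf : findInLL log o k with
    | none =>
      rw [findInLL_eq_none] at hf ⊢
      exact fun x hx hxk => hf x ((hiff x hxk).1 hx) hxk
    | some e' =>
      rw [findInLL_eq_some hlog] at hf
      exact (findInLL_eq_some hp).2 ⟨(hiff e' hf.2).2 hf.1, hf.2⟩

/-- Sorting gives weakly increasing keys, and the log has one entry per key of a table, so the order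
is strict within each table. Equality of signatures transfers this to the entries being treated. -/
theorem LogI.ordered (h : LogI l) {es : List (LogEntry O K V m)} (hes : tracked l = some es) :
    es.Pairwise EntryOrd ∧ ∀ e ∈ es, e.opn ≠ .lookup := by
  have hent := h.ent es hes
  have hperm : (orderedLL l.log).Perm (l.log.filter fun e => e.opn.isUpdate) :=
    List.perm_insertionSort _ _
  have h1 : (orderedLL l.log).Pairwise fun a b => a.key ≤ b.key := by
    have : Std.Total (α := LogEntry O K V m) (fun a b => a.key ≤ b.key) := ⟨fun a b => le_total _ _⟩
    have : IsTrans (LogEntry O K V m) (fun a b => a.key ≤ b.key) := ⟨fun a b c => le_trans⟩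
    exact List.pairwise_insertionSort _ _
  have h2 : (orderedLL l.log).Pairwise EntryNe :=
    (hperm.pairwise_iff (fun h h' => h ⟨h'.1.symm, h'.2.symm⟩)).2 (h.log.filter _)
  have h3 : (orderedLL l.log).Pairwise EntryOrd :=
    (h1.and h2).imp fun {a b} hab ho => lt_of_le_of_ne hab.1 fun hk => hab.2 ⟨ho, hk⟩
  constructor
  · have h4 : ((orderedLL l.log).map LogEntry.sig).Pairwise
        (fun a b => a.1 = b.1 → a.2.1 < b.2.1) := List.pairwise_map.2 h3
    rw [← hent, List.pairwise_map] at h4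
    exact h4
  · intro e he ho
    have h4 : e.sig ∈ (orderedLL l.log).map LogEntry.sig := hent ▸ List.mem_map_of_mem he
    obtain ⟨e', he', hsig⟩ := List.mem_map.1 h4
    have h5 := (List.mem_filter.1 (hperm.subset he')).2
    have h6 : e'.opn = e.opn := congrArg (fun x => x.2.2.1) hsig
    rw [h6, ho] at h5
    simp [Opn.isUpdate] at h5

theorem LogI.untracked (h : l.log.Pairwise EntryNe) (h1 : tracked l = none)
    (h2 : ∀ d o k, (∀ s, l.pc ≠ .search (.rv d) o k s) ∧ ∀ s, l.pc ≠ .rvEff d o k s) : LogI l where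
  log := h
  ent es hes := by simp [h1] at hes
  new d o k hn := by
    rcases hn with ⟨s, hs⟩ | ⟨s, hs⟩
    · exact absurd hs ((h2 d o k).1 s)
    · exact absurd hs ((h2 d o k).2 s)

theorem LogI.transfer (h : LogI l) {es es' : List (LogEntry O K V m)} (h1 : tracked l = some es)
    (h2 : tracked l' = some es') (h3 : es'.map LogEntry.sig = es.map LogEntry.sig)
    (h4 : l'.log = l.log)
    (h5 : ∀ d o k, (∀ s, l'.pc ≠ .search (.rv d) o k s) ∧ ∀ s, l'.pc ≠ .rvEff d o k s) :
    LogI l' where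
  log := h4 ▸ h.log
  ent es1 hes := by
    rw [h2, Option.some.injEq] at hes
    rw [← hes, h3, h4]
    exact h.ent _ h1
  new d o k hn := by
    rcases hn with ⟨s, hs⟩ | ⟨s, hs⟩
    · exact absurd hs ((h5 d o k).1 s)
    · exact absurd hs ((h5 d o k).2 s)

theorem LogI.invoke (h : LogI l) {op : Op O K V} {p : PC O K V}
    (hp : invoke l.pc op = some p) : LogI { l with pc := p } := by
  unfold HTOSTM.invoke at hp
  split at hp <;> simp only [Option.some.injEq, reduceCtorEq] at hp <;> subst hp <;>
    exact LogI.untracked h.log rfl (by simp)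

/-- `hrel`, supplied by the memory invariant, says that the release drops entries only after the
linearization point, when they are no longer tracked. -/
theorem LogI.step (h : LogI l)
    (hrel : ∀ ok s, l.pc = .rel ok s → l.lpDone = false → s = .loop ∨ s = .bp)
    (hs : stepThread hash u g l = some (g', l', ev)) : LogI l' := by
  cases hpc : l.pc <;> simp only [stepThread, hpc, Option.some.injEq, Prod.mk.injEq, reduceCtorEq] at hs
  case stmBegin =>
    obtain ⟨rfl, rfl, rfl⟩ := hs
    exact LogI.untracked List.Pairwise.nil rfl (by simp)
  case ins o k v =>
    obtain ⟨rfl, rfl, rfl⟩ := hs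
    exact LogI.untracked (putLL_pairwise h.log _) rfl (by simp)
  case rvStart d o k =>
    split at hs
    · rename_i hf
      simp only [Option.some.injEq, Prod.mk.injEq] at hs
      obtain ⟨rfl, rfl, rfl⟩ := hs
      refine ⟨h.log, by simp [tracked], fun d' o' k' hn => ?_⟩
      simp only [PC.search.injEq, reduceCtorEq, exists_false, or_false] at hn
      obtain ⟨s, -, rfl, rfl, -⟩ := hn
      exact hf
    · simp only [Option.some.injEq, Prod.mk.injEq] at hs
      obtain ⟨rfl, rfl, rfl⟩ := hs
      exact LogI.untracked (putLL_pairwise h.log _) rfl (by simp)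
  case search c o k s =>
    obtain ⟨-, h1, h2, h3, -, -, h4⟩ := stepSearch_local hs
    cases c with
    | rv d =>
      have hf := h.new d o k (.inl ⟨s, hpc⟩)
      refine ⟨h1 ▸ h.log, ?_, fun d' o' k' hn => ?_⟩
      · rcases h4 with ⟨s', h4⟩ | h4 | h4 <;> simp [tracked, h4]
      · rw [h1]
        rcases h4 with ⟨s', h4⟩ | h4 | h4 <;> simp [h4] at hn
        · obtain ⟨-, rfl, rfl⟩ := hn
          exact hf
        · obtain ⟨-, rfl, rfl⟩ := hn
          exact hf
    | tryC =>
      have h5 : (∃ s', l'.pc = .search .tryC o k s') ∨ l'.pc = .tcFound ∨ l'.pc = .tcAbort := h4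
      rcases h5 with ⟨s', h5⟩ | h5 | h5
      · exact h.transfer (es := l.done ++ l.todo) (es' := l'.done ++ l'.todo)
          (by simp [tracked, hpc]) (by simp [tracked, h5]) (by rw [h2, h3]) h1 (by simp [h5])
      · exact h.transfer (es := l.done ++ l.todo) (es' := l'.done ++ l'.todo)
          (by simp [tracked, hpc]) (by simp [tracked, h5]) (by rw [h2, h3]) h1 (by simp [h5])
      · exact LogI.untracked (h1 ▸ h.log) (by simp [tracked, h5]) (by simp [h5])
  case rvEff d o k s =>
    obtain ⟨-, -, h1⟩ := stepRv_local hs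
    have hf := h.new d o k (.inr ⟨s, hpc⟩)
    rcases h1 with ⟨rfl, rfl, -⟩ | ⟨rfl, -, rfl⟩ | ⟨-, h1, s', h2, -⟩
    · refine ⟨h.log, by simp [tracked], fun d' o' k' hn => ?_⟩
      simp at hn
      obtain ⟨-, rfl, rfl⟩ := hn
      exact hf
    · exact LogI.untracked (putLL_pairwise h.log _) rfl (by simp)
    · refine ⟨h1 ▸ h.log, by simp [tracked, h2], fun d' o' k' hn => ?_⟩
      simp [h2] at hn
      obtain ⟨-, rfl, rfl⟩ := hn
      rw [h1]
      exact hf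
  case rvAbort d o k =>
    obtain ⟨rfl, rfl, rfl⟩ := hs
    exact LogI.untracked h.log rfl (by simp)
  case tcStart =>
    obtain ⟨rfl, rfl, rfl⟩ := hs
    exact ⟨h.log, by simp [tracked], by simp⟩
  case tcLoop =>
    split at hs <;> rename_i htd <;> simp only [Option.some.injEq, Prod.mk.injEq] at hs <;>
      obtain ⟨rfl, rfl, rfl⟩ := hs
    · exact h.transfer (by simp only [tracked, hpc]; rfl) (by simp only [tracked]; rfl)
        (by simp [htd]) rfl (by simp)
    · exact h.transfer (by simp only [tracked, hpc]; rfl) (by simp only [tracked]; rfl)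
        (by simp [htd]) rfl (by simp)
  case tcFound =>
    split at hs <;> rename_i htd <;>
      simp only [Option.some.injEq, Prod.mk.injEq, reduceCtorEq] at hs
    obtain ⟨rfl, rfl, rfl⟩ := hs
    exact h.transfer (by simp only [tracked, hpc]; rfl) (by simp only [tracked]; rfl)
      (by simp [htd, LogEntry.sig]) rfl (by simp)
  case tcAbort =>
    obtain ⟨rfl, rfl, rfl⟩ := hs
    exact LogI.untracked h.log rfl (by simp)
  case updLoop =>
    split at hs <;> rename_i htd <;> simp only [Option.some.injEq, Prod.mk.injEq] at hs <;>
      obtain ⟨rfl, rfl, rfl⟩ := hs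
    · exact h.transfer (by simp only [tracked, hpc]; rfl) (by simp only [tracked]; rfl)
        (by simp [htd]) rfl (by simp)
    · exact h.transfer (by simp only [tracked, hpc]; rfl) (by simp only [tracked]; rfl)
        (by simp [htd]) rfl (by simp)
  case upd s =>
    split at hs <;> rename_i htd
    · simp at hs
    obtain ⟨-, h1, -, -, h2, h3⟩ := stepUpd_local htd hs
    refine h.transfer (es := l.done ++ l.todo) (es' := l'.done ++ l'.todo) (by simp [tracked, hpc])
      ?_ h2 h1 ?_
    · rcases h3 with ⟨s', h3⟩ | h3 <;> simp [tracked, h3]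
    · rcases h3 with ⟨s', h3⟩ | h3 <;> simp [h3]
  case rel ok s =>
    have hr := hrel ok s hpc
    cases s <;> simp only [stepRel] at hs
    case loop =>
      cases htd : l.todo <;> simp only [htd, Option.some.injEq, Prod.mk.injEq] at hs <;>
        obtain ⟨rfl, rfl, rfl⟩ := hs
      · exact LogI.untracked h.log rfl (by simp)
      · exact ⟨h.log, fun es hes => h.ent es (by simpa [tracked, hpc, htd] using hes), by simp⟩
    all_goals
      (repeat' split at hs) <;>
      (try simp only [Option.some.injEq, Prod.mk.injEq, reduceCtorEq] at hs) <;>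
      obtain ⟨rfl, rfl, rfl⟩ := hs
    all_goals first
      | exact LogI.untracked h.log rfl (by simp)
      | exact LogI.untracked h.log (by
          cases hd : l.lpDone
          · simp [hd] at hr
          · simp [tracked]) (by simp)
  case tryA =>
    obtain ⟨rfl, rfl, rfl⟩ := hs
    exact LogI.untracked h.log rfl (by simp)
  case ret r =>
    obtain ⟨rfl, rfl, rfl⟩ := hs
    refine LogI.untracked h.log ?_ ?_ <;> cases hr : r.isFinal <;> simp [tracked]

end LocalInv

/-! ### Every step keeps the memory invariant; dirty keys are locked. -/

section MemSteps

variable {T O K V : Type*} [DecidableEq T] [DecidableEq O] [LinearOrder K] {m : ℕ}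
variable {hash : O → K → Fin m} {u t : T} {S S' : Mem T O K V m} {L : T → Local O K V m}
  {g' : Shared T O K V m} {l l' : Local O K V m} {ev : Option (Event T O K V)}

theorem li_rel_iff {ok : Bool} {s : RelPC} {e : LogEntry O K V m} {rest : List (LogEntry O K V m)}
    (hpc : l.pc = .rel ok s) (htd : l.todo = e :: rest) :
    LI hash t S l ↔ Held t S (relHeld e s ++ rest.flatMap LogEntry.slots) ∧
      (l.lpDone = false → ok = true ∧ (s = .loop ∨ s = .bp) ∧ ∀ e ∈ l.todo, DoneOK hash S e) := by
  have h1 : held l = relHeld e s ++ rest.flatMap LogEntry.slots := by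
    unfold held; rw [hpc]; simp only [htd]
  have h2 : PcI hash t S l = (l.lpDone = false →
      ok = true ∧ (s = .loop ∨ s = .bp) ∧ ∀ e ∈ l.todo, DoneOK hash S e) := by
    unfold PcI; rw [hpc]
  exact ⟨fun h => ⟨h1 ▸ h.held, h2 ▸ h.pc⟩, fun h => ⟨h1 ▸ h.1, h2 ▸ h.2⟩⟩

theorem li_rel_loop {ok : Bool} (hpc : l.pc = .rel ok .loop)
    (h1 : Held t S (l.todo.flatMap LogEntry.slots))
    (h2 : l.lpDone = false → ok = true ∧ ∀ e ∈ l.todo, DoneOK hash S e) : LI hash t S l := by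
  constructor
  · unfold held
    rw [hpc]
    cases htd : l.todo with
    | nil => exact Held.nil
    | cons e rest => rw [htd] at h1; exact h1
  · unfold PcI
    rw [hpc]
    exact fun h => ⟨(h2 h).1, .inl rfl, (h2 h).2⟩

theorem LI.rel_pc {ok : Bool} {s : RelPC} (h : LI hash t S l) (hpc : l.pc = .rel ok s)
    (hlp : l.lpDone = false) : ok = true ∧ (s = .loop ∨ s = .bp) ∧ ∀ e ∈ l.todo, DoneOK hash S e := by
  have h2 := h.pc
  unfold PcI at h2
  rw [hpc] at h2
  exact h2 hlp

/-- The conclusion is `Quiet` and not just `StepOK`, because at the commit the contents of the dirty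
keys have to be carried over too. -/
theorem step_rel {ok : Bool} {s : RelPC} (hM : MemInv hash S L) (hpc : (L u).pc = .rel ok s)
    (hs : stepRel u S.sh (L u) ok s = some (g', l', ev)) :
    ∃ S', S'.sh = g' ∧ MemInv hash S' (Function.update L u l') ∧ Quiet u S S' := by
  have hS := hM.wf
  have hLI := hM.li u
  have hex : ∀ a, exc (L u) = some a → exc l' = some a := by simp [exc, hpc]
  have hlp := hLI.rel_pc hpc
  generalize hl : L u = l at *
  have silent : ∀ {l'}, LI hash u S l' →
      ∃ S', S'.sh = S.sh ∧ MemInv hash S' (Function.update L u l') ∧ Quiet u S S' := fun h =>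
    ⟨S, rfl, hM.quiet hS Quiet.rfl' (by simp [hl, exc, hpc]) h, Quiet.rfl'⟩
  have unlock : ∀ {a L' l'}, (∀ x, (a :: L').count x ≤ (held l).count x) →
      (∀ {S'}, Held u S' L' → LI hash u S' l') →
      ∃ S', S'.sh = S.sh.unlock u a ∧ MemInv hash S' (Function.update L u l') ∧ Quiet u S S' := by
    intro a L' l' h1 h2
    have h3 := hLI.held.mono h1
    obtain ⟨S', h4, -, h5, h6, h7⟩ := unlock_step hS (h3.own List.mem_cons_self)
    exact ⟨S', h4, hM.quiet h5 h6 (by simp [hl, exc, hpc]) (h2 (h3.uncons h7)), h6⟩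
  cases htd : l.todo with
  | nil =>
    cases s <;> simp only [stepRel, htd, Option.some.injEq, Prod.mk.injEq, reduceCtorEq] at hs
    obtain ⟨rfl, rfl, rfl⟩ := hs
    exact silent ⟨Held.nil, trivial⟩
  | cons e rest =>
    have hheld : held l = relHeld e s ++ rest.flatMap LogEntry.slots := by
      unfold held; rw [hpc]; simp only [htd]
    rw [hheld] at unlock
    have hdone : s ≠ .loop → s ≠ .bp → l.lpDone = true := by
      intro h1 h2
      cases h : l.lpDone
      · rcases (hlp h).2.1 with h3 | h3
        · exact absurd h3 h1
        · exact absurd h3 h2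
      · rfl
    cases s <;> simp only [stepRel, htd] at hs
    case loop =>
      simp only [Option.some.injEq, Prod.mk.injEq] at hs
      obtain ⟨rfl, rfl, rfl⟩ := hs
      refine silent ((li_rel_iff (s := .bp) rfl rfl).2 ⟨((li_rel_iff hpc htd).1 hLI).1, fun h => ?_⟩)
      exact ⟨(hlp h).1, .inr rfl, fun e he => (hlp h).2.2 e (htd ▸ he)⟩
    case bp =>
      simp only [Option.some.injEq, Prod.mk.injEq] at hs
      obtain ⟨rfl, rfl, rfl⟩ := hs
      refine unlock (L' := relHeld e .rp ++ rest.flatMap LogEntry.slots) (fun x => le_of_eq ?_)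
        fun h => (li_rel_iff rfl rfl).2 ⟨h, by simp⟩
      simp [relHeld, LogEntry.slots]
    case rp =>
      simp only [Option.some.injEq, Prod.mk.injEq] at hs
      obtain ⟨rfl, rfl, rfl⟩ := hs
      refine unlock (L' := relHeld e .node ++ rest.flatMap LogEntry.slots) (fun x => le_of_eq ?_)
        fun h => (li_rel_iff rfl rfl).2 ⟨h, by simp [hdone]⟩
      simp [relHeld]
    case node =>
      cases hn : e.node with
      | none =>
        simp only [hn, Option.some.injEq, Prod.mk.injEq] at hs
        obtain ⟨rfl, rfl, rfl⟩ := hs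
        refine silent ((li_rel_iff rfl rfl).2 ⟨?_, by simp [hdone]⟩)
        have := ((li_rel_iff hpc htd).1 hLI).1
        simpa [relHeld, hn] using this
      | some a =>
        simp only [hn, Option.some.injEq, Prod.mk.injEq] at hs
        obtain ⟨rfl, rfl, rfl⟩ := hs
        refine unlock (L' := relHeld e .rc ++ rest.flatMap LogEntry.slots) (fun x => le_of_eq ?_)
          fun h => (li_rel_iff rfl rfl).2 ⟨h, by simp [hdone]⟩
        simp [relHeld, hn, List.count_cons]
        omega
    case rc =>
      simp only [Option.some.injEq, Prod.mk.injEq] at hs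
      obtain ⟨rfl, rfl, rfl⟩ := hs
      refine unlock (L' := relHeld e .bc ++ rest.flatMap LogEntry.slots) (fun x => le_of_eq ?_)
        fun h => (li_rel_iff rfl rfl).2 ⟨h, by simp [hdone]⟩
      simp [relHeld]
    case bc =>
      simp only [Option.some.injEq, Prod.mk.injEq] at hs
      obtain ⟨rfl, rfl, rfl⟩ := hs
      refine unlock (L' := rest.flatMap LogEntry.slots) (fun x => le_of_eq ?_)
        fun h => li_rel_loop rfl h (by simp [hdone])
      simp [relHeld]

theorem step_mem (hM : MemInv hash S L) (hlog : LogI (L u))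
    (hs : stepThread hash u S.sh (L u) = some (g', l', ev)) : StepOK hash u S L g' l' := by
  have hS := hM.wf
  have hLI := hM.li u
  have silent : (∀ s, (L u).pc ≠ .upd s) → ∀ {l'}, LI hash u S l' → StepOK hash u S L S.sh l' := by
    intro hpc l' h
    refine StepOK.silent hM (fun a ha => ?_) h
    unfold exc at ha
    split at ha <;> simp at ha <;> rename_i h1 <;> exact absurd h1 (hpc _)
  have hpcI := hLI.pc
  have hheld := hLI.held
  unfold PcI at hpcI
  unfold held at hheld
  cases hpc : (L u).pc <;>
    simp only [stepThread, hpc, Option.some.injEq, Prod.mk.injEq, reduceCtorEq] at hs hpcI hheld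
  case stmBegin =>
    obtain ⟨rfl, rfl, rfl⟩ := hs
    refine StepOK.quiet (S' := ⟨{ S.sh with cntr := S.sh.cntr + 1 }, S.st⟩) hM
      ⟨hS.headPub, hS.headKey, hS.freeCell, hS.blPub, hS.rlPub, hS.cntSt⟩ ?_
      (by simp [exc, hpc]) ⟨Held.nil, trivial⟩
    exact ⟨fun _ _ => Iff.rfl, fun _ _ _ => rfl, fun _ _ _ => rfl, fun _ _ _ => rfl, fun _ _ _ => rfl,
      fun _ _ _ => rfl, fun _ _ _ h => ⟨h, rfl⟩⟩
  case ins o k v =>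
    obtain ⟨rfl, rfl, rfl⟩ := hs
    exact silent (by simp [hpc]) ⟨Held.nil, trivial⟩
  case rvStart d o k =>
    split at hs <;> simp only [Option.some.injEq, Prod.mk.injEq] at hs <;>
      obtain ⟨rfl, rfl, rfl⟩ := hs <;> exact silent (by simp [hpc]) ⟨Held.nil, trivial⟩
  case search c o k s => exact step_search hM hpc hs
  case rvEff d o k s => exact step_rv hM hpc hs
  case rvAbort d o k =>
    obtain ⟨rfl, rfl, rfl⟩ := hs
    exact silent (by simp [hpc]) ⟨Held.nil, trivial⟩
  case tcStart =>
    obtain ⟨rfl, rfl, rfl⟩ := hs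
    exact silent (by simp [hpc]) ⟨Held.nil, fun e he => absurd he List.not_mem_nil⟩
  case tcLoop =>
    split at hs <;> rename_i htd <;> simp only [Option.some.injEq, Prod.mk.injEq] at hs <;>
      obtain ⟨rfl, rfl, rfl⟩ := hs
    -- On entering the second loop no entry has been treated, and every window is still the one that
    -- the first loop found and locked.
    · refine silent (by simp [hpc]) ⟨hheld, ⟨fun e he => absurd he List.not_mem_nil, fun e he => ?_⟩⟩
      have h := hpcI e he
      exact ⟨⟨h.bpPub hS, h.rpPub, h.rcPub, h.bcPub hS, h.win.lt, h.win.le⟩, e.bp, h.win, .inl rfl⟩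
    · exact silent (by simp [hpc]) ((li_search_iff (c := .tryC) (s := .start) rfl).2
        ⟨hheld, trivial, ⟨_, _, htd, rfl, rfl⟩, hpcI⟩)
  case tcFound =>
    split at hs <;> rename_i htd <;>
      simp only [Option.some.injEq, Prod.mk.injEq, reduceCtorEq] at hs
    obtain ⟨rfl, rfl, rfl⟩ := hs
    obtain ⟨⟨e', rest', h1, h2⟩, h3⟩ := hpcI
    rw [htd] at h1
    obtain ⟨rfl, rfl⟩ := List.cons.inj h1
    refine silent (by simp [hpc]) ⟨?_, fun e he => ?_⟩
    · refine hheld.mono fun x => le_of_eq ?_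
      simp [held, LogEntry.slots, List.count_cons]
      omega
    · rcases List.mem_append.1 he with he | he
      · exact h3 e he
      · rw [List.mem_singleton.1 he]
        exact h2
  case tcAbort =>
    obtain ⟨rfl, rfl, rfl⟩ := hs
    exact silent (by simp [hpc]) (li_rel_loop rfl hheld (by simp))
  case updLoop =>
    split at hs <;> rename_i htd <;> simp only [Option.some.injEq, Prod.mk.injEq] at hs <;>
      obtain ⟨rfl, rfl, rfl⟩ := hs
    · refine silent (by simp [hpc]) (li_rel_loop rfl ?_ fun _ => ⟨rfl, hpcI.doneOK⟩)
      simpa [htd] using hheld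
    · rename_i e rest
      refine silent (by simp [hpc]) ((li_upd_iff (l := { L u with pc := .upd .load }) rfl htd).2 ⟨?_, fun h => absurd rfl h, ?_, ?_⟩)
      · refine hheld.mono fun x => le_of_eq ?_
        simp [updHeld, htd]
        omega
      · exact ⟨hpcI.doneOK, fun e he => hpcI.todoOK e (htd ▸ List.mem_cons_of_mem _ he)⟩
      · exact hpcI.todoOK e (htd ▸ List.mem_cons_self)
  case upd s =>
    split at hs <;> rename_i htd
    · simp at hs
    obtain ⟨h1, h2⟩ := hlog.ordered (es := (L u).done ++ (L u).todo) (by simp [tracked, hpc])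
    rw [htd] at h1 h2
    exact step_upd hM hpc htd h1 (h2 _ (by simp)) hs
  case rel ok s =>
    obtain ⟨S', h1, h2, h3⟩ := step_rel hM hpc hs
    exact ⟨S', h1, h2, fun _ _ _ _ h => h3.content hS h⟩
  case tryA =>
    obtain ⟨rfl, rfl, rfl⟩ := hs
    exact silent (by simp [hpc]) ⟨Held.nil, trivial⟩
  case ret r =>
    obtain ⟨rfl, rfl, rfl⟩ := hs
    refine silent (by simp [hpc]) ⟨?_, ?_⟩
    · cases hr : r.isFinal <;> exact Held.nil
    · cases hr : r.isFinal <;> trivial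

theorem MemInv.invoke (hM : MemInv hash S L) {op : Op O K V} {p : PC O K V}
    (hp : invoke (L u).pc op = some p) :
    MemInv hash S (Function.update L u { L u with pc := p }) := by
  refine hM.quiet hM.wf Quiet.rfl' (fun a ha => ?_) ?_
  · unfold exc at ha
    unfold HTOSTM.invoke at hp
    split at hp <;> simp_all
  · unfold HTOSTM.invoke at hp
    split at hp <;> simp only [Option.some.injEq, reduceCtorEq] at hp <;> subst hp <;>
      exact ⟨Held.nil, trivial⟩

/-- Whoever may have changed the value of a key holds the lock of its predecessor. -/
theorem LI.dirty (h : LI hash t S l) {o : O} {k : K} (hd : Dirty l o k) :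
    ∃ p, S.Pred (o, hash o k) (nodeKey k) p ∧ 0 < S.cnt t p := by
  -- After an INSERT the successor of `e.bp` carries the key, after a DELETE it lies beyond it; both
  -- times `e.bp` is the last blue node below the key.
  have done : ∀ e, DoneOK hash S e → e.obj = o → e.key = k →
      S.Pred (o, hash o k) (nodeKey k) e.bp := by
    rintro e he rfl rfl
    refine ⟨he.blue, he.lt, fun c hc => ?_⟩
    by_cases hi : e.opn = .insert
    · obtain ⟨n, -, h1, h2, -⟩ := he.ins hi
      rw [← Option.some.inj (h1.symm.trans hc), h2]
    · exact (he.del hi c hc).le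
  have todo : ∀ d e, TodoOK hash S d e → e.obj = o → e.key = k → ∃ p,
      S.Pred (o, hash o k) (nodeKey k) p ∧ (p = e.bp ∨ ∃ e' ∈ d, p ∈ e'.slots) := by
    rintro d e he rfl rfl
    obtain ⟨-, p, h1, h2⟩ := he
    exact ⟨p, h1.pred, h2.imp id fun ⟨e', h3, _, h4, _⟩ => ⟨e', h3, h4⟩⟩
  have hpcI := h.pc
  have own := fun a => h.held.own (a := a)
  unfold PcI at hpcI
  unfold HTOSTM.held at own
  unfold Dirty at hd
  split at hd <;> (try exact hd.elim) <;> rename_i hpc <;> simp only [hpc] at hpcI own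
  · obtain ⟨e, he, h1, h2⟩ := hd
    rcases List.mem_append.1 he with he | he
    · exact ⟨_, done e (hpcI.doneOK e he) h1 h2, own _ (List.mem_append_left _
        (List.mem_flatMap.2 ⟨e, he, mem_slots_bp e⟩))⟩
    · obtain ⟨p, h3, h4⟩ := todo _ e (hpcI.todoOK e he) h1 h2
      refine ⟨p, h3, own _ ?_⟩
      rcases h4 with rfl | ⟨e', h4, h5⟩
      · exact List.mem_append_right _ (List.mem_flatMap.2 ⟨e, he, mem_slots_bp e⟩)
      · exact List.mem_append_left _ (List.mem_flatMap.2 ⟨e', h4, h5⟩)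
  · rename_i s
    obtain ⟨e, he, h1, h2⟩ := hd
    obtain ⟨e0, rest, htd, hI⟩ := hpcI
    simp only [htd] at own he
    have ownd : ∀ e ∈ l.done, ∀ a ∈ e.slots, 0 < S.cnt t a := fun e he a ha =>
      own a (List.mem_append_right _ (List.mem_append_left _ (List.mem_flatMap.2 ⟨e, he, ha⟩)))
    have ownr : ∀ e ∈ rest, ∀ a ∈ e.slots, 0 < S.cnt t a := fun e he a ha =>
      own a (List.mem_append_right _ (List.mem_append_right _ (List.mem_flatMap.2 ⟨e, he, ha⟩)))
    have ownc : ∀ a ∈ updHeld l e0 s, 0 < S.cnt t a := fun a ha => own a (List.mem_append_left _ ha)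
    have hpost : s.isPost = true → ∀ a ∈ (curEntry l e0 s).slots, a ∈ updHeld l e0 s := by
      intro hs a ha
      have he := hI.eqs (by rintro rfl; simp [UpdPC.isPost] at hs)
      cases s <;> simp [UpdPC.isPost] at hs <;>
        simpa [curEntry, LogEntry.slots, updHeld, he.1, he.2] using ha
    rw [List.mem_append, List.mem_cons] at he
    rcases he with he | rfl | he
    · have h3 := hI.phase.doneOK e (by split_ifs <;> simp [he])
      exact ⟨_, done e h3 h1 h2, ownd e he _ (mem_slots_bp e)⟩
    · by_cases hs : s.isPost = true
      · have h3 := hI.phase.doneOK (curEntry l e s) (by simp [hs])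
        refine ⟨_, done _ h3 ?_ ?_, ownc _ (hpost hs _ (mem_slots_bp _))⟩
        · cases s <;> exact h1
        · cases s <;> exact h2
      · have hc := hI.cur
        subst h1 h2
        have found : Found S (e.bucket hash) (nodeKey e.key) l.bp l.rp l.rc l.bc →
            l.bp ∈ updHeld l e s → ∃ p, S.Pred (e.obj, hash e.obj e.key) (nodeKey e.key) p ∧
              0 < S.cnt t p := fun h1 h2 => ⟨_, h1.win.pred, ownc _ h2⟩
        -- Even while the lock of `l.bp` is given up, the actual predecessor is locked on behalf of
        -- an earlier entry. So there is no gap in the protection of the key.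
        have behind : ∀ p, S.Win (e.bucket hash) (nodeKey e.key) p l.bc → Behind hash S l.done e p →
            ∃ p, S.Pred (e.obj, hash e.obj e.key) (nodeKey e.key) p ∧ 0 < S.cnt t p :=
          fun p h1 ⟨e', h2, _, h3, _⟩ => ⟨p, h1.pred, ownd e' h2 p h3⟩
        cases s <;> simp [UpdPC.isPost] at hs <;> simp only [PreI] at hc
        case load =>
          obtain ⟨p, h3, h4⟩ := todo _ e hc rfl rfl
          refine ⟨p, h3, ?_⟩
          rcases h4 with rfl | ⟨e', h4, h5⟩
          · exact ownc _ (mem_slots_bp e)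
          · exact ownd e' h4 p h5
        case testBpMarked =>
          obtain ⟨-, p, h3, rfl | h4⟩ := hc
          · exact ⟨_, h3.pred, ownc _ (by simp [updHeld])⟩
          · exact behind p h3 h4
        case testBpBl =>
          obtain ⟨-, -, p, h3, rfl | h4⟩ := hc
          · exact ⟨_, h3.pred, ownc _ (by simp [updHeld])⟩
          · exact behind p h3 h4
        case unlockBp =>
          obtain ⟨-, -, p, h3, h4⟩ := hc
          exact behind p h3 h4
        case newBp =>
          obtain ⟨-, -, p, h3, h4⟩ := hc
          exact behind p h3 h4
        case lockBp => exact behind _ hc.1.win hc.2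
        case testRpRl | unlockRp | newRp | lockRp | dispatch => exact found hc (by simp [updHeld])
        all_goals exact found hc.1 (by simp [updHeld])
    · obtain ⟨p, h3, h4⟩ := todo _ e (hI.phase.todoOK e he) h1 h2
      refine ⟨p, h3, ?_⟩
      rcases h4 with rfl | ⟨e', h4, h5⟩
      · exact ownr e he _ (mem_slots_bp e)
      · split_ifs at h4 with hs
        · rcases List.mem_append.1 h4 with h4 | h4
          · exact ownd e' h4 p h5
          · rw [List.mem_singleton.1 h4] at h5
            exact ownc _ (hpost hs p h5)
        · exact ownd e' h4 p h5
  · obtain ⟨h1, e, he, h2, h3⟩ := hd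
    obtain ⟨-, h4, h5⟩ := hpcI h1
    refine ⟨_, done e (h5 e he) h2 h3, own _ ?_⟩
    cases htd : l.todo with
    | nil => simp [htd] at he
    | cons e0 rest =>
      rw [htd] at he
      rcases List.mem_cons.1 he with rfl | he
      · refine List.mem_append_left _ ?_
        rcases h4 with rfl | rfl <;> exact mem_slots_bp _
      · exact List.mem_append_right _ (List.mem_flatMap.2 ⟨e, he, mem_slots_bp e⟩)

end MemSteps

/-! ### Histories that grow by one method, and what a log entry says about them. -/

section HistoryLemmas

variable {O K V : Type*}

theorem Meth.IsUpdate.key {m : Meth O K V} {o : O} {k : K} (h : m.IsUpdate o k) :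
    m.key? = some (o, k) := by
  rcases h with ⟨v, rfl⟩ | ⟨r, rfl⟩ <;> rfl

theorem Meth.IsRv.key {m : Meth O K V} {o : O} {k : K} {r : Option V} (h : m.IsRv o k r) :
    m.key? = some (o, k) := by
  rcases h with rfl | rfl <;> rfl

namespace SeqHistory

variable {H : SeqHistory O K V} {t u i j q c : ℕ} {o : O} {k : K} {r : Option V} {m : Meth O K V}

theorem getElem?_snoc {e x : MExec O K V} :
    (H ++ [e])[i]? = some x ↔ H[i]? = some x ∨ (i = H.length ∧ x = e) := by
  rcases lt_trichotomy i H.length with h | h | h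
  · rw [List.getElem?_append_left h]
    exact ⟨.inl, fun h1 => h1.elim id fun h2 => absurd h2.1 h.ne⟩
  · subst h
    simp [eq_comm]
  · rw [List.getElem?_eq_none (by simp; omega), List.getElem?_eq_none h.le]
    simp [h.ne']

theorem lt_of_getElem? {x : MExec O K V} (h : H[i]? = some x) : i < H.length :=
  (List.getElem?_eq_some_iff.1 h).1

theorem onKey_snoc : OnKey (H ++ [⟨u, m⟩]) i t o k ↔
    OnKey H i t o k ∨ (i = H.length ∧ t = u ∧ m.key? = some (o, k)) := by
  unfold OnKey
  simp only [getElem?_snoc]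
  constructor
  · rintro ⟨w, h1 | ⟨h1, h2⟩, h3⟩
    · exact .inl ⟨w, h1, h3⟩
    · cases h2; exact .inr ⟨h1, rfl, h3⟩
  · rintro (⟨w, h1, h3⟩ | ⟨h1, rfl, h3⟩)
    · exact ⟨w, .inl h1, h3⟩
    · exact ⟨m, .inr ⟨h1, rfl⟩, h3⟩

theorem updateAt_snoc : UpdateAt (H ++ [⟨u, m⟩]) i t o k ↔
    UpdateAt H i t o k ∨ (i = H.length ∧ t = u ∧ m.IsUpdate o k) := by
  unfold UpdateAt
  simp only [getElem?_snoc]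
  constructor
  · rintro ⟨w, h1 | ⟨h1, h2⟩, h3⟩
    · exact .inl ⟨w, h1, h3⟩
    · cases h2; exact .inr ⟨h1, rfl, h3⟩
  · rintro (⟨w, h1, h3⟩ | ⟨h1, rfl, h3⟩)
    · exact ⟨w, .inl h1, h3⟩
    · exact ⟨m, .inr ⟨h1, rfl⟩, h3⟩

theorem commitAt_snoc : CommitAt (H ++ [⟨u, m⟩]) i t ↔
    CommitAt H i t ∨ (i = H.length ∧ t = u ∧ m = .tryC true) := by
  unfold CommitAt
  rw [getElem?_snoc, MExec.mk.injEq, @eq_comm _ _ m]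

theorem OnKey.lt (h : OnKey H i t o k) : i < H.length := by
  obtain ⟨w, h, -⟩ := h
  exact lt_of_getElem? h

theorem UpdateAt.lt (h : UpdateAt H i t o k) : i < H.length := by
  obtain ⟨w, h, -⟩ := h
  exact lt_of_getElem? h

theorem CommitAt.lt (h : CommitAt H i t) : i < H.length := lt_of_getElem? h

theorem UpdateAt.exists_last (h : UpdateAt H i t o k) : ∃ q, IsLastUpdate H q t o k := by
  classical
  have h1 := Nat.findGreatest_spec (P := fun q => UpdateAt H q t o k) h.lt.le h
  exact ⟨_, h1, fun q hq hu => absurd hu (Nat.findGreatest_is_greatest hq hu.lt.le)⟩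

/-- The closest update of `⟨o, k⟩` that is committed before position `i` leaves the value `r`. -/
def Closest (H : SeqHistory O K V) (i : ℕ) (o : O) (k : K) (r : Option V) : Prop :=
  ∃ p q c u, H.LastCommit c p i o k ∧ H.IsLastUpdate q p o k ∧ H[q]? = some (MExec.mk p u) ∧
    ((∃ v, u = .ins o k v ∧ r = some v) ∨ ((∃ r', u = .del o k r') ∧ r = none))

theorem IsLastUpdate.snoc (h : IsLastUpdate H q t o k) (ht : t = u → ¬ m.IsUpdate o k) :
    IsLastUpdate (H ++ [⟨u, m⟩]) q t o k := by
  refine ⟨updateAt_snoc.2 (.inl h.1), fun q' hq hu => ?_⟩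
  rcases updateAt_snoc.1 hu with h1 | ⟨-, h1, h2⟩
  · exact h.2 q' hq h1
  · exact ht h1 h2

/-- The last updater has committed, so it differs from `u`, and the new method cannot become its
last update. `hnew` excludes a new committed updater in between; it is stated for both a fixed
position and the moving end of the history. -/
theorem Closest.snoc_of (h : Closest H i o k r) (hu : ∀ c, ¬ CommitAt H c u) (hj : i ≤ j)
    (hnew : ∀ x y d, UpdateAt (H ++ [⟨u, m⟩]) y x o k → CommitAt (H ++ [⟨u, m⟩]) d x → d < j →
      d < i ∧ d < H.length) :
    Closest (H ++ [⟨u, m⟩]) j o k r := by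
  obtain ⟨p, q, c, w, ⟨h1, h2, h3⟩, h4, h5, h6⟩ := h
  have hpu : p ≠ u := fun hp => hu c (hp ▸ h1)
  refine ⟨p, q, c, w, ⟨commitAt_snoc.2 (.inl h1), h2.trans_le hj, ?_⟩,
    h4.snoc fun hp => absurd hp hpu, getElem?_snoc.2 (.inl h5), h6⟩
  rintro ⟨x, y, d, h7, h8, h9, h10⟩
  obtain ⟨h11, h12⟩ := hnew x y d h7 h8 h10
  rcases commitAt_snoc.1 h8 with h8 | ⟨h8, -, -⟩
  · have hxu : x ≠ u := fun hx => hu d (hx ▸ h8)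
    rcases updateAt_snoc.1 h7 with h7 | ⟨-, h7, -⟩
    · exact h3 ⟨x, y, d, h7, h8, h9, h11⟩
    · exact hxu h7
  · exact h12.ne h8

theorem Closest.snoc (h : Closest H i o k r) (hu : ∀ c, ¬ CommitAt H c u) (hi : i ≤ H.length) :
    Closest (H ++ [⟨u, m⟩]) i o k r :=
  h.snoc_of hu le_rfl fun x y d _ _ hd => ⟨hd, hd.trans_le hi⟩

/-- The closest update at the end of the history changes only by the commit of a transaction that
updates the key. -/
theorem Closest.succ (h : Closest H H.length o k r) (hu : ∀ c, ¬ CommitAt H c u)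
    (hm : m = .tryC true → ∀ y, ¬ UpdateAt H y u o k) :
    Closest (H ++ [⟨u, m⟩]) (H ++ [(⟨u, m⟩ : MExec O K V)]).length o k r := by
  refine h.snoc_of hu (by simp) fun x y d h1 h2 hd => ?_
  rcases commitAt_snoc.1 h2 with h2 | ⟨-, rfl, rfl⟩
  · exact ⟨h2.lt, h2.lt⟩
  · rcases updateAt_snoc.1 h1 with h1 | ⟨-, -, h1⟩
    · exact absurd h1 (hm rfl y)
    · exact absurd h1.key (by simp [Meth.key?])

/-- A commit in the last position leaves no room for a later one before the end of the history. -/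
theorem Closest.commit (h : IsLastUpdate H q u o k) (hq : H[q]? = some ⟨u, m⟩)
    (hm : (∃ v, m = .ins o k v ∧ r = some v) ∨ ((∃ r', m = .del o k r') ∧ r = none)) :
    Closest (H ++ [⟨u, .tryC true⟩]) (H ++ [(⟨u, .tryC true⟩ : MExec O K V)]).length o k r := by
  refine ⟨u, q, H.length, m, ⟨commitAt_snoc.2 (.inr ⟨rfl, rfl, rfl⟩), by simp, ?_⟩,
    h.snoc fun _ hu => absurd hu.key (by simp [Meth.key?]), getElem?_snoc.2 (.inl hq), hm⟩
  rintro ⟨x, y, d, -, h1, h2, h3⟩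
  simp at h3
  omega

theorem isPrev_snoc (hi : i ≤ H.length) :
    IsPrev (H ++ [⟨u, m⟩]) j i t o k ↔ IsPrev H j i t o k := by
  have h : ∀ l < i, OnKey (H ++ [⟨u, m⟩]) l t o k ↔ OnKey H l t o k := fun l hl => by
    rw [onKey_snoc]
    exact or_iff_left fun h => absurd h.1 (hl.trans_le hi).ne
  unfold IsPrev
  constructor
  · rintro ⟨h1, h2, h3⟩
    exact ⟨h1, (h j h1).1 h2, fun l hl hli => (h l hli).not.1 (h3 l hl hli)⟩
  · rintro ⟨h1, h2, h3⟩
    exact ⟨h1, (h j h1).2 h2, fun l hl hli => (h l hli).not.2 (h3 l hl hli)⟩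

theorem noneBefore_snoc (hi : i ≤ H.length) :
    NoneBefore (H ++ [⟨u, m⟩]) i t o k ↔ NoneBefore H i t o k := by
  refine forall₂_congr fun l hl => not_congr ?_
  rw [onKey_snoc]
  exact or_iff_left fun h => absurd h.1 (hl.trans_le hi).ne

theorem LR1.snoc (h : LR1 H i t o k r) (hi : i ≤ H.length) : LR1 (H ++ [⟨u, m⟩]) i t o k r := by
  intro j w hj hw
  rw [isPrev_snoc hi] at hj
  rcases getElem?_snoc.1 hw with hw | ⟨hw, -⟩
  · exact h j w hj hw
  · exact absurd hw (hj.1.trans_le hi).ne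

/-- The rules for the return values. -/
def Good (H : SeqHistory O K V) : Prop :=
  ∀ i t m o k r, H[i]? = some (MExec.mk t m) → t ≠ 0 → m.IsRv o k r →
    H.LR1 i t o k r ∧ (H.NoneBefore i t o k → H.Closest i o k r)

theorem Good.snoc (h : Good H) (hu : ∀ c, ¬ CommitAt H c u)
    (hnew : ∀ o k r, m.IsRv o k r → H.LR1 H.length u o k r ∧
      (H.NoneBefore H.length u o k → H.Closest H.length o k r)) : Good (H ++ [⟨u, m⟩]) := by
  intro i t w o k r hi ht hw
  have key : H.LR1 i t o k r ∧ (H.NoneBefore i t o k → H.Closest i o k r) ∧ i ≤ H.length := by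
    rcases getElem?_snoc.1 hi with hi | ⟨rfl, hi'⟩
    · obtain ⟨h1, h2⟩ := h i t w o k r hi ht hw
      exact ⟨h1, h2, (lt_of_getElem? hi).le⟩
    · cases hi'
      obtain ⟨h1, h2⟩ := hnew o k r hw
      exact ⟨h1, h2, le_rfl⟩
  obtain ⟨h1, h2, h3⟩ := key
  exact ⟨h1.snoc h3, fun hn => (h2 ((noneBefore_snoc h3).1 hn)).snoc hu h3⟩

theorem Good.legal (h : Good H) : H.Legal := by
  intro i t m o k r hi ht hm
  obtain ⟨h1, h2⟩ := h i t m o k r hi ht hm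
  refine ⟨h1, fun v hv hn => ?_, fun hr hn => ?_⟩
  · obtain ⟨p, q, c, u, h3, -, h4, ⟨v', rfl, h5⟩ | ⟨-, h5⟩⟩ := h2 hn
    · rw [hv, Option.some.injEq] at h5
      exact ⟨p, q, c, h5 ▸ h4, h3⟩
    · simp [hv] at h5
  · obtain ⟨p, q, c, u, h3, -, h4, ⟨v', rfl, h5⟩ | ⟨⟨r', rfl⟩, h5⟩⟩ := h2 hn
    · simp [hr] at h5
    · exact ⟨p, q, c, r', h4, h3⟩

theorem Good.returnsClosest (h : Good H) : H.ReturnsClosest :=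
  fun i t m o k r hi ht hm hn => (h i t m o k r hi ht hm).2 hn

/-- The log entry for `⟨o, k⟩` of the transaction `t` summarizes its methods on the key. -/
def ViewI (H : SeqHistory O K V) (t : ℕ) (o : O) (k : K) : Option (Opn × Option V) → Prop
  | none => H.NoneBefore H.length t o k
  -- The first rule is stated for the next position: a method that now answers from the log may
  -- return `v`.
  | some (op, v) => (∃ j, H.OnKey j t o k) ∧ H.LR1 H.length t o k v ∧
      match op with
      | .insert => ∃ q v', H.IsLastUpdate q t o k ∧ H[q]? = some ⟨t, .ins o k v'⟩ ∧ v = some v'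
      | .delete => v = none ∧ ∃ q r', H.IsLastUpdate q t o k ∧ H[q]? = some ⟨t, .del o k r'⟩
      | .lookup => ∀ q, ¬ H.UpdateAt q t o k

theorem ViewI.snoc {x : Option (Opn × Option V)} (h : ViewI H t o k x)
    (hm : t = u → m.key? ≠ some (o, k)) : ViewI (H ++ [⟨u, m⟩]) t o k x := by
  have hon : ∀ l, OnKey (H ++ [⟨u, m⟩]) l t o k ↔ OnKey H l t o k := fun l => by
    rw [onKey_snoc]
    exact or_iff_left fun h => hm h.2.1 h.2.2
  have hup : t = u → ¬ m.IsUpdate o k := fun h h1 => hm h h1.key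
  rcases x with _ | ⟨op, v⟩
  · exact fun l _ hl => h l ((hon l).1 hl).lt ((hon l).1 hl)
  · obtain ⟨⟨j, h1⟩, h2, h3⟩ := h
    refine ⟨⟨j, (hon j).2 h1⟩, fun j w ⟨h4, h5, h6⟩ hw => ?_, ?_⟩
    · rw [hon] at h5
      refine h2 j w ⟨h5.lt, h5, fun l hl hlH => (hon l).not.1 (h6 l hl (by simp; omega))⟩ ?_
      rcases getElem?_snoc.1 hw with hw | ⟨hw, -⟩
      · exact hw
      · exact absurd hw h5.lt.ne
    · cases op
      · obtain ⟨q, v', h4, h5, h6⟩ := h3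
        exact ⟨q, v', h4.snoc hup, getElem?_snoc.2 (.inl h5), h6⟩
      · obtain ⟨h6, q, v', h4, h5⟩ := h3
        exact ⟨h6, q, v', h4.snoc hup, getElem?_snoc.2 (.inl h5)⟩
      · intro q hq
        rcases updateAt_snoc.1 hq with hq | ⟨-, hq, hq'⟩
        · exact h3 q hq
        · exact hup hq hq'

/-- For whatever comes next, the previous method on the key is the one just appended, so the rule
reduces to a condition on `m`. -/
theorem lr1_snoc_self (hm : m.key? = some (o, k))
    (h : (∀ v, m = .ins o k v → r = some v) ∧ (∀ r', m = .look o k (.ret r') → r = r') ∧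
      (∀ r', m = .del o k (.ret r') → r = none)) :
    LR1 (H ++ [⟨t, m⟩]) (H ++ [(⟨t, m⟩ : MExec O K V)]).length t o k r := by
  rintro j w ⟨h1, h2, h3⟩ hw
  have h4 : j = H.length := by
    simp at h1
    by_contra hj
    exact h3 H.length (by omega) (by simp) (onKey_snoc.2 (.inr ⟨rfl, rfl, hm⟩))
  rcases getElem?_snoc.1 hw with hw | ⟨-, hw⟩
  · exact absurd h4 (lt_of_getElem? hw).ne
  · cases hw
    exact h

theorem isLastUpdate_snoc_self (hm : m.IsUpdate o k) :
    IsLastUpdate (H ++ [⟨t, m⟩]) H.length t o k :=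
  ⟨updateAt_snoc.2 (.inr ⟨rfl, rfl, hm⟩), fun q hq h => by
    have := h.lt
    simp at this
    omega⟩

theorem viewI_ins (H : SeqHistory O K V) (t : ℕ) (o : O) (k : K) (v : V) :
    ViewI (H ++ [⟨t, .ins o k v⟩]) t o k (some (.insert, some v)) :=
  ⟨⟨H.length, onKey_snoc.2 (.inr ⟨rfl, rfl, rfl⟩)⟩,
    lr1_snoc_self rfl ⟨fun v' h => by cases h; rfl, by simp, by simp⟩,
    H.length, v, isLastUpdate_snoc_self (.inl ⟨v, rfl⟩), by simp, rfl⟩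

theorem viewI_del (H : SeqHistory O K V) (t : ℕ) (o : O) (k : K) (r : Result V) :
    ViewI (H ++ [⟨t, .del o k r⟩]) t o k (some (.delete, none)) :=
  ⟨⟨H.length, onKey_snoc.2 (.inr ⟨rfl, rfl, rfl⟩)⟩,
    lr1_snoc_self rfl ⟨by simp, by simp, fun _ _ => rfl⟩,
    rfl, H.length, r, isLastUpdate_snoc_self (.inr ⟨r, rfl⟩), by simp⟩

theorem ViewI.look_none (h : ViewI H t o k none) (r : Option V) :
    ViewI (H ++ [⟨t, .look o k (.ret r)⟩]) t o k (some (.lookup, r)) := by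
  refine ⟨⟨H.length, onKey_snoc.2 (.inr ⟨rfl, rfl, rfl⟩)⟩,
    lr1_snoc_self rfl ⟨by simp, fun r' h => by cases h; rfl, by simp⟩, ?_⟩
  intro q hq
  rcases updateAt_snoc.1 hq with ⟨w, hq, hw⟩ | ⟨-, -, hq⟩
  · exact h q (lt_of_getElem? hq) ⟨w, hq, hw.key⟩
  · rcases hq with ⟨v, hq⟩ | ⟨v, hq⟩ <;> cases hq

theorem ViewI.look_some {op : Opn} {v : Option V} (h : ViewI H t o k (some (op, v))) :
    ViewI (H ++ [⟨t, .look o k (.ret v)⟩]) t o k (some (op, v)) := by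
  have hup : ¬ (Meth.look o k (.ret v)).IsUpdate o k := by simp [Meth.IsUpdate]
  obtain ⟨-, -, h3⟩ := h
  refine ⟨⟨H.length, onKey_snoc.2 (.inr ⟨rfl, rfl, rfl⟩)⟩,
    lr1_snoc_self rfl ⟨by simp, fun r' h => by cases h; rfl, by simp⟩, ?_⟩
  cases op
  · obtain ⟨q, v', h4, h5, h6⟩ := h3
    exact ⟨q, v', h4.snoc fun _ => hup, getElem?_snoc.2 (.inl h5), h6⟩
  · obtain ⟨h6, q, v', h4, h5⟩ := h3
    exact ⟨h6, q, v', h4.snoc fun _ => hup, getElem?_snoc.2 (.inl h5)⟩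
  · intro q hq
    rcases updateAt_snoc.1 hq with hq | ⟨-, -, hq⟩
    · exact h3 q hq
    · exact hup hq

theorem ViewI.lr1 {op : Opn} {v : Option V} (h : ViewI H t o k (some (op, v))) :
    LR1 H H.length t o k v := h.2.1

theorem ViewI.not_noneBefore {op : Opn} {v : Option V} (h : ViewI H t o k (some (op, v))) :
    ¬ NoneBefore H H.length t o k := by
  obtain ⟨⟨j, hj⟩, -⟩ := h
  exact fun hn => hn j hj.lt hj

theorem NoneBefore.lr1 (h : NoneBefore H i t o k) : LR1 H i t o k r :=
  fun j w hj => absurd hj.2.1 (h j hj.1)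

theorem good_initialTx (ks : List (O × K)) : Good (initialTx ks : SeqHistory O K V) := by
  intro i t m o k r hi ht hm
  have h1 := List.mem_of_getElem? hi
  simp only [initialTx, List.mem_append, List.mem_map, MExec.mk.injEq, List.mem_singleton] at h1
  rcases h1 with ⟨x, -, h1, -⟩ | ⟨h1, -⟩
  · exact absurd h1.symm ht
  · exact absurd h1 ht

theorem tx_initialTx {ks : List (O × K)} {e : MExec O K V} (h : e ∈ initialTx ks) : e.tx = 0 := by
  simp only [initialTx, List.mem_append, List.mem_map, List.mem_singleton] at h
  rcases h with ⟨x, -, rfl⟩ | rfl <;> rfl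

/-- Base case of the content invariant: the commit of the initial transaction matches the empty
tables. All its updates are deletes, so it does not matter which one on the key is the last. -/
theorem closest_initialTx {ks : List (O × K)} (h : (o, k) ∈ ks) :
    Closest (initialTx ks : SeqHistory O K V) (initialTx ks : SeqHistory O K V).length o k none := by
  obtain ⟨i, hi, hik⟩ := List.mem_iff_getElem.1 h
  have h1 : UpdateAt (ks.map (fun x => (⟨0, .del x.1 x.2 (.ret none)⟩ : MExec O K V))) i 0 o k := by
    refine ⟨.del o k (.ret none), ?_, .inr ⟨_, rfl⟩⟩
    rw [List.getElem?_map, List.getElem?_eq_getElem hi, hik]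
    rfl
  obtain ⟨q, hq⟩ := h1.exists_last
  obtain ⟨w, h2, h3⟩ := hq.1
  refine Closest.commit hq h2 (.inr ⟨?_, rfl⟩)
  rcases h3 with ⟨v, rfl⟩ | h3
  · have := List.mem_of_getElem? h2
    simp at this
  · exact h3

end SeqHistory

end HistoryLemmas

open SeqHistory

/-! ### Agreement between the history and the logs of the live transactions. -/

section HistoryInv

variable {T O K V : Type*} [DecidableEq T] [DecidableEq O] [LinearOrder K] {m : ℕ}
variable {hash : O → K → Fin m} {u t : T} {L : T → Local O K V m} {H : SeqHistory O K V} {n : ℕ}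
  {g g' : Shared T O K V m} {l l' : Local O K V m} {ev : Option (Event T O K V)}

/-- The thread executes a transaction that has not passed its last linearization point. -/
def Live (l : Local O K V m) : Prop :=
  match l.pc with
  | .idle | .stmBegin => False
  | .ret r => r.isFinal = false
  | .rel _ _ => l.lpDone = false
  | _ => True

/-- The log as it will be after the current method, if this has passed its linearization point. -/
def effLog (l : Local O K V m) : List (LogEntry O K V m) :=
  match l.pc with
  | .rvEff d o k s => if s.isPost then putLL l.log (rvEntry l d o k) else l.log
  | _ => l.log

/-- What the log says about `⟨o, k⟩`. -/
def view (log : List (LogEntry O K V m)) (o : O) (k : K) : Option (Opn × Option V) :=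
  (findInLL log o k).map fun e => (e.opn, e.val)

/-- The history of the methods that have passed their linearization points agrees with the logs of
the live transactions. -/
structure HistI (n : ℕ) (L : T → Local O K V m) (H : SeqHistory O K V) : Prop where
  pos : 0 < n
  lt : ∀ e ∈ H, e.tx < n
  -- Since a live transaction has not committed, none of its further methods can change which
  -- committed update is the closest one at an earlier position.
  tx : ∀ u, Live (L u) → 0 < (L u).tx ∧ (L u).tx < n ∧ ∀ c, ¬ H.CommitAt c (L u).tx
  inj : ∀ u v, Live (L u) → Live (L v) → (L u).tx = (L v).tx → u = v
  view : ∀ u, Live (L u) → ∀ o k, H.ViewI (L u).tx o k (view (effLog (L u)) o k)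
  good : H.Good

theorem HistI.silent (h : HistI n L H) (hl : Live l' → Live (L u) ∧ l'.tx = (L u).tx ∧
    ∀ o k, HTOSTM.view (effLog l') o k = HTOSTM.view (effLog (L u)) o k) :
    HistI n (Function.update L u l') H := by
  have hlive : ∀ v, Live (Function.update L u l' v) → Live (L v) ∧
      (Function.update L u l' v).tx = (L v).tx ∧ ∀ o k,
        HTOSTM.view (effLog (Function.update L u l' v)) o k = HTOSTM.view (effLog (L v)) o k := by
    intro v hv
    by_cases huv : v = u
    · subst huv
      rw [Function.update_self] at hv ⊢
      exact hl hv
    · rw [Function.update_of_ne huv] at hv ⊢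
      exact ⟨hv, rfl, fun _ _ => rfl⟩
  refine ⟨h.pos, h.lt, fun v hv => ?_, fun v w hv hw htx => ?_, fun v hv o k => ?_, h.good⟩
  · obtain ⟨h1, h2, -⟩ := hlive v hv
    rw [h2]
    exact h.tx v h1
  · obtain ⟨h1, h2, -⟩ := hlive v hv
    obtain ⟨h3, h4, -⟩ := hlive w hw
    exact h.inj v w h1 h3 (by rw [← h2, ← h4, htx])
  · obtain ⟨h1, h2, h3⟩ := hlive v hv
    rw [h2, h3]
    exact h.view v h1 o k

/-- Covers all linearization points except that of `begin`. A method that ends its transaction makes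
`l'` not live, and then `hl` asks nothing; in particular a commit falls under this case. -/
theorem HistI.snoc (h : HistI n L H) {w : Meth O K V} (hlive : Live (L u))
    (hl : Live l' → l'.tx = (L u).tx ∧ w ≠ .tryC true ∧
      ∀ o k, ViewI (H ++ [⟨(L u).tx, w⟩]) (L u).tx o k (HTOSTM.view (effLog l') o k))
    (hnew : ∀ o k r, w.IsRv o k r → H.LR1 H.length (L u).tx o k r ∧
      (H.NoneBefore H.length (L u).tx o k → H.Closest H.length o k r)) :
    HistI n (Function.update L u l') (H ++ [⟨(L u).tx, w⟩]) := by
  have hu := h.tx u hlive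
  have hL : ∀ v, Live (Function.update L u l' v) → Live (L v) ∧
      (Function.update L u l' v).tx = (L v).tx := by
    intro v hv
    by_cases huv : v = u
    · subst huv
      rw [Function.update_self] at hv ⊢
      exact ⟨hlive, (hl hv).1⟩
    · rw [Function.update_of_ne huv] at hv ⊢
      exact ⟨hv, rfl⟩
  refine ⟨h.pos, fun e he => ?_, fun v hv => ?_, fun v w' hv hw htx => ?_, fun v hv o k => ?_,
    h.good.snoc hu.2.2 hnew⟩
  · rcases List.mem_append.1 he with he | he
    · exact h.lt e he
    · rw [List.mem_singleton.1 he]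
      exact hu.2.1
  · obtain ⟨h1, h2⟩ := hL v hv
    rw [h2]
    obtain ⟨h3, h4, h5⟩ := h.tx v h1
    refine ⟨h3, h4, fun c hc => ?_⟩
    rcases commitAt_snoc.1 hc with hc | ⟨-, hc, hw⟩
    · exact h5 c hc
    · obtain rfl := h.inj v u h1 hlive hc
      rw [Function.update_self] at hv
      exact (hl hv).2.1 hw
  · obtain ⟨h1, h2⟩ := hL v hv
    obtain ⟨h3, h4⟩ := hL w' hw
    exact h.inj v w' h1 h3 (by rw [← h2, ← h4, htx])
  · by_cases huv : v = u
    · subst huv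
      rw [Function.update_self] at hv ⊢
      rw [(hl hv).1]
      exact (hl hv).2.2 o k
    · rw [Function.update_of_ne huv] at hv ⊢
      exact (h.view v hv o k).snoc fun htx => absurd (h.inj v u hv hlive htx) huv

/-- The counter exceeds all numbers in use, so the new transaction differs from all others and has
no methods on any key, as its empty log says. -/
theorem HistI.begin (h : HistI n L H) (htx : l'.tx = n) (hlog : effLog l' = []) :
    HistI (n + 1) (Function.update L u l') (H ++ [⟨n, .stmBegin⟩]) := by
  have hn : ∀ c, ¬ H.CommitAt c n := fun c hc =>
    absurd (h.lt _ (List.mem_of_getElem? hc)) (lt_irrefl _)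
  have hL : ∀ v, Live (Function.update L u l' v) → v ≠ u → Live (L v) ∧
      Function.update L u l' v = L v := by
    intro v hv huv
    rw [Function.update_of_ne huv] at hv ⊢
    exact ⟨hv, rfl⟩
  have hLu : (Function.update L u l' u).tx = n := by rw [Function.update_self, htx]
  have hcom : ∀ c t, CommitAt (H ++ [⟨n, .stmBegin⟩]) c t → CommitAt H c t := fun c t hc => by
    rcases commitAt_snoc.1 hc with hc | ⟨-, -, hc⟩
    · exact hc
    · cases hc
  refine ⟨h.pos.trans (Nat.lt_succ_self n), fun e he => ?_, fun v hv => ?_, fun v w hv hw hvw => ?_,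
    fun v hv o k => ?_, h.good.snoc hn fun o k r hr => ?_⟩
  · rcases List.mem_append.1 he with he | he
    · exact (h.lt e he).trans (Nat.lt_succ_self n)
    · rw [List.mem_singleton.1 he]
      exact Nat.lt_succ_self n
  · by_cases huv : v = u
    · subst huv
      rw [hLu]
      exact ⟨h.pos, Nat.lt_succ_self n, fun c hc => hn c (hcom _ _ hc)⟩
    · obtain ⟨h1, h2⟩ := hL v hv huv
      rw [h2]
      obtain ⟨h3, h4, h5⟩ := h.tx v h1
      exact ⟨h3, h4.trans (Nat.lt_succ_self n), fun c hc => h5 c (hcom _ _ hc)⟩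
  · by_cases huv : v = u <;> by_cases huw : w = u
    · rw [huv, huw]
    · obtain ⟨h1, h2⟩ := hL w hw huw
      rw [huv, hLu, h2] at hvw
      exact absurd (h.tx w h1).2.1 hvw.not_gt.elim
    · obtain ⟨h1, h2⟩ := hL v hv huv
      rw [huw, hLu, h2] at hvw
      exact absurd (h.tx v h1).2.1 hvw.not_lt
    · obtain ⟨h1, h2⟩ := hL v hv huv
      obtain ⟨h3, h4⟩ := hL w hw huw
      rw [h2, h4] at hvw
      exact h.inj v w h1 h3 hvw
  · by_cases huv : v = u
    · subst huv
      rw [hLu, Function.update_self, hlog]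
      intro j _ hj
      rcases onKey_snoc.1 hj with ⟨w, hj, -⟩ | ⟨-, -, hj⟩
      · exact absurd (h.lt _ (List.mem_of_getElem? hj)) (lt_irrefl _)
      · cases hj
    · obtain ⟨h1, h2⟩ := hL v hv huv
      rw [h2]
      exact (h.view v h1 o k).snoc fun _ => by simp [Meth.key?]
  · exact absurd hr.key (by simp [Meth.key?])

theorem view_putLL {log : List (LogEntry O K V m)} (hlog : log.Pairwise EntryNe)
    (e : LogEntry O K V m) (o : O) (k : K) : view (putLL log e) o k =
      if e.obj = o ∧ e.key = k then some (e.opn, e.val) else view log o k := by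
  unfold view
  rw [findInLL_putLL hlog]
  split_ifs <;> rfl

/-- The view after a method on `⟨o, k⟩` that changes the log entry for `⟨o, k⟩` only. -/
theorem ViewI.put {log : List (LogEntry O K V m)} (hlog : log.Pairwise EntryNe) {tx : ℕ}
    {w : Meth O K V} {e : LogEntry O K V m} {o : O} {k : K} (hw : w.key? = some (o, k))
    (ho : e.obj = o) (hk : e.key = k)
    (h : ∀ o k, ViewI H tx o k (HTOSTM.view log o k))
    (he : ViewI (H ++ [⟨tx, w⟩]) tx o k (some (e.opn, e.val))) (o' : O) (k' : K) :
    ViewI (H ++ [⟨tx, w⟩]) tx o' k' (HTOSTM.view (putLL log e) o' k') := by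
  rw [view_putLL hlog]
  subst ho hk
  split_ifs with h1
  · obtain ⟨rfl, rfl⟩ := h1
    exact he
  · refine (h o' k').snoc fun _ h2 => h1 ?_
    rw [hw] at h2
    simpa using h2

theorem lpHistory_lp (t : T) (e : MExec O K V) : lpHistory (some (Event.lp t e)).toList = [e] := rfl

theorem isRv_rvMeth {d : Bool} {o o' : O} {k k' : K} {r : Option V} {r' : Result V}
    (h : (rvMeth d o k r').IsRv o' k' r) : o = o' ∧ k = k' ∧ r' = .ret r := by
  cases d <;> rcases h with h | h <;> simp [rvMeth] at h <;> exact h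

theorem rvMeth_key (d : Bool) (o : O) (k : K) (r : Result V) :
    (rvMeth d o k r).key? = some (o, k) := by
  cases d <;> rfl

theorem rvMeth_ne (d : Bool) (o : O) (k : K) (r : Result V) (ok : Bool) :
    rvMeth d o k r ≠ .tryC ok := by
  cases d <;> simp [rvMeth]

theorem rvMeth_abort_isFinal (d : Bool) (o : O) (k : K) :
    (rvMeth d o k (.abort : Result V)).isFinal = true := by
  cases d <;> rfl

/-- A DELETE entry stores nil, so a method answered from the log returns the stored value in all
cases. -/
theorem rvLocal_spec {d : Bool} {e : LogEntry O K V m} (he : e.opn = .delete → e.val = none) :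
    (rvLocal d e).1 = e.val ∧ (rvLocal d e).2.obj = e.obj ∧ (rvLocal d e).2.key = e.key ∧
      (d = false → (rvLocal d e).2.opn = e.opn ∧ (rvLocal d e).2.val = e.val) ∧
      (d = true → (rvLocal d e).2.opn = .delete ∧ (rvLocal d e).2.val = none) := by
  cases d <;> cases ho : e.opn <;> simp [rvLocal, ho] at he ⊢ <;> simp [he]

/-- `hcl` brings in the value read from shared memory, and `hrel` the progress of a release; the
rest depends on the log, the counter and the local step. -/
theorem HistI.step (h : HistI g.cntr L H) (hlog : LogI (L u))
    (hrel : ∀ ok s, (L u).pc = .rel ok s → (L u).lpDone = false → s = .loop ∨ s = .bp)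
    (hcl : ∀ d o k, (L u).pc = .rvEff d o k .unlockBp → H.Closest H.length o k (L u).val)
    (hs : stepThread hash u g (L u) = some (g', l', ev)) :
    HistI g'.cntr (Function.update L u l') (H ++ lpHistory ev.toList) := by
  have quiet : (Live l' → Live (L u) ∧ l'.tx = (L u).tx ∧
      ∀ o k, HTOSTM.view (effLog l') o k = HTOSTM.view (effLog (L u)) o k) → g'.cntr = g.cntr →
      lpHistory ev.toList = [] →
      HistI g'.cntr (Function.update L u l') (H ++ lpHistory ev.toList) := fun h1 h2 h3 => by
    rw [h2, h3, List.append_nil]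
    exact h.silent h1
  have hv := h.view u
  cases hpc : (L u).pc <;>
    simp only [stepThread, hpc, Option.some.injEq, Prod.mk.injEq, reduceCtorEq] at hs
  case stmBegin =>
    obtain ⟨rfl, rfl, rfl⟩ := hs
    exact h.begin rfl rfl
  case ins o k v =>
    obtain ⟨rfl, rfl, rfl⟩ := hs
    have hlive : Live (L u) := by simp [Live, hpc]
    have heff : effLog (L u) = (L u).log := by simp [effLog, hpc]
    have hv := hv hlive
    rw [heff] at hv
    refine h.snoc hlive (fun _ => ⟨rfl, by simp, ?_⟩) fun o k r hr => ?_
    · refine ViewI.put hlog.log rfl ?_ ?_ hv (viewI_ins _ _ _ _ _)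
      · cases hf : findInLL (L u).log o k with
        | none => rfl
        | some e => exact ((findInLL_eq_some hlog.log).1 hf).2.1
      · cases hf : findInLL (L u).log o k with
        | none => rfl
        | some e => exact ((findInLL_eq_some hlog.log).1 hf).2.2
    · rcases hr with hr | hr <;> cases hr
  case rvStart d o k =>
    have hlive : Live (L u) := by simp [Live, hpc]
    have heff : effLog (L u) = (L u).log := by simp [effLog, hpc]
    split at hs <;> rename_i hf <;> simp only [Option.some.injEq, Prod.mk.injEq] at hs <;>
      obtain ⟨rfl, rfl, rfl⟩ := hs
    · exact quiet (fun _ => ⟨hlive, rfl, fun _ _ => by rw [heff]; rfl⟩) rfl rfl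
    · rename_i e
      have hv := hv hlive
      rw [heff] at hv
      have h1 := hv o k
      simp only [HTOSTM.view, hf, Option.map_some] at h1
      have he : e.opn = .delete → e.val = none := by
        intro ho
        rw [ho] at h1
        exact h1.2.2.1
      obtain ⟨h2, h3, h4, h5, h6⟩ := rvLocal_spec (d := d) he
      obtain ⟨-, ho, hk⟩ := (findInLL_eq_some hlog.log).1 hf
      rw [h2]
      refine h.snoc hlive (fun _ => ⟨rfl, rvMeth_ne _ _ _ _ _, ?_⟩) fun o' k' r hr => ?_
      · refine ViewI.put hlog.log (rvMeth_key _ _ _ _) (h3.trans ho) (h4.trans hk) hv ?_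
        cases d
        · rw [(h5 rfl).1, (h5 rfl).2]
          exact h1.look_some
        · rw [(h6 rfl).1, (h6 rfl).2]
          exact viewI_del _ _ _ _ _
      · obtain ⟨rfl, rfl, hr'⟩ := isRv_rvMeth hr
        cases hr'
        exact ⟨h1.lr1, fun hn => absurd hn h1.not_noneBefore⟩
  case search c o k s =>
    obtain ⟨rfl, h1, -, -, h2, h3, h4⟩ := stepSearch_local hs
    refine quiet (fun _ => ⟨by simp [Live, hpc], h2, fun o k => ?_⟩) h3 rfl
    have h5 : effLog l' = l'.log := by
      rcases h4 with ⟨s', h4⟩ | h4 | h4 <;> cases c <;> simp [effLog, h4, RvPC.isPost]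
    rw [h5, h1]
    simp [effLog, hpc]
  case rvEff d o k s =>
    have hlive : Live (L u) := by simp [Live, hpc]
    obtain ⟨h1, h2, h3⟩ := stepRv_local hs
    rcases h3 with ⟨rfl, rfl, rfl⟩ | ⟨rfl, rfl, rfl⟩ | ⟨rfl, h3, s', h4, h5, h6⟩
    · have heff : effLog (L u) = (L u).log := by simp [effLog, hpc, RvPC.isPost]
      have hv := hv hlive
      rw [heff] at hv
      -- Without a log entry there is no earlier method on the key: the first rule is void, and the
      -- value has to be justified by `hcl`.
      have hn := hlog.new d o k (.inr ⟨_, hpc⟩)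
      have hvn := hv o k
      simp only [HTOSTM.view, hn, Option.map_none] at hvn
      rw [h2]
      refine h.snoc hlive (fun _ => ⟨rfl, rvMeth_ne _ _ _ _ _, ?_⟩) fun o' k' r hr => ?_
      · have h7 : effLog { L u with pc := .rvEff d o k .unlockRp } =
            putLL (L u).log (rvEntry (L u) d o k) := by simp [effLog, RvPC.isPost, rvEntry]
        rw [h7]
        refine ViewI.put hlog.log (rvMeth_key _ _ _ _) rfl rfl hv ?_
        cases d
        · exact hvn.look_none _
        · exact viewI_del _ _ _ _ _
      · obtain ⟨rfl, rfl, hr'⟩ := isRv_rvMeth hr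
        cases hr'
        exact ⟨NoneBefore.lr1 hvn, fun _ => hcl _ _ _ hpc⟩
    · exact quiet (fun _ => ⟨hlive, rfl, fun _ _ => by simp [effLog, hpc, RvPC.isPost]⟩) h2 rfl
    · refine quiet (fun _ => ⟨hlive, h1, fun o' k' => ?_⟩) h2 rfl
      have h7 : effLog l' = effLog (L u) := by
        simp only [effLog, h4, hpc, h5, h3]
        split_ifs with h8
        · rw [h6 h8]
        · rfl
      rw [h7]
  case rvAbort d o k =>
    obtain ⟨rfl, rfl, rfl⟩ := hs
    refine h.snoc (by simp [Live, hpc]) (fun hl => ?_) fun o' k' r hr => ?_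
    · simp [Live, rvMeth_abort_isFinal] at hl
    · have := (isRv_rvMeth hr).2.2
      cases this
  case tcStart =>
    obtain ⟨rfl, rfl, rfl⟩ := hs
    exact quiet (fun _ => ⟨by simp [Live, hpc], rfl, fun _ _ => by simp [effLog, hpc]⟩) rfl rfl
  case tcLoop =>
    split at hs <;> simp only [Option.some.injEq, Prod.mk.injEq] at hs <;>
      obtain ⟨rfl, rfl, rfl⟩ := hs <;>
      exact quiet (fun _ => ⟨by simp [Live, hpc], rfl, fun _ _ => by simp [effLog, hpc]⟩) rfl rfl
  case tcFound =>
    split at hs <;> simp only [Option.some.injEq, Prod.mk.injEq, reduceCtorEq] at hs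
    obtain ⟨rfl, rfl, rfl⟩ := hs
    exact quiet (fun _ => ⟨by simp [Live, hpc], rfl, fun _ _ => by simp [effLog, hpc]⟩) rfl rfl
  case tcAbort =>
    obtain ⟨rfl, rfl, rfl⟩ := hs
    refine h.snoc (by simp [Live, hpc]) (fun hl => ?_) fun o' k' r hr => ?_
    · simp [Live] at hl
    · rcases hr with hr | hr <;> cases hr
  case updLoop =>
    split at hs <;> simp only [Option.some.injEq, Prod.mk.injEq] at hs <;>
      obtain ⟨rfl, rfl, rfl⟩ := hs <;>
      exact quiet (fun _ => ⟨by simp [Live, hpc], rfl, fun _ _ => by simp [effLog, hpc]⟩) rfl rfl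
  case upd s =>
    split at hs <;> rename_i htd
    · simp at hs
    obtain ⟨rfl, h1, h2, h3, -, h4⟩ := stepUpd_local htd hs
    refine quiet (fun _ => ⟨by simp [Live, hpc], h2, fun _ _ => ?_⟩) h3 rfl
    have h5 : effLog l' = l'.log := by rcases h4 with ⟨s', h4⟩ | h4 <;> simp [effLog, h4]
    rw [h5, h1]
    simp [effLog, hpc]
  case rel ok s =>
    have hr := hrel ok s hpc
    have hnew : ∀ o k r, (Meth.tryC ok : Meth O K V).IsRv o k r → H.LR1 H.length (L u).tx o k r ∧
        (H.NoneBefore H.length (L u).tx o k → H.Closest H.length o k r) := by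
      intro o k r hr
      rcases hr with hr | hr <;> cases hr
    cases s <;> simp only [stepRel] at hs
    case loop =>
      split at hs <;> simp only [Option.some.injEq, Prod.mk.injEq] at hs <;>
        obtain ⟨rfl, rfl, rfl⟩ := hs
      · cases hlp : (L u).lpDone
        · exact h.snoc (by simp [Live, hpc, hlp]) (fun hl => by simp [Live, Meth.isFinal] at hl) hnew
        · simpa only [hlp] using quiet (fun hl => by simp [Live, Meth.isFinal] at hl) rfl
            (by simp only [hlp]; rfl)
      · exact quiet (fun hl => ⟨by simpa [Live, hpc] using hl, rfl,
          fun _ _ => by simp [effLog, hpc]⟩) rfl rfl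
    case bp =>
      split at hs <;> simp only [Option.some.injEq, Prod.mk.injEq, reduceCtorEq] at hs
      obtain ⟨rfl, rfl, rfl⟩ := hs
      cases hlp : (L u).lpDone
      · rw [shared_unlock_cntr]
        exact h.snoc (by simp [Live, hpc, hlp]) (fun hl => by simp [Live] at hl) hnew
      · simpa only [hlp] using quiet (fun hl => by simp [Live] at hl) (shared_unlock_cntr _)
          (by simp only [hlp]; rfl)
    all_goals
      (repeat' split at hs) <;>
      (try simp only [Option.some.injEq, Prod.mk.injEq, reduceCtorEq] at hs) <;>
      obtain ⟨rfl, rfl, rfl⟩ := hs <;>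
      refine quiet (fun hl => ?_) (by first | rfl | exact shared_unlock_cntr _) rfl <;>
      have := hr hl <;> simp at this
  case tryA =>
    obtain ⟨rfl, rfl, rfl⟩ := hs
    refine h.snoc (by simp [Live, hpc]) (fun hl => ?_) fun o' k' r hr => ?_
    · simp [Live, Meth.isFinal] at hl
    · rcases hr with hr | hr <;> cases hr
  case ret r =>
    obtain ⟨rfl, rfl, rfl⟩ := hs
    refine quiet (fun hl => ?_) rfl rfl
    cases hr : r.isFinal
    · exact ⟨by simp [Live, hpc, hr], rfl, fun _ _ => by simp [effLog, hpc]⟩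
    · simp [Live, hr] at hl

theorem HistI.invoke (h : HistI n L H) {op : Op O K V} {p : PC O K V}
    (hp : invoke (L u).pc op = some p) : HistI n (Function.update L u { L u with pc := p }) H := by
  refine h.silent fun hl => ?_
  unfold HTOSTM.invoke at hp
  split at hp <;> rename_i hpc <;> simp only [Option.some.injEq, reduceCtorEq] at hp <;> subst hp <;>
    first
      | (simp [Live] at hl; done)
      | exact ⟨by simp [Live, hpc], rfl, fun _ _ => by simp [effLog, hpc]⟩

/-- A step is a commit, or it keeps the keys dirty that are so. -/
theorem step_commit_or (hs : stepThread hash u g l = some (g', l', ev))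
    (hrel : ∀ ok s, l.pc = .rel ok s → l.lpDone = false → ok = true ∧ (s = .loop ∨ s = .bp)) :
    (∃ s, l.pc = .rel true s ∧ l.lpDone = false ∧ ev = some (.lp u ⟨l.tx, .tryC true⟩)) ∨
      ((∀ o k, Dirty l o k → Dirty l' o k) ∧ ∀ t e, ev = some (.lp t e) → e.meth ≠ .tryC true) := by
  have clean : (∀ o k, ¬ Dirty l o k) → (∀ o k, Dirty l o k → Dirty l' o k) :=
    fun h o k hd => absurd hd (h o k)
  cases hpc : l.pc <;>
    simp only [stepThread, hpc, Option.some.injEq, Prod.mk.injEq, reduceCtorEq] at hs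
  case rel ok s =>
    have hr := hrel ok s hpc
    cases hlp : l.lpDone
    · obtain ⟨rfl, rfl | rfl⟩ := hr hlp
      · cases htd : l.todo <;>
          simp only [stepRel, htd, hlp, Option.some.injEq, Prod.mk.injEq] at hs <;>
          obtain ⟨rfl, rfl, rfl⟩ := hs
        · exact .inl ⟨_, rfl, rfl, rfl⟩
        · refine .inr ⟨fun o k hd => ?_, by simp⟩
          simpa [Dirty, hpc, htd, hlp] using hd
      · cases htd : l.todo <;>
          simp only [stepRel, htd, hlp, Option.some.injEq, Prod.mk.injEq, reduceCtorEq] at hs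
        exact .inl ⟨_, rfl, rfl, hs.2.2.symm⟩
    · refine .inr ⟨clean fun o k => by simp [Dirty, hpc, hlp], ?_⟩
      cases s <;> simp only [stepRel, hlp, if_true] at hs <;> (repeat' split at hs) <;>
        simp only [Option.some.injEq, Prod.mk.injEq, reduceCtorEq] at hs <;>
        simp [← hs.2.2]
  case upd s =>
    split at hs <;> rename_i htd
    · simp at hs
    obtain ⟨rfl, -, -, -, h1, h2⟩ := stepUpd_local htd hs
    refine .inr ⟨fun o k hd => ?_, by simp⟩
    have h3 : ∃ e ∈ l'.done ++ l'.todo, e.obj = o ∧ e.key = k := by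
      simp only [Dirty, hpc] at hd
      obtain ⟨e, h4, h5, h6⟩ := hd
      have h7 : e.sig ∈ (l'.done ++ l'.todo).map LogEntry.sig := h1 ▸ List.mem_map_of_mem h4
      obtain ⟨e', h8, h9⟩ := List.mem_map.1 h7
      simp only [LogEntry.sig, Prod.mk.injEq] at h9
      exact ⟨e', h8, h9.1.trans h5, h9.2.1.trans h6⟩
    rcases h2 with ⟨s', h2⟩ | h2 <;> simpa only [Dirty, h2] using h3
  case updLoop =>
    split at hs <;> rename_i htd <;> simp only [Option.some.injEq, Prod.mk.injEq] at hs <;>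
      obtain ⟨rfl, rfl, rfl⟩ := hs <;> refine .inr ⟨fun o k hd => ?_, by simp⟩ <;>
      simpa [Dirty, hpc, htd] using hd
  case search c o k s =>
    obtain ⟨rfl, -⟩ := stepSearch_local hs
    exact .inr ⟨clean fun o k => by simp [Dirty, hpc], by simp⟩
  case rvEff d o k s =>
    obtain ⟨-, -, h3⟩ := stepRv_local hs
    refine .inr ⟨clean fun o k => by simp [Dirty, hpc], ?_⟩
    rcases h3 with ⟨-, -, rfl⟩ | ⟨-, rfl, -⟩ | ⟨rfl, -⟩ <;> simp [rvMeth_ne]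
  all_goals
    refine .inr ⟨clean fun o k => by simp [Dirty, hpc], ?_⟩
    (repeat' split at hs) <;>
      (try simp only [Option.some.injEq, Prod.mk.injEq, reduceCtorEq] at hs) <;>
      simp [← hs.2.2, rvMeth_ne]

end HistoryInv

/-! ### The content invariant, and the induction over executions. -/

section Executions

variable {T O K V : Type*} [DecidableEq T] [DecidableEq O] [LinearOrder K] {m : ℕ}
variable {hash : O → K → Fin m} {u t : T} {S S' : Mem T O K V m} {L : T → Local O K V m}
  {H : SeqHistory O K V} {ks : List (O × K)} {g' : Shared T O K V m} {l l' : Local O K V m}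
  {ev : Option (Event T O K V)}

/-- For every key that is not being updated, the blue list stores the closest committed update. -/
def ContentI (hash : O → K → Fin m) (ks : List (O × K)) (S : Mem T O K V m) (L : T → Local O K V m)
    (H : SeqHistory O K V) : Prop :=
  ∀ o k, (o, k) ∈ ks → (∀ t, ¬ Dirty (L t) o k) →
    ∃ r, H.Closest H.length o k r ∧ Content S (o, hash o k) (nodeKey k) r

/-- The invariant of the executions. -/
structure ExecI (hash : O → K → Fin m) (ks : List (O × K)) (S : Mem T O K V m)
    (L : T → Local O K V m) (H : SeqHistory O K V) : Prop where
  mem : MemInv hash S L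
  log : ∀ t, LogI (L t)
  hist : HistI S.sh.cntr L H
  content : ContentI hash ks S L H

theorem DoneOK.content_insert {e : LogEntry O K V m} (h : DoneOK hash S e) (hS : S.WF) {v : V}
    (ho : e.opn = .insert) (hv : e.val = some v) :
    Content S (e.bucket hash) (nodeKey e.key) (some v) := by
  obtain ⟨n, -, h1, h2, h3⟩ := h.ins ho
  have hn : S.Blue (e.bucket hash) n := h.blue.tail h1
  refine ⟨fun a ha hk => ?_, fun _ => ⟨n, hn, h2⟩⟩
  obtain rfl := hS.blue_key_inj ha hn (hk.trans h2.symm)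
  exact ⟨h3.trans hv, by simp⟩

theorem DoneOK.content_delete {e : LogEntry O K V m} (h : DoneOK hash S e) (hS : S.WF)
    (ho : e.opn ≠ .insert) : Content S (e.bucket hash) (nodeKey e.key) none := by
  refine ⟨fun a ha hk => ?_, fun h => absurd rfl h⟩
  have hp : S.Pred (e.bucket hash) (nodeKey e.key) e.bp :=
    ⟨h.blue, h.lt, fun c hc => (h.del ho c hc).le⟩
  exact absurd hk (h.del ho a (hp.next_of_key hS ha hk)).ne'

/-- A successful search for the key of a clean entry reads the closest committed update. -/
theorem ExecI.closest (h : ExecI hash ks S L H) {d : Bool} {o : O} {k : K}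
    (hpc : (L u).pc = .rvEff d o k .unlockBp) (hk : (o, k) ∈ ks) :
    H.Closest H.length o k (L u).val := by
  have hS := h.mem.wf
  obtain ⟨h1, h2, h3⟩ := (li_rv_iff hpc).1 (h.mem.li u)
  have hown : 0 < S.cnt u (L u).bp := h1.own (by simp [rvHeld])
  -- A thread for which the key is dirty holds the lock of its blue predecessor. That node is `(L
  -- u).bp`, locked by `u`, so the thread is `u`, which is not in `tryC`.
  obtain ⟨r, h4, h5, h6⟩ := h.content o k hk fun t hd => by
    obtain ⟨p, h4, h5⟩ := (h.mem.li t).dirty hd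
    rw [h4.unique hS h2.win.pred] at h5
    obtain rfl := S.cnt_unique h5 hown
    simp [Dirty, hpc] at hd
  suffices hr : (L u).val = r by rwa [hr]
  rcases h3 with ⟨h7, h8⟩ | ⟨h7, h8⟩
  · rw [h8]
    exact (h5 _ h2.win.blue_next h7).1
  · rw [h8]
    -- Were a value stored for the key, its node would be `c_b`, the next one after the predecessor,
    -- but `c_b` has another key.
    by_contra hr
    obtain ⟨a, ha, hak⟩ := h6 fun h => hr h.symm
    rw [h2.win.eq_next_of_key hS ha hak] at hak
    exact h7 hak

/-- Outside commits dirty keys stay dirty, so a key that is clean afterwards was clean before; then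
neither its content nor its closest committed update has changed. -/
theorem ContentI.step (h : ExecI hash ks S L H) (hC : ∀ o k r, ¬ Dirty (L u) o k →
      Content S (o, hash o k) (nodeKey k) r → Content S' (o, hash o k) (nodeKey k) r)
    (hd : ∀ o k, Dirty (L u) o k → Dirty l' o k) {H' : SeqHistory O K V}
    (hH : H' = H ∨ ∃ w, Live (L u) ∧ w ≠ .tryC true ∧ H' = H ++ [⟨(L u).tx, w⟩] ∨
      H' = H ++ [⟨S.sh.cntr, .stmBegin⟩]) :
    ContentI hash ks S' (Function.update L u l') H' := by
  intro o k hk hnd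
  have hnu : ¬ Dirty (L u) o k := fun h1 => hnd u (by
    rw [Function.update_self]
    exact hd o k h1)
  obtain ⟨r, h1, h2⟩ := h.content o k hk fun t => by
    by_cases htu : t = u
    · exact htu ▸ hnu
    · have := hnd t
      rwa [Function.update_of_ne htu] at this
  refine ⟨r, ?_, hC o k r hnu h2⟩
  rcases hH with rfl | ⟨w, ⟨h3, h4, rfl⟩ | rfl⟩
  · exact h1
  · exact h1.succ (h.hist.tx u h3).2.2 fun h5 => absurd h5 h4
  · exact h1.succ (fun c hc => absurd (h.hist.lt _ (List.mem_of_getElem? hc)) (lt_irrefl _))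
      fun h5 => by cases h5

/-- The commit of a transaction turns its updates into the closest committed ones. -/
theorem ContentI.commit (h : ExecI hash ks S L H) (hQ : Quiet u S S') {s : RelPC}
    (hpc : (L u).pc = .rel true s) (hlp : (L u).lpDone = false) :
    ContentI hash ks S' (Function.update L u l') (H ++ [⟨(L u).tx, .tryC true⟩]) := by
  have hS := h.mem.wf
  obtain ⟨-, hs, hdone⟩ := (h.mem.li u).rel_pc hpc hlp
  have hlive : Live (L u) := by simp [Live, hpc, hlp]
  have hview := h.hist.view u hlive
  have heff : effLog (L u) = (L u).log := by simp [effLog, hpc]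
  rw [heff] at hview
  have htr : tracked (L u) = some (L u).todo := by simp [tracked, hpc, hlp]
  have hent := (h.log u).ent _ htr
  have hmem : ∀ e, e ∈ orderedLL (L u).log ↔ e ∈ (L u).log ∧ e.opn.isUpdate = true := fun e =>
    (List.perm_insertionSort _ _).mem_iff.trans List.mem_filter
  intro o k hk hnd
  by_cases hdu : Dirty (L u) o k
  -- A key cleaned by this commit: `DoneOK` says what the blue list stores for it, and the view of
  -- the log says that this is the last update of the transaction.
  · have hd : ∃ e ∈ (L u).todo, e.obj = o ∧ e.key = k := by
      simp only [Dirty, hpc] at hdu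
      exact hdu.2
    obtain ⟨e, he, rfl, rfl⟩ := hd
    have h1 : e.sig ∈ (orderedLL (L u).log).map LogEntry.sig := hent ▸ List.mem_map_of_mem he
    obtain ⟨e', h2, h3⟩ := List.mem_map.1 h1
    simp only [LogEntry.sig, Prod.mk.injEq] at h3
    obtain ⟨h4, h5⟩ := (hmem e').1 h2
    have hf := (findInLL_eq_some (h.log u).log).2 ⟨h4, h3.1, h3.2.1⟩
    have hv := hview e.obj e.key
    simp only [view, hf, Option.map_some, h3.2.2.1, h3.2.2.2] at hv
    have hde := hdone e he
    cases ho : e.opn with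
    | insert =>
      rw [ho] at hv
      obtain ⟨q, v, h6, h7, h8⟩ := hv.2.2
      exact ⟨some v, Closest.commit h6 h7 (.inl ⟨v, rfl, rfl⟩),
        hQ.content hS (hde.content_insert hS ho h8)⟩
    | delete =>
      rw [ho] at hv
      obtain ⟨-, q, r, h6, h7⟩ := hv.2.2
      exact ⟨none, Closest.commit h6 h7 (.inr ⟨⟨r, rfl⟩, rfl⟩),
        hQ.content hS (hde.content_delete hS (by simp [ho]))⟩
    | lookup =>
      rw [h3.2.2.1, ho] at h5
      simp [Opn.isUpdate] at h5
  · obtain ⟨r, h1, h2⟩ := h.content o k hk fun t => by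
      by_cases htu : t = u
      · exact htu ▸ hdu
      · have := hnd t
        rwa [Function.update_of_ne htu] at this
    -- The transaction has no update on such a key; otherwise its log would hold an update entry,
    -- which would be tracked and make the key dirty.
    refine ⟨r, h1.succ (h.hist.tx u hlive).2.2 fun _ y hy => ?_, hQ.content hS h2⟩
    have hv := hview o k
    cases hf : findInLL (L u).log o k with
    | none =>
      simp only [view, hf, Option.map_none] at hv
      obtain ⟨w, h3, h4⟩ := hy
      exact hv y (lt_of_getElem? h3) ⟨w, h3, h4.key⟩
    | some e =>
      simp only [view, hf, Option.map_some] at hv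
      obtain ⟨h3, h4, h5⟩ := (findInLL_eq_some (h.log u).log).1 hf
      cases ho : e.opn with
      | lookup =>
        rw [ho] at hv
        exact hv.2.2 y hy
      | _ =>
        refine hdu ?_
        have h6 : e.sig ∈ (L u).todo.map LogEntry.sig :=
          hent ▸ List.mem_map_of_mem ((hmem e).2 ⟨h3, by rw [ho]; rfl⟩)
        obtain ⟨e', h7, h8⟩ := List.mem_map.1 h6
        simp only [LogEntry.sig, Prod.mk.injEq] at h8
        simp only [Dirty, hpc]
        exact ⟨hlp, e', h7, h8.1.trans h4, h8.2.1.trans h5⟩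

/-- What a step appends to the history. -/
theorem lpHistory_step {hash : O → K → Fin m} {g : Shared T O K V m}
    (hs : stepThread hash u g l = some (g', l', ev)) :
    lpHistory ev.toList = [] ∨ ∃ w, Live l ∧ lpHistory ev.toList = [⟨l.tx, w⟩] ∧
      ev = some (.lp u ⟨l.tx, w⟩) ∨ lpHistory ev.toList = [⟨g.cntr, .stmBegin⟩] := by
  cases hpc : l.pc <;>
    simp only [stepThread, hpc, Option.some.injEq, Prod.mk.injEq, reduceCtorEq] at hs
  case stmBegin =>
    rw [← hs.2.2]
    exact .inr ⟨.stmBegin, .inr rfl⟩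
  case search c o k s =>
    rw [(stepSearch_local hs).1]
    exact .inl rfl
  case rvEff d o k s =>
    obtain ⟨-, -, h3⟩ := stepRv_local hs
    rcases h3 with ⟨-, -, rfl⟩ | ⟨-, rfl, -⟩ | ⟨rfl, -⟩
    · exact .inr ⟨_, .inl ⟨by simp [Live, hpc], rfl, rfl⟩⟩
    · exact .inl rfl
    · exact .inl rfl
  case upd s =>
    split at hs <;> rename_i htd
    · simp at hs
    rw [(stepUpd_local htd hs).1]
    exact .inl rfl
  case rel ok s =>
    cases hlp : l.lpDone <;>
      cases s <;> simp only [stepRel, hlp, if_true] at hs <;> (repeat' split at hs) <;>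
      (try simp only [Option.some.injEq, Prod.mk.injEq, reduceCtorEq] at hs) <;>
      rw [← hs.2.2] <;>
      first
        | exact .inl rfl
        | exact .inr ⟨_, .inl ⟨by simp [Live, hpc, hlp], rfl, rfl⟩⟩
  all_goals
    (repeat' split at hs) <;>
      (try simp only [Option.some.injEq, Prod.mk.injEq, reduceCtorEq] at hs) <;>
      rw [← hs.2.2] <;>
      first
        | exact .inl rfl
        | exact .inr ⟨_, .inl ⟨by simp [Live, hpc], rfl, rfl⟩⟩

theorem ExecI.step (h : ExecI hash ks S L H)
    (hs : stepThread hash u S.sh (L u) = some (g', l', ev))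
    (hks : ∀ x ∈ usedKeys (lpHistory ev.toList), x ∈ ks) :
    ∃ S' : Mem T O K V m, S'.sh = g' ∧
      ExecI hash ks S' (Function.update L u l') (H ++ lpHistory ev.toList) := by
  have hrel : ∀ ok s, (L u).pc = .rel ok s → (L u).lpDone = false →
      ok = true ∧ (s = .loop ∨ s = .bp) := fun ok s hpc hlp =>
    ⟨((h.mem.li u).rel_pc hpc hlp).1, ((h.mem.li u).rel_pc hpc hlp).2.1⟩
  have hrel' := fun ok s hpc hlp => (hrel ok s hpc hlp).2
  have hlog : ∀ t, LogI (Function.update L u l' t) := fun t => by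
    by_cases htu : t = u
    · subst htu
      rw [Function.update_self]
      exact (h.log t).step hrel' hs
    · rw [Function.update_of_ne htu]
      exact h.log t
  -- The method linearized by this step operates on the key, so the key is among those that the
  -- initial transaction deletes.
  have hhist := h.hist.step (h.log u) hrel' (fun d o k hpc => h.closest hpc (hks _ (by
    have hs' := hs
    simp only [stepThread, hpc, stepRv, Option.some.injEq, Prod.mk.injEq] at hs'
    rw [← hs'.2.2, lpHistory_lp]
    simp [usedKeys, rvMeth_key]))) hs
  rcases step_commit_or hs hrel with ⟨s, h1, h2, rfl⟩ | ⟨h1, h2⟩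
  · have hs' := hs
    simp only [stepThread, h1] at hs'
    obtain ⟨S', rfl, h3, h4⟩ := step_rel h.mem h1 hs'
    exact ⟨S', rfl, h3, hlog, hhist, ContentI.commit h h4 h1 h2⟩
  · obtain ⟨S', rfl, h3, h4⟩ := step_mem h.mem (h.log u) hs
    refine ⟨S', rfl, h3, hlog, hhist, ContentI.step h h4 h1 ?_⟩
    rcases lpHistory_step hs with h5 | ⟨w, ⟨h5, h6, h7⟩ | h5⟩
    · exact .inl (by rw [h5, List.append_nil])
    · exact .inr ⟨w, .inl ⟨h5, h2 _ _ h7, by rw [h6]⟩⟩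
    · exact .inr ⟨.stmBegin, .inr (by rw [h5])⟩

theorem ExecI.invoke (h : ExecI hash ks S L H) {op : Op O K V} {p : PC O K V}
    (hp : invoke (L u).pc op = some p) :
    ExecI hash ks S (Function.update L u { L u with pc := p }) H where
  mem := h.mem.invoke hp
  log t := by
    by_cases htu : t = u
    · subst htu
      rw [Function.update_self]
      exact (h.log t).invoke hp
    · rw [Function.update_of_ne htu]
      exact h.log t
  hist := h.hist.invoke hp
  content := ContentI.step h (fun _ _ _ _ h => h) (fun o k hd => by
    unfold HTOSTM.invoke at hp
    unfold Dirty at hd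
    split at hp <;> rename_i hpc <;> simp [hpc] at hd hp) (.inl rfl)

/-- The initial memory: only the sentinels are published. -/
def Mem.initial : Mem T O K V m where
  sh := Shared.initial
  st
    | .head o b => .pub (o, b)
    | .tail o b => .pub (o, b)
    | .cell _ => .free

theorem Mem.initial_wf : (Mem.initial : Mem T O K V m).WF where
  headPub _ _ := rfl
  headKey _ _ := rfl
  freeCell _ _ := rfl
  blPub a B b ha hb := by
    cases a <;> simp [Mem.initial, Mem.bl, Shared.initial] at ha hb
    subst hb ha
    exact ⟨rfl, bot_lt_top⟩
  rlPub a B b ha hb := by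
    cases a <;> simp [Mem.initial, Mem.rl, Shared.initial] at ha hb
    subst hb ha
    rfl
  cntSt t a h := by cases a <;> simp [Mem.cnt, Node.cnt, Mem.initial, Shared.initial] at h

theorem ExecI.initial (hash : O → K → Fin m) (ks : List (O × K)) :
    ExecI hash ks (Mem.initial : Mem T O K V m) (fun _ => {}) (initialTx ks) where
  mem := by
    refine ⟨Mem.initial_wf, fun t => ⟨Held.nil, trivial⟩, fun a B ha _ => ?_⟩
    have h1 : (Mem.initial : Mem T O K V m).marked a = false := by
      cases a <;> rfl
    refine ⟨fun _ => ?_, fun _ => h1⟩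
    cases a <;> simp [Mem.initial] at ha <;> subst ha
    · exact .refl
    · exact .single rfl
  log t := LogI.untracked List.Pairwise.nil rfl (by simp)
  hist := by
    refine ⟨Nat.one_pos, fun e he => ?_, fun u hu => absurd hu id, fun u v hu => absurd hu id,
      fun u hu => absurd hu id, good_initialTx ks⟩
    rw [tx_initialTx he]
    exact Nat.one_pos
  content o k hk _ := by
    refine ⟨none, closest_initialTx hk, fun a ha hak => ?_, fun h => absurd rfl h⟩
    have h1 := Mem.initial_wf.blue_pub ha
    cases a <;> simp [Mem.initial, Mem.key, Shared.initial, nodeKey] at h1 hak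

theorem lpHistory_append (E F : List (Event T O K V)) :
    lpHistory (E ++ F) = lpHistory E ++ lpHistory F := List.filterMap_append

/-- The initial transaction depends on all keys of the complete execution. Fixing a list `ks` that
contains them keeps it the same for all prefixes, which makes the induction possible. -/
theorem Exec.invariant {E : List (Event T O K V)} {σ : State T O K V m} (h : Exec hash E σ)
    (hks : ∀ x ∈ usedKeys (lpHistory E), x ∈ ks) :
    ∃ S : Mem T O K V m, S.sh = σ.shared ∧
      ExecI hash ks S σ.locals (initialTx ks ++ lpHistory E) := by
  induction h with
  | init => exact ⟨Mem.initial, rfl, by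
      rw [show lpHistory ([] : List (Event T O K V)) = [] from rfl, List.append_nil]
      exact ExecI.initial hash ks⟩
  | @invoke E σ h t op p hp ih =>
    have hE : lpHistory (E ++ [.inv t op]) = lpHistory E := by
      rw [lpHistory_append]
      exact List.append_nil _
    rw [hE] at hks ⊢
    obtain ⟨S, h1, h2⟩ := ih hks
    exact ⟨S, h1, h2.invoke hp⟩
  | @step E σ h t g l ev hs ih =>
    have hk : usedKeys (lpHistory (E ++ ev.toList)) =
        usedKeys (lpHistory E) ++ usedKeys (lpHistory ev.toList) := by
      rw [lpHistory_append]
      exact List.filterMap_append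
    rw [hk] at hks
    obtain ⟨S, h1, h2⟩ := ih fun x hx => hks x (List.mem_append_left _ hx)
    rw [← h1] at hs
    obtain ⟨S', h3, h4⟩ := h2.step hs fun x hx => hks x (List.mem_append_right _ hx)
    refine ⟨S', h3, ?_⟩
    rw [lpHistory_append, ← List.append_assoc]
    exact h4

theorem Exec.good {E : List (Event T O K V)} {σ : State T O K V m} (h : Exec hash E σ) :
    (seqHistory E).Good := by
  obtain ⟨S, -, h1⟩ := h.invariant (ks := usedKeys (lpHistory E)) fun _ hx => hx
  exact h1.hist.good

end Executions

end HTOSTM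

theorem mainTheorem3 {T O K V : Type*} [DecidableEq T] [DecidableEq O] [LinearOrder K] {m : ℕ}
    (hash : O → K → Fin m) (E : List (HTOSTM.Event T O K V)) (σ : HTOSTM.State T O K V m)
    (hE : HTOSTM.Exec hash E σ) :
    (HTOSTM.seqHistory E).Legal ∧ (HTOSTM.seqHistory E).ReturnsClosest :=
  ⟨hE.good.legal, hE.good.returnsClosest⟩
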